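/- **Setting.** Let $M$ be a smooth ($C^\infty$, Hausdorff, finite-dimensional) manifold and $V\to M$ a smooth vector bundle. *Gauge algebroid.* $\mathfrak D V$ is the vector bundle whose fibre at $m$ consists of the pairs of an $\mathbb R$-linear map $\mathfrak d:\Gamma(V)\to V_m$ and a vector $x=\alpha(\mathfrak d)\in T_mM$ with $\mathfrak d(fu)=f(m)\,\mathfrak d(u)+x(f)\,u(m)$. Its smooth sections act as derivations of $\Gamma(V)$; its bracket is the commutator, and its anchor is $\alpha$. There is an inclusion $\mathbb i:\mathfrak{gl}(V)\hookrightarrow\mathfrak D V$, $\Phi\mapsto (u\mapsto\Phi(u(m)))$. *Jet bundle.* $\mathfrak J V\subset \mathrm{Hom}(\mathfrak D V,V)$ is the bundle of $\nu$ with $\nu(\Phi)=\Phi(\nu(\mathbf 1_V))$ for all $\Phi\in\mathfrak{gl}(V)$; the 1-jet $[u]_m$ of a section $u$ is the element $\mathfrak d\mapsto \mathfrak d u$. Put $\mathbb p:\mathfrak J V\to V$, $\mathbb p(\nu)=\nu(\mathbf 1_V)$, and $\mathbb e:\mathrm{Hom}(TM,V)\to\mathfrak J V$, $\mathbb e(y)(\mathfrak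 d)=y(\alpha(\mathfrak d))$. Write $\mathbb d u\in\Gamma(\mathfrak J V)$ for the section $m\mapsto[u]_m$. *Jet Lie algebroid.* If $V$ is a Lie algebroid with anchor $\rho$, let $\pi:\mathfrak J V\to\mathfrak D V$ be the bundle map with $\pi([u]_m)=[u,\cdot\,](m)$. Then $\mathfrak J V$ carries the anchor $\alpha\circ\pi=\rho\circ\mathbb p$ and the bracket $$[\mu,\nu]_\pi=L_{\pi\mu}\nu-L_{\pi\nu}\mu-\mathbb d\langle\nu,\pi\mu\rangle,\qquad \langle L_{\mathfrak d}\nu,\mathfrak d'\rangle=\mathfrak d\langle\nu,\mathfrak d'\rangle-\langle\nu,[\mathfrak d,\mathfrak d']\rangle .$$ *Poisson structure.* Let $\Pi:T^*M\to TM$ be a Poisson structure, that is, a smooth skew-symmetric bundle map such that $\{f,g\}=dg(\Pi\,df)$ satisfies the Jacobi identity. $T^*M$ is regarded as a Lie algebroid with anchor $\Pi$ and bracket $[\alpha,\beta]=L_{\Pi\alpha}\beta-L_{\Pi\beta}\alpha-d(\beta(\Pi\alpha))$; $TM$ has its usual Lie algebroid structure. **Theorem.** Let $(M,\Pi)$ be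 a Poisson manifold. Then $\mathfrak J(T^*M)$ and $\mathfrak D(TM)$, with the structures above, are Lie algebroids over $M$, and there is a morphism of Lie algebroids over the identity of $M$ $$\hat\Pi:\mathfrak J(T^*M)\to\mathfrak D(TM),\qquad \hat\Pi([\alpha]_m)(X)=[\Pi\alpha,X](m)\quad(\alpha\in\Omega^1(M),\ X\in\mathfrak X(M)),$$ for which the following diagram with exact rows commutes: $$\begin{array}{ccccccccc} 0&\to&\mathrm{Hom}(TM,T^*M)&\xrightarrow{\ \mathbb e\ }&\mathfrak J(T^*M)&\xrightarrow{\ \mathbb p\ }&T^*M&\to&0\\ &&\downarrow{\scriptstyle -\mathbf 1\otimes\Pi}&&\downarrow{\scriptstyle\hat\Pi}&&\downarrow{\scriptstyle\Pi}&&\\ 0&\to&\mathfrak{gl}(TM)&\xrightarrow{\ \mathbb i\ }&\mathfrak D(TM)&\xrightarrow{\ \alpha\ }&TM&\to&0 \end{array}$$ that is, $\hat\Pi(\mathbb e(y))=\mathbb i(-\Pi\circ y)$ for $y\in\mathrm{Hom}(T_mM,T^*_mM)$, and $\alpha\circ\hat\Pi=\Pi\circ\mathbb p$. If every $\Pi_m$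 is bijective, then $\hat\Pi$ is an isomorphism of Lie algebroids. In particular, let $(M,\omega)$ be a symplectic manifold. Then there is a Poisson structure $\Pi$ with $\Pi(\omega(x,\cdot))=x$ for all $x\in TM$, and for this $\Pi$ a map $\hat\Pi$ as above that is an isomorphism of Lie algebroids $\mathfrak J(T^*M)\cong\mathfrak D(TM)$. -/

import Mathlib

open Bundle VectorField Filter
open scoped Manifold ContDiff Topology


noncomputable section

section Sections

variable {E : Type*} [NormedAddCommGroup E] [NormedSpace ℝ E] [FiniteDimensional ℝ E]
  {M : Type*} [TopologicalSpace M] [ChartedSpace E M]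

/-- The algebra of smooth functions on `M`. -/
abbrev SmoothFun (E M : Type*) [NormedAddCommGroup E] [NormedSpace ℝ E]
    [TopologicalSpace M] [ChartedSpace E M] : Type _ :=
  C^∞⟮𝓘(ℝ, E), M; 𝓘(ℝ, ℝ), ℝ⟯

/-- The smooth sections of a vector bundle `V` with model fibre `F`. -/
abbrev Sec (E F : Type*) {M : Type*} [NormedAddCommGroup E] [NormedSpace ℝ E]
    [NormedAddCommGroup F] [NormedSpace ℝ F] [TopologicalSpace M] [ChartedSpace E M]
    (V : M → Type*) [TopologicalSpace (TotalSpace F V)] [∀ m, TopologicalSpace (V m)]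
    [FiberBundle F V] : Type _ :=
  Cₛ^∞⟮𝓘(ℝ, E); F, V⟯

/-- Smooth vector fields. -/
abbrev VF (E M : Type*) [NormedAddCommGroup E] [NormedSpace ℝ E]
    [TopologicalSpace M] [ChartedSpace E M] [IsManifold 𝓘(ℝ, E) ∞ M] : Type _ :=
  Sec E E (TangentSpace 𝓘(ℝ, E) : M → Type _)

variable [IsManifold 𝓘(ℝ, E) ∞ M]

/-- The derivative `X f` of a smooth function along a vector field. -/
def VF.deriv (X : VF E M) (f : SmoothFun E M) : SmoothFun E M where
  val m := mvfderiv 𝓘(ℝ, E) f m (X m)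
  property := by
    have h := (f.contMDiff.contMDiff_tangentMap (m := ∞) (by simp)).comp X.contMDiff
    have h2 := (contMDiff_snd_tangentBundle_modelSpace ℝ 𝓘(ℝ, ℝ) (n := ∞)).comp h
    exact h2

theorem isManifold_two : IsManifold 𝓘(ℝ, E) (minSmoothness ℝ 2) M := by
  simp only [minSmoothness_of_isRCLikeNormedField]
  exact IsManifold.of_le (n := ∞) (WithTop.coe_le_coe.2 le_top)

/-- The Lie bracket of two smooth vector fields. -/
def VF.bracket (X Y : VF E M) : VF E M where
  toFun := mlieBracket 𝓘(ℝ, E) X Y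
  contMDiff_toFun := by
    have : IsManifold 𝓘(ℝ, E) (((⊤ : ℕ∞) : ℕ∞ω) + 1) M := by
      simpa using ‹IsManifold 𝓘(ℝ, E) ∞ M›
    have := isManifold_two (E := E) (M := M)
    intro x
    exact ContMDiffAt.mlieBracket_vectorField (n := ⊤) (m := ⊤)
      (X.contMDiff x) (Y.contMDiff x) (by simp)

theorem VF.bracket_deriv (X Y : VF E M) (f : SmoothFun E M) (m : M) :
    mvfderiv 𝓘(ℝ, E) f m (mlieBracket 𝓘(ℝ, E) X Y m) =
      X.deriv (Y.deriv f) m - Y.deriv (X.deriv f) m := by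
  set φ := extChartAt 𝓘(ℝ, E) m with hφ
  have hM1 : IsManifold 𝓘(ℝ, E) 1 M := IsManifold.of_le (n := ∞) (by simp)
  have hM2 : IsManifold 𝓘(ℝ, E) 2 M := by simpa using isManifold_two (E := E) (M := M)
  let R (Z : VF E M) : E → E :=
    mpullbackWithin 𝓘(ℝ, E) 𝓘(ℝ, E) φ.symm Z (Set.range 𝓘(ℝ, E))
  have ht : φ.target ∈ 𝓝 (φ m) := extChartAt_target_mem_nhds m
  have key (g : SmoothFun E M) (Z : VF E M) (y : E) (hy : y ∈ φ.target) (v : E)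
      (hv : v = (mfderiv 𝓘(ℝ, E) 𝓘(ℝ, E) φ.symm y).inverse (Z (φ.symm y))) :
      Z.deriv g (φ.symm y) = fderiv ℝ (g ∘ φ.symm) y v := by
    have hs : MDifferentiableAt 𝓘(ℝ, E) 𝓘(ℝ, E) φ.symm y :=
      ((contMDiffOn_extChartAt_symm (I := 𝓘(ℝ, E)) (n := 1) m).contMDiffAt
        ((isOpen_extChartAt_target m).mem_nhds hy)).mdifferentiableAt one_ne_zero
    have hinv := isInvertible_mfderivWithin_extChartAt_symm (I := 𝓘(ℝ, E)) (x := m) hy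
    have h1 : fderiv ℝ (g ∘ φ.symm) y v =
        (mfderiv 𝓘(ℝ, E) 𝓘(ℝ, ℝ) g (φ.symm y))
          (mfderiv 𝓘(ℝ, E) 𝓘(ℝ, E) φ.symm y v) := by
      rw [← mfderiv_eq_fderiv]
      exact congrArg (fun L => L v) (mfderiv_comp y g.mdifferentiableAt hs)
    simp only [modelWithCornersSelf_coe, Set.range_id, mfderivWithin_univ] at hinv
    rw [← hφ] at hinv
    obtain ⟨e, he⟩ := hinv
    rw [h1, hv, ← he]
    simp [VF.deriv, mvfderiv]
    rfl
  have hm : φ.symm (φ m) = m := extChartAt_to_inv m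
  have hRd (Z : VF E M) : DifferentiableAt ℝ (R Z) (φ m) := by
    have := MDifferentiableWithinAt.differentiableWithinAt_mpullbackWithin_vectorField
      (I := 𝓘(ℝ, E)) (s := Set.univ) (x := m) (V := Z)
      ((Z.contMDiff m).mdifferentiableAt (by simp)).mdifferentiableWithinAt
    simp only [Set.preimage_univ, Set.univ_inter, modelWithCornersSelf_coe, Set.range_id] at this
    simp only [modelWithCornersSelf_coe, Set.range_id, R]
    exact differentiableWithinAt_univ.1 this
  have hkey (g : SmoothFun E M) (Z : VF E M) :
      (Z.deriv g ∘ φ.symm) =ᶠ[𝓝 (φ m)] fun y => fderiv ℝ (g ∘ φ.symm) y (R Z y) := by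
    filter_upwards [ht] with y hy
    exact key g Z y hy _ (by simp [R, mpullback_apply]; rfl)
  have hgd (g : SmoothFun E M) : ContDiffAt ℝ 2 (g ∘ φ.symm) (φ m) := by
    have h1 : ContMDiffAt 𝓘(ℝ, E) 𝓘(ℝ, E) 2 φ.symm (φ m) :=
      (contMDiffOn_extChartAt_symm (I := 𝓘(ℝ, E)) (n := 2) m).contMDiffAt ht
    have h2 : ContMDiffAt 𝓘(ℝ, E) 𝓘(ℝ, ℝ) 2 g (φ.symm (φ m)) :=
      (g.contMDiff _).of_le (WithTop.coe_le_coe.2 le_top)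
    exact contMDiffAt_iff_contDiffAt.1 (h2.comp _ h1)
  have hdd (A B : VF E M) : A.deriv (B.deriv f) m =
      fderiv ℝ (fderiv ℝ (f ∘ φ.symm)) (φ m) (R A (φ m)) (R B (φ m)) +
      fderiv ℝ (f ∘ φ.symm) (φ m) (fderiv ℝ (R B) (φ m) (R A (φ m))) := by
    have h1 : A.deriv (B.deriv f) m = fderiv ℝ (B.deriv f ∘ φ.symm) (φ m) (R A (φ m)) := by
      have := (hkey (B.deriv f) A).self_of_nhds
      rwa [Function.comp_apply, hm] at this
    rw [h1, (hkey f B).fderiv_eq]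
    have h2 : DifferentiableAt ℝ (fderiv ℝ (f ∘ φ.symm)) (φ m) :=
      ((hgd f).fderiv_right (m := 1) (by norm_num)).differentiableAt one_ne_zero
    rw [fderiv_clm_apply h2 (hRd B)]
    simp [add_comm]
  have hbr : mvfderiv 𝓘(ℝ, E) f m (mlieBracket 𝓘(ℝ, E) X Y m) =
      fderiv ℝ (f ∘ φ.symm) (φ m) (lieBracket ℝ (R X) (R Y) (φ m)) := by
    have h := key f (VF.bracket X Y) (φ m) (mem_extChartAt_target m) _ rfl
    rw [hm] at h
    refine h.trans (congrArg _ ?_)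
    have hinv := isInvertible_mfderiv_extChartAt (I := 𝓘(ℝ, E)) (mem_extChartAt_source m)
    rw [← hφ] at hinv
    have h1 := mfderiv_extChartAt_inverse_comp_mfderivWithin_extChartAT_symm (I := 𝓘(ℝ, E))
      (mlieBracket 𝓘(ℝ, E) X Y m)
    let L : E := lieBracket ℝ (R X) (R Y) (φ m)
    have h2 : mlieBracket 𝓘(ℝ, E) X Y m = (mfderiv 𝓘(ℝ, E) 𝓘(ℝ, E) φ m).inverse L := by
      rw [← mlieBracketWithin_univ, mlieBracketWithin_apply]
      simp only [Set.preimage_univ, Set.univ_inter, modelWithCornersSelf_coe, Set.range_id, L, R]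
      exact congrArg _ (congrFun lieBracketWithin_univ _)
    obtain ⟨e, he⟩ := hinv
    rw [← hφ] at h1
    simp only [modelWithCornersSelf_coe, Set.range_id, mfderivWithin_univ] at h1
    have h3 := h1.trans h2
    rw [← he, ContinuousLinearMap.inverse_equiv] at h3
    exact e.symm.injective h3
  rw [hbr, hdd, hdd, lieBracket_eq]
  have hsymm := (hgd f).isSymmSndFDerivAt (by simp)
  rw [hsymm.eq (R X (φ m)) (R Y (φ m))]
  simp


variable {F : Type*} [NormedAddCommGroup F] [NormedSpace ℝ F]
  {V : M → Type*} [TopologicalSpace (TotalSpace F V)] [∀ m, AddCommGroup (V m)]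
  [∀ m, Module ℝ (V m)] [∀ m, TopologicalSpace (V m)] [FiberBundle F V] [VectorBundle ℝ F V]

theorem Sec.ext' {u v : Sec E F V} (h : ∀ m, u m = v m) : u = v := ContMDiffSection.ext h

/-- Multiplication of a section by a smooth function. -/
def Sec.fsmul (f : SmoothFun E M) (u : Sec E F V) : Sec E F V where
  toFun m := f m • u m
  contMDiff_toFun := ContMDiff.smul_section (V := V) f.contMDiff u.contMDiff

/-- Evaluation of sections at `m`. -/
def Sec.eval (E F : Type*) {M : Type*} [NormedAddCommGroup E] [NormedSpace ℝ E]
    [NormedAddCommGroup F] [NormedSpace ℝ F] [TopologicalSpace M] [ChartedSpace E M]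
    (V : M → Type*) [TopologicalSpace (TotalSpace F V)] [∀ m, AddCommGroup (V m)]
    [∀ m, Module ℝ (V m)] [∀ m, TopologicalSpace (V m)]
    [FiberBundle F V] [VectorBundle ℝ F V] (m : M) : Sec E F V →ₗ[ℝ] V m where
  toFun u := u m
  map_add' _ _ := rfl
  map_smul' _ _ := rfl

theorem exists_sec_eventuallyEq [T2Space M] {m : M} {U : Set M} (hU : IsOpen U) (hm : m ∈ U)
    (s : ∀ m, V m)
    (hs : ContMDiffOn 𝓘(ℝ, E) (𝓘(ℝ, E).prod 𝓘(ℝ, F)) ∞ (fun m => TotalSpace.mk' F m (s m)) U) :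
    ∃ u : Sec E F V, ∀ᶠ p in 𝓝 m, u p = s p := by
  obtain ⟨ψ, -, hψ⟩ := (SmoothBumpFunction.nhds_basis_tsupport (I := 𝓘(ℝ, E)) m).mem_iff.1
    (hU.mem_nhds hm)
  refine ⟨⟨(ψ : M → ℝ) • s, ContMDiffOn.smul_section_of_tsupport ψ.contMDiff.contMDiffOn hU hψ hs⟩, ?_⟩
  filter_upwards [ψ.eventuallyEq_one] with p hp
  change ψ p • s p = s p
  rw [hp]; simp

theorem exists_fun_eventuallyEq [T2Space M] {m : M} {U : Set M} (hU : IsOpen U) (hm : m ∈ U)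
    (g : M → ℝ) (hg : ContMDiffOn 𝓘(ℝ, E) 𝓘(ℝ, ℝ) ∞ g U) :
    ∃ f : SmoothFun E M, ∀ᶠ p in 𝓝 m, f p = g p := by
  obtain ⟨ψ, -, hψ⟩ := (SmoothBumpFunction.nhds_basis_tsupport (I := 𝓘(ℝ, E)) m).mem_iff.1
    (hU.mem_nhds hm)
  refine ⟨⟨fun p => ψ p • g p, contMDiff_of_tsupport fun p hp => ?_⟩, ?_⟩
  · have : p ∈ U := hψ (closure_mono (Function.support_smul_subset_left _ _) hp)
    exact ψ.contMDiffAt.smul ((hg p this).contMDiffAt (hU.mem_nhds this))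
  · filter_upwards [ψ.eventuallyEq_one] with p hp
    change ψ p • g p = g p
    rw [hp]; simp

variable [ContMDiffVectorBundle ∞ F V 𝓘(ℝ, E)]

theorem exists_sec_apply_eq [T2Space M] (m : M) (v : V m) : ∃ u : Sec E F V, u m = v := by
  obtain ⟨s, hs, hs'⟩ := FiberBundle.exists_contMDiffOn_extend (k := ∞) 𝓘(ℝ, E) F v
  obtain ⟨u, hu⟩ := exists_sec_eventuallyEq (isOpen_interior (s := s)) (mem_interior_iff_mem_nhds.2 hs) _
    (hs'.mono interior_subset)
  exact ⟨u, by simpa using hu.self_of_nhds⟩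

variable {W : Type*} [AddCommGroup W] [Module ℝ W]

theorem tensorial_local [T2Space M] {m : M} (T : Sec E F V →ₗ[ℝ] W)
    (hT : ∀ (f : SmoothFun E M) (u : Sec E F V), T (u.fsmul f) = f m • T u)
    {u v : Sec E F V} (huv : ∀ᶠ p in 𝓝 m, u p = v p) : T u = T v := by
  obtain ⟨ψ, -, hψ⟩ := (SmoothBumpFunction.nhds_basis_tsupport (I := 𝓘(ℝ, E)) m).mem_iff.1 huv
  let f : SmoothFun E M := ⟨ψ, ψ.contMDiff⟩
  have hf : f m = 1 := ψ.eq_one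
  have h : u.fsmul f = v.fsmul f := by
    apply Sec.ext'
    intro p
    change ψ p • u p = ψ p • v p
    by_cases hp : p ∈ tsupport ψ
    · rw [hψ hp]
    · rw [image_eq_zero_of_notMem_tsupport hp]; simp
  have := congrArg T h
  simpa [hT, hf] using this

theorem tensorial_pointwise [T2Space M] [FiniteDimensional ℝ F] {m : M} (T : Sec E F V →ₗ[ℝ] W)
    (hT : ∀ (f : SmoothFun E M) (u : Sec E F V), T (u.fsmul f) = f m • T u)
    {u : Sec E F V} (hu : u m = 0) : T u = 0 := by
  have : ContMDiffVectorBundle 1 F V 𝓘(ℝ, E) := ContMDiffVectorBundle.of_le (n := ∞) (by simp)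
  let t := trivializationAt F V m
  have hm : m ∈ t.baseSet := FiberBundle.mem_baseSet_trivializationAt F V m
  let b := Module.finBasis ℝ F
  have hfr (i) := t.contMDiffOn_localFrame_baseSet (I := 𝓘(ℝ, E)) ∞ b i
  choose S hS using fun i => exists_sec_eventuallyEq t.open_baseSet hm _ (hfr i)
  have hco (i) := contMDiffOn_baseSet_localFrameCoeff (k := ∞) (e := t) b
    (s := u) u.contMDiff.contMDiffOn i
  choose c hc using fun i => exists_fun_eventuallyEq t.open_baseSet hm _ (hco i)
  have h1 : T u = T (∑ i, (S i).fsmul (c i)) := by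
    apply tensorial_local T hT
    filter_upwards [t.eventually_eq_localFrame_sum_coeff_smul (I := 𝓘(ℝ, E)) b (s := u) hm,
      eventually_all.2 hS, eventually_all.2 hc] with p h1 h2 h3
    rw [h1]
    have : (∑ i, (S i).fsmul (c i)) p = ∑ i, ((S i).fsmul (c i)) p := by
      exact map_sum (Sec.eval E F V p) _ _
    rw [this]
    refine Finset.sum_congr rfl fun i _ => ?_
    change _ = c i p • S i p
    rw [h2, h3]
    rfl
  rw [h1, map_sum]
  refine Finset.sum_eq_zero fun i _ => ?_
  rw [hT, (hc i).self_of_nhds]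
  simp [hu]

/-- The linear map on the fibre at `m` induced by an operation on sections that is linear over
the smooth functions, in the sense that `T (f u) = f(m) T u`. -/
def tensorialLift [T2Space M] [FiniteDimensional ℝ F] (m : M) (T : Sec E F V →ₗ[ℝ] W)
    (hT : ∀ (f : SmoothFun E M) (u : Sec E F V), T (u.fsmul f) = f m • T u) : V m →ₗ[ℝ] W :=
  (LinearMap.ker (Sec.eval E F V m)).liftQ T (fun _ hu => tensorial_pointwise T hT hu) ∘ₗ
    ((Sec.eval E F V m).quotKerEquivOfSurjective (exists_sec_apply_eq m)).symm.toLinearMap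

theorem tensorialLift_apply [T2Space M] [FiniteDimensional ℝ F] (m : M) (T : Sec E F V →ₗ[ℝ] W)
    (hT : ∀ (f : SmoothFun E M) (u : Sec E F V), T (u.fsmul f) = f m • T u) (u : Sec E F V) :
    tensorialLift m T hT (u m) = T u := by
  have : ((Sec.eval E F V m).quotKerEquivOfSurjective (exists_sec_apply_eq m)).symm (u m) =
      Submodule.Quotient.mk u := by
    rw [LinearEquiv.symm_apply_eq]; rfl
  rw [tensorialLift, LinearMap.comp_apply, LinearEquiv.coe_coe, this]
  rfl


section Hom

variable [T2Space M] [FiniteDimensional ℝ F] {F' : Type*} [NormedAddCommGroup F'] [NormedSpace ℝ F']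
  {V' : M → Type*} [TopologicalSpace (TotalSpace F' V')] [∀ m, AddCommGroup (V' m)]
  [∀ m, Module ℝ (V' m)] [∀ m, TopologicalSpace (V' m)] [FiberBundle F' V'] [VectorBundle ℝ F' V']
  [∀ m, IsTopologicalAddGroup (V' m)] [∀ m, ContinuousSMul ℝ (V' m)]

theorem contMDiff_hom_of_apply (s : ∀ m, V m →L[ℝ] V' m)
    (hs : ∀ u : Sec E F V, ContMDiff 𝓘(ℝ, E) (𝓘(ℝ, E).prod 𝓘(ℝ, F')) ∞
      (fun m => TotalSpace.mk' F' m (s m (u m)))) :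
    ContMDiff 𝓘(ℝ, E) (𝓘(ℝ, E).prod 𝓘(ℝ, F →L[ℝ] F')) ∞
      (fun m => TotalSpace.mk' (F →L[ℝ] F') (E := fun m => V m →L[ℝ] V' m) m (s m)) := by
  intro m
  rw [contMDiffAt_hom_bundle]
  refine ⟨contMDiffAt_id, ?_⟩
  let b := Module.finBasis ℝ F
  let g : M → F →L[ℝ] F' :=
    fun p => ContinuousLinearMap.inCoordinates F V F' V' m p m p (s p)
  have hg : ∀ p, g p = ∑ i, ContinuousLinearMap.smulRightL ℝ F F'
      (LinearMap.toContinuousLinearMap (b.coord i)) (g p (b i)) := by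
    intro p
    apply ContinuousLinearMap.coe_injective
    apply b.ext
    intro j
    simp [Finsupp.single_apply]
  have hb (i) : ContMDiffAt 𝓘(ℝ, E) 𝓘(ℝ, F') ∞ (fun p => g p (b i)) m := by
    let t := trivializationAt F V m
    have hm : m ∈ t.baseSet := FiberBundle.mem_baseSet_trivializationAt F V m
    obtain ⟨S, hS⟩ := exists_sec_eventuallyEq t.open_baseSet hm _
      (t.contMDiffOn_localFrame_baseSet (I := 𝓘(ℝ, E)) ∞ b i)
    have h1 := (contMDiffAt_section m).1 (hs S m)
    refine h1.congr_of_eventuallyEq ?_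
    filter_upwards [hS, t.open_baseSet.mem_nhds hm,
      (trivializationAt F' V' m).open_baseSet.mem_nhds
        (FiberBundle.mem_baseSet_trivializationAt F' V' m)] with p hp hp1 hp2
    simp only [g]
    rw [ContinuousLinearMap.inCoordinates_eq hp1 hp2, hp]
    simp [hp1, t, Trivialization.basisAt]
  have : ContMDiffAt 𝓘(ℝ, E) 𝓘(ℝ, F →L[ℝ] F') ∞ (fun p => ∑ i, ContinuousLinearMap.smulRightL ℝ F F'
      (LinearMap.toContinuousLinearMap (b.coord i)) (g p (b i))) m := by
    refine ContMDiffAt.sum fun i _ => ?_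
    exact (ContinuousLinearMap.contMDiff _).contMDiffAt.comp m (hb i)
  exact this.congr_of_eventuallyEq (Eventually.of_forall hg)

end Hom


section Gauge

variable (E F V) in
/-- The fibre at `m` of the gauge algebroid `𝔇V`: `ℝ`-linear operators `d : Γ(V) → V_m` together
with an anchor `x ∈ T_m M` such that `d (f u) = f(m) d(u) + x(f) u(m)`. -/
def Gauge (m : M) : Submodule ℝ ((Sec E F V →ₗ[ℝ] V m) × TangentSpace 𝓘(ℝ, E) m) where
  carrier := {d | ∀ (f : SmoothFun E M) (u : Sec E F V),
    d.1 (u.fsmul f) = f m • d.1 u + mvfderiv 𝓘(ℝ, E) f m d.2 • u m}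
  zero_mem' := by intro f u; simp
  add_mem' := by
    intro a b ha hb f u
    simp only [Prod.fst_add, LinearMap.add_apply, ha f u, hb f u, Prod.snd_add, map_add, add_smul,
      smul_add]
    abel
  smul_mem' := by
    intro c a ha f u
    simp only [Prod.smul_fst, LinearMap.smul_apply, ha f u, Prod.smul_snd, map_smul, smul_add,
      smul_smul, smul_eq_mul, mul_comm c]

/-- The anchor of `𝔇V`. -/
def Gauge.anchor {m : M} : Gauge E F V m →ₗ[ℝ] TangentSpace 𝓘(ℝ, E) m :=
  LinearMap.snd ℝ _ _ ∘ₗ (Gauge E F V m).subtype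

/-- The inclusion `gl(V) → 𝔇V`. -/
def Gauge.ofEnd {m : M} : (V m →ₗ[ℝ] V m) →ₗ[ℝ] Gauge E F V m where
  toFun Φ := ⟨(Φ ∘ₗ Sec.eval E F V m, 0), fun f u => by
    simp only [LinearMap.comp_apply, map_zero, zero_smul, add_zero]
    exact map_smul Φ (f m) (u m)⟩
  map_add' _ _ := Subtype.ext (Prod.ext rfl (add_zero _).symm)
  map_smul' _ _ := Subtype.ext (Prod.ext rfl (smul_zero _).symm)

variable (E F V) in
/-- The smooth sections of `𝔇V`: those families `δ` of elements of the fibres whose anchor is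
a smooth vector field and that map smooth sections of `V` to smooth sections of `V`. -/
def GaugeSec : Submodule ℝ (∀ m : M, Gauge E F V m) where
  carrier := {δ |
    (∀ u : Sec E F V, ContMDiff 𝓘(ℝ, E) (𝓘(ℝ, E).prod 𝓘(ℝ, F)) ∞
      (fun m => TotalSpace.mk' F m ((δ m).1.1 u))) ∧
    ContMDiff 𝓘(ℝ, E) (𝓘(ℝ, E).prod 𝓘(ℝ, E)) ∞
      (fun m => TotalSpace.mk' E (E := (TangentSpace 𝓘(ℝ, E) : M → Type _)) m (Gauge.anchor (δ m)))}
  zero_mem' := ⟨fun _ => (0 : Sec E F V).contMDiff, (0 : VF E M).contMDiff⟩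
  add_mem' ha hb := ⟨fun u => (ha.1 u).add_section (hb.1 u), ha.2.add_section hb.2⟩
  smul_mem' c _ ha := ⟨fun u => (ha.1 u).const_smul_section (a := c),
    ha.2.const_smul_section (a := c)⟩

/-- The operator `Γ(V) → Γ(V)` given by a section of `𝔇V`. -/
def GaugeSec.op (δ : GaugeSec E F V) : Sec E F V →ₗ[ℝ] Sec E F V where
  toFun u := ⟨fun m => (δ.1 m).1.1 u, δ.2.1 u⟩
  map_add' u v := Sec.ext' fun m => map_add (δ.1 m).1.1 u v
  map_smul' c u := Sec.ext' fun m => map_smul (δ.1 m).1.1 c u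

/-- The anchor of a section of `𝔇V`. -/
def GaugeSec.anchor (δ : GaugeSec E F V) : VF E M := ⟨fun m => Gauge.anchor (δ.1 m), δ.2.2⟩

theorem GaugeSec.op_apply (δ : GaugeSec E F V) (u : Sec E F V) (m : M) :
    (GaugeSec.op δ) u m = (δ.1 m).1.1 u := rfl

theorem GaugeSec.op_fsmul (δ : GaugeSec E F V) (f : SmoothFun E M) (u : Sec E F V) :
    (GaugeSec.op δ) (u.fsmul f) = ((GaugeSec.op δ) u).fsmul f + u.fsmul ((GaugeSec.anchor δ).deriv f) :=
  Sec.ext' fun m => (δ.1 m).2 f u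

theorem GaugeSec.ext {δ δ' : GaugeSec E F V} (h : ∀ u, (GaugeSec.op δ) u = (GaugeSec.op δ') u)
    (h' : (GaugeSec.anchor δ) = (GaugeSec.anchor δ')) : δ = δ' := by
  refine Subtype.ext (funext fun m => Subtype.ext (Prod.ext (LinearMap.ext fun u => ?_) ?_))
  · exact congrArg (fun v : Sec E F V => v m) (h u)
  · exact congrArg (fun X : VF E M => X m) h'

/-- A section of `𝔇V` from an operator on sections with an anchor. -/
def GaugeSec.mk (D : Sec E F V →ₗ[ℝ] Sec E F V) (X : VF E M)
    (h : ∀ f u, D (u.fsmul f) = (D u).fsmul f + u.fsmul (X.deriv f)) : GaugeSec E F V :=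
  ⟨fun m => ⟨(Sec.eval E F V m ∘ₗ D, X m), fun f u =>
    congrArg (fun v : Sec E F V => v m) (h f u)⟩,
    fun u => (D u).contMDiff, X.contMDiff⟩

/-- The bracket of `Γ(𝔇V)`: the commutator of operators, with anchor the bracket of the anchors. -/
def GaugeSec.bracket (δ δ' : GaugeSec E F V) : GaugeSec E F V :=
  GaugeSec.mk ((GaugeSec.op δ) ∘ₗ (GaugeSec.op δ') - (GaugeSec.op δ') ∘ₗ (GaugeSec.op δ)) ((GaugeSec.anchor δ).bracket (GaugeSec.anchor δ')) (by
    intro f u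
    have h : ∀ m, ((GaugeSec.anchor δ).bracket (GaugeSec.anchor δ')).deriv f m =
        (GaugeSec.anchor δ).deriv ((GaugeSec.anchor δ').deriv f) m - (GaugeSec.anchor δ').deriv ((GaugeSec.anchor δ).deriv f) m :=
      fun m => VF.bracket_deriv _ _ f m
    simp only [LinearMap.sub_apply, LinearMap.comp_apply, GaugeSec.op_fsmul, map_add]
    apply Sec.ext'
    intro m
    change f m • _ + (GaugeSec.anchor δ).deriv f m • _ +
        ((GaugeSec.anchor δ').deriv f m • _ + (GaugeSec.anchor δ).deriv ((GaugeSec.anchor δ').deriv f) m • u m) -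
      (f m • _ + (GaugeSec.anchor δ').deriv f m • _ +
        ((GaugeSec.anchor δ).deriv f m • _ + (GaugeSec.anchor δ').deriv ((GaugeSec.anchor δ).deriv f) m • u m)) =
      f m • (_ - _) + ((GaugeSec.anchor δ).bracket (GaugeSec.anchor δ')).deriv f m • u m
    rw [h m, sub_smul, smul_sub]
    abel)

/-- Multiplication of a section of `𝔇V` by a smooth function. -/
def GaugeSec.fsmul (f : SmoothFun E M) (δ : GaugeSec E F V) : GaugeSec E F V :=
  ⟨fun m => f m • δ.1 m, fun u => (((GaugeSec.op δ) u).fsmul f).contMDiff, ((GaugeSec.anchor δ).fsmul f).contMDiff⟩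

end Gauge


section Lift

theorem contMDiff_mvfderiv_apply {G : Type*} [NormedAddCommGroup G] [NormedSpace ℝ G]
    {g : M → G} (hg : ContMDiff 𝓘(ℝ, E) 𝓘(ℝ, G) ∞ g) (X : VF E M) :
    ContMDiff 𝓘(ℝ, E) 𝓘(ℝ, G) ∞ (fun m => mvfderiv 𝓘(ℝ, E) g m (X m)) := by
  have h := (hg.contMDiff_tangentMap (m := ∞) (by simp)).comp X.contMDiff
  exact (contMDiff_snd_tangentBundle_modelSpace G 𝓘(ℝ, G) (n := ∞)).comp h

/-- Near every point there is a linear connection, cut off by a smooth function. -/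
theorem exists_local_connection [T2Space M] (m₀ : M) :
    ∃ (D : VF E M →ₗ[ℝ] GaugeSec E F V) (χ : SmoothFun E M),
      (∀ f X, D (X.fsmul f) = GaugeSec.fsmul f (D X)) ∧ (∀ᶠ m in 𝓝 m₀, χ m = 1) ∧
      ∀ X, GaugeSec.anchor (D X) = X.fsmul χ := by
  let t := trivializationAt F V m₀
  have hm : m₀ ∈ t.baseSet := FiberBundle.mem_baseSet_trivializationAt F V m₀
  obtain ⟨ψ, -, hψ⟩ := (SmoothBumpFunction.nhds_basis_tsupport (I := 𝓘(ℝ, E)) m₀).mem_iff.1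
    (t.open_baseSet.mem_nhds hm)
  have hψ0 : ∀ p, p ∉ t.baseSet → ψ p = 0 := fun p hp =>
    image_eq_zero_of_notMem_tsupport fun h => hp (hψ h)
  let loc (u : Sec E F V) (p : M) : F := ψ p • (t ⟨p, u p⟩).2
  have hloc (u : Sec E F V) : ContMDiff 𝓘(ℝ, E) 𝓘(ℝ, F) ∞ (loc u) := by
    refine contMDiff_of_tsupport fun p hp => ?_
    have hp' : p ∈ t.baseSet := hψ (closure_mono (Function.support_smul_subset_left _ _) hp)
    exact ψ.contMDiffAt.smul ((t.contMDiffAt_section_iff hp').1 (u.contMDiff p))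
  have hlocd (u : Sec E F V) (p : M) : MDifferentiableAt 𝓘(ℝ, E) 𝓘(ℝ, F) (loc u) p :=
    (hloc u p).mdifferentiableAt (by simp)
  have loc_add (u v : Sec E F V) : loc (u + v) = loc u + loc v := by
    funext p
    by_cases hp : p ∈ t.baseSet
    · have := (t.linear ℝ hp).map_add (u p) (v p)
      change ψ p • (t ⟨p, u p + v p⟩).2 = ψ p • _ + ψ p • _
      rw [this, smul_add]
    · simp [loc, hψ0 p hp]
  have loc_fsmul (f : SmoothFun E M) (u : Sec E F V) : loc (u.fsmul f) = (f : M → ℝ) • loc u := by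
    funext p
    by_cases hp : p ∈ t.baseSet
    · have := (t.linear ℝ hp).map_smul (f p) (u p)
      change ψ p • (t ⟨p, f p • u p⟩).2 = f p • ψ p • _
      rw [this, smul_comm]
    · simp [loc, hψ0 p hp]
  have loc_smul (c : ℝ) (u : Sec E F V) : loc (c • u) = c • loc u := by
    funext p
    by_cases hp : p ∈ t.baseSet
    · have := (t.linear ℝ hp).map_smul c (u p)
      change ψ p • (t ⟨p, c • u p⟩).2 = c • ψ p • _
      rw [this, smul_comm]
    · simp [loc, hψ0 p hp]
  have symm_loc (u : Sec E F V) (p : M) : ψ p • t.symmₗ ℝ p (loc u p) = (ψ p * ψ p) • u p := by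
    by_cases hp : p ∈ t.baseSet
    · have : t.symmₗ ℝ p (t ⟨p, u p⟩).2 = u p := by
        simp [hp]
      simp only [loc, map_smul, this, smul_smul]
    · simp [hψ0 p hp]
  let χ : SmoothFun E M := ⟨fun p => ψ p * ψ p, ψ.contMDiff.mul ψ.contMDiff⟩
  let op (X : VF E M) (u : Sec E F V) : Sec E F V :=
    ⟨(ψ : M → ℝ) • fun p => t.symmₗ ℝ p (mvfderiv 𝓘(ℝ, E) (loc u) p (X p)), by
      refine ContMDiffOn.smul_section_of_tsupport ψ.contMDiff.contMDiffOn t.open_baseSet hψ ?_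
      intro p hp
      refine ContMDiffAt.contMDiffWithinAt ?_
      rw [t.contMDiffAt_section_iff hp]
      refine (contMDiff_mvfderiv_apply (hloc u) X p).congr_of_eventuallyEq ?_
      filter_upwards [t.open_baseSet.mem_nhds hp] with q hq
      simp [hq]⟩
  have op_apply (X : VF E M) (u : Sec E F V) (p : M) :
    op X u p = ψ p • t.symmₗ ℝ p (mvfderiv 𝓘(ℝ, E) (loc u) p (X p)) := rfl
  let δ (X : VF E M) : GaugeSec E F V := GaugeSec.mk
    { toFun := op X
      map_add' := fun u v => Sec.ext' fun p => by
        change _ = op X u p + op X v p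
        simp only [op_apply, loc_add, mvfderiv_add (hlocd u p) (hlocd v p), ← smul_add, ← map_add]
        rfl
      map_smul' := fun c u => Sec.ext' fun p => by
        change _ = c • op X u p
        have h : mvfderiv 𝓘(ℝ, E) (loc (c • u)) p (X p) =
            c • mvfderiv 𝓘(ℝ, E) (loc u) p (X p) := by
          have := mvfderiv_smul (I := 𝓘(ℝ, E)) (a := fun _ => c) (x := p) mdifferentiableAt_const
            (hlocd u p)
          rw [loc_smul]
          have h2 : (fun _ : M => c) • loc u = c • loc u := rfl
          rw [h2, mvfderiv_const] at this
          simp [this]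
        rw [op_apply, h, map_smul, smul_comm]
        rfl }
    (X.fsmul χ) (fun f u => Sec.ext' fun p => by
      change op X (u.fsmul f) p = f p • op X u p + mvfderiv 𝓘(ℝ, E) f p (χ p • X p) • u p
      have h := mvfderiv_smul (I := 𝓘(ℝ, E)) (a := f) (x := p) f.mdifferentiableAt (hlocd u p)
      rw [op_apply, loc_fsmul, h, op_apply]
      have h2 := symm_loc u p
      simp only [add_apply, smul_apply, map_add, map_smul,
        ContinuousLinearMap.smulRight_apply, smul_add, smul_eq_mul]
      congr 1
      · rw [smul_comm]
      · rw [smul_comm, h2, smul_smul, mul_comm]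
        rfl)
  have δ_apply (X : VF E M) (u : Sec E F V) (p : M) : GaugeSec.op (δ X) u p = op X u p := rfl
  refine ⟨{ toFun := δ, map_add' := ?_, map_smul' := ?_ }, χ, ?_, ?_, fun X => rfl⟩
  · intro X Y
    refine GaugeSec.ext (fun u => Sec.ext' fun p => ?_) (Sec.ext' fun p => ?_)
    · change op (X + Y) u p = op X u p + op Y u p
      simp only [op_apply, ← smul_add, ← map_add]
      rfl
    · exact smul_add (χ p) (X p) (Y p)
  · intro c X
    refine GaugeSec.ext (fun u => Sec.ext' fun p => ?_) (Sec.ext' fun p => ?_)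
    · change op (c • X) u p = c • op X u p
      have h : (c • X) p = c • X p := rfl
      rw [op_apply, op_apply, h, map_smul, map_smul, smul_comm]
    · exact smul_comm (χ p) c (X p)
  · intro f X
    refine GaugeSec.ext (fun u => Sec.ext' fun p => ?_) (Sec.ext' fun p => ?_)
    · change op (X.fsmul f) u p = f p • op X u p
      have h : X.fsmul f p = f p • X p := rfl
      rw [op_apply, op_apply, h, map_smul, map_smul, smul_comm]
    · exact smul_comm (χ p) (f p) (X p)
  · filter_upwards [ψ.eventuallyEq_one] with p hp
    change ψ p * ψ p = 1
    rw [hp]; simp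

variable [T2Space M] [FiniteDimensional ℝ F]

theorem Gauge.exists_eq_ofEnd {m : M} (d : Gauge E F V m) (hd : Gauge.anchor d = 0) :
    ∃ Φ : V m →ₗ[ℝ] V m, d = Gauge.ofEnd Φ := by
  have hT : ∀ (f : SmoothFun E M) (u : Sec E F V), d.1.1 (u.fsmul f) = f m • d.1.1 u := by
    intro f u
    have h := d.2 f u
    have h2 : d.1.2 = 0 := hd
    simpa [h2] using h
  refine ⟨tensorialLift m d.1.1 hT, Subtype.ext (Prod.ext (LinearMap.ext fun u => ?_) hd)⟩
  exact (tensorialLift_apply m d.1.1 hT u).symm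

variable [∀ m, IsTopologicalAddGroup (V m)] [∀ m, ContinuousSMul ℝ (V m)]

/-- A smooth field of endomorphisms of `V`, as a section of `𝔇V`. -/
def GaugeSec.ofHom : Sec E (F →L[ℝ] F) (fun m => V m →L[ℝ] V m) →ₗ[ℝ] GaugeSec E F V where
  toFun A := ⟨fun m => Gauge.ofEnd (A m).toLinearMap,
    fun u => ContMDiff.clm_bundle_apply A.contMDiff u.contMDiff, (0 : VF E M).contMDiff⟩
  map_add' A B := Subtype.ext <| funext fun m =>
    map_add (Gauge.ofEnd (E := E) (F := F)) (A m).toLinearMap (B m).toLinearMap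
  map_smul' c A := Subtype.ext <| funext fun m =>
    map_smul (Gauge.ofEnd (E := E) (F := F)) c (A m).toLinearMap

theorem GaugeSec.ofHom_fsmul (f : SmoothFun E M)
    (A : Sec E (F →L[ℝ] F) (fun m => V m →L[ℝ] V m)) :
    GaugeSec.ofHom (A.fsmul f) = GaugeSec.fsmul f (GaugeSec.ofHom A) :=
  Subtype.ext <| funext fun m =>
    map_smul (Gauge.ofEnd (E := E) (F := F)) (f m) (A m).toLinearMap

theorem exists_clm_eq {m : M} (Φ : V m →ₗ[ℝ] V m) (_ : Sec E F V) :
    ∃ A : V m →L[ℝ] V m, A.toLinearMap = Φ := by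
  have : T2Space (V m) := FiberBundle.t2Space F V m
  have : FiniteDimensional ℝ (V m) := VectorBundle.finiteDimensional ℝ F V m
  exact ⟨LinearMap.toContinuousLinearMap Φ, rfl⟩

theorem GaugeSec.exists_eq_ofHom (δ : GaugeSec E F V) (hδ : GaugeSec.anchor δ = 0) :
    ∃ A, δ = GaugeSec.ofHom A := by
  have h0 (m : M) : ∃ A : V m →L[ℝ] V m, δ.1 m = Gauge.ofEnd A.toLinearMap := by
    obtain ⟨Φ, hΦ⟩ := Gauge.exists_eq_ofEnd (δ.1 m) (congrArg (fun X : VF E M => X m) hδ)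
    obtain ⟨A, rfl⟩ := exists_clm_eq Φ (0 : Sec E F V)
    exact ⟨A, hΦ⟩
  choose A hA using h0
  refine ⟨⟨A, contMDiff_hom_of_apply A fun u => ?_⟩, Subtype.ext (funext hA)⟩
  refine (GaugeSec.op δ u).contMDiff.congr fun m => ?_
  rw [GaugeSec.op_apply, hA m]
  rfl

theorem gauge_tensorial_local {m : M} (T : GaugeSec E F V →ₗ[ℝ] W)
    (hT : ∀ (f : SmoothFun E M) (δ : GaugeSec E F V), T (GaugeSec.fsmul f δ) = f m • T δ)
    {δ δ' : GaugeSec E F V} (h : ∀ᶠ p in 𝓝 m, δ.1 p = δ'.1 p) : T δ = T δ' := by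
  obtain ⟨ψ, -, hψ⟩ := (SmoothBumpFunction.nhds_basis_tsupport (I := 𝓘(ℝ, E)) m).mem_iff.1 h
  let f : SmoothFun E M := ⟨ψ, ψ.contMDiff⟩
  have hf : f m = 1 := ψ.eq_one
  have h : GaugeSec.fsmul f δ = GaugeSec.fsmul f δ' := by
    refine Subtype.ext (funext fun p => ?_)
    change ψ p • δ.1 p = ψ p • δ'.1 p
    by_cases hp : p ∈ tsupport ψ
    · rw [hψ hp]
    · rw [image_eq_zero_of_notMem_tsupport hp]; simp
  have := congrArg T h
  simpa [hT, hf] using this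

theorem gauge_tensorial_pointwise {m : M} (T : GaugeSec E F V →ₗ[ℝ] W)
    (hT : ∀ (f : SmoothFun E M) (δ : GaugeSec E F V), T (GaugeSec.fsmul f δ) = f m • T δ)
    {δ : GaugeSec E F V} (hδ : δ.1 m = 0) : T δ = 0 := by
  obtain ⟨D, χ, hD, hχ, hDa⟩ := exists_local_connection (V := V) (F := F) (E := E) m
  have hX : GaugeSec.anchor δ m = 0 := by
    change Gauge.anchor (δ.1 m) = 0
    rw [hδ, map_zero]
  -- the connection part
  have h1 : T (D (GaugeSec.anchor δ)) = 0 :=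
    tensorial_pointwise (m := m) (T ∘ₗ D) (fun f X => by simp [hD, hT]) hX
  have h1' : (D (GaugeSec.anchor δ)).1 m = 0 :=
    tensorial_pointwise (m := m) ((LinearMap.proj m ∘ₗ (GaugeSec E F V).subtype) ∘ₗ D)
      (fun f X => by simp only [LinearMap.comp_apply, hD]; rfl) hX
  -- the endomorphism part
  obtain ⟨ψ, -, hψ⟩ := (SmoothBumpFunction.nhds_basis_tsupport (I := 𝓘(ℝ, E)) m).mem_iff.1 hχ
  let f : SmoothFun E M := ⟨ψ, ψ.contMDiff⟩
  have hf : f m = 1 := ψ.eq_one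
  let ε : GaugeSec E F V := GaugeSec.fsmul f (δ - D (GaugeSec.anchor δ))
  obtain ⟨A, hA⟩ := GaugeSec.exists_eq_ofHom ε (by
    refine Sec.ext' fun p => ?_
    have h2 : GaugeSec.anchor (D (GaugeSec.anchor δ)) p = χ p • GaugeSec.anchor δ p := by
      rw [hDa]; rfl
    change ψ p • (GaugeSec.anchor δ p - GaugeSec.anchor (D (GaugeSec.anchor δ)) p) = 0
    rw [h2]
    by_cases hp : p ∈ tsupport ψ
    · have : χ p = 1 := hψ hp
      simp [this]
    · rw [image_eq_zero_of_notMem_tsupport hp]; simp)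
  have hA0 : A m = 0 := by
    have h3 : ε.1 m = 0 := by
      change f m • (δ.1 m - (D (GaugeSec.anchor δ)).1 m) = 0
      rw [hδ, h1']; simp
    ext v
    obtain ⟨u, rfl⟩ := exists_sec_apply_eq (E := E) (F := F) m v
    have h4 : (ε.1 m).1.1 u = A m (u m) := by rw [hA]; rfl
    rw [← h4, h3]; rfl
  have h5 : T ε = 0 := by
    rw [hA]
    exact tensorial_pointwise (m := m) (T ∘ₗ GaugeSec.ofHom)
      (fun f A => by simp [GaugeSec.ofHom_fsmul, hT]) hA0
  have h6 : T ε + T (D (GaugeSec.anchor δ)) = T δ := by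
    rw [hT, hf, one_smul, ← T.map_add]
    exact congrArg T (sub_add_cancel δ (D (GaugeSec.anchor δ)))
  rw [h5, h1, add_zero] at h6
  exact h6.symm

theorem gauge_tensorial_eq {m : M} (T : GaugeSec E F V →ₗ[ℝ] W)
    (hT : ∀ (f : SmoothFun E M) (δ : GaugeSec E F V), T (GaugeSec.fsmul f δ) = f m • T δ)
    {δ δ' : GaugeSec E F V} (h : δ.1 m = δ'.1 m) : T δ = T δ' := by
  have h1 : T (δ - δ') = 0 := gauge_tensorial_pointwise T hT (by
    change δ.1 m - δ'.1 m = 0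
    rw [h, sub_self])
  have h2 : T (δ - δ') + T δ' = T δ := by
    rw [← T.map_add]
    exact congrArg T (sub_add_cancel δ δ')
  rw [h1, zero_add] at h2
  exact h2.symm

theorem exists_gaugeSec_apply_eq (m : M) (d : Gauge E F V m) :
    ∃ δ : GaugeSec E F V, δ.1 m = d := by
  obtain ⟨D, χ, hD, hχ, hDa⟩ := exists_local_connection (V := V) (F := F) (E := E) m
  obtain ⟨X, hX⟩ := exists_sec_apply_eq (E := E) (F := E) m (Gauge.anchor d)
  obtain ⟨Φ, hΦ⟩ := Gauge.exists_eq_ofEnd (d - (D X).1 m) (by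
    have h2 : GaugeSec.anchor (D X) m = χ m • X m := by rw [hDa]; rfl
    have h3 : Gauge.anchor ((D X).1 m) = χ m • X m := h2
    rw [map_sub, h3, hX, hχ.self_of_nhds, one_smul, sub_self])
  obtain ⟨A₀, rfl⟩ := exists_clm_eq Φ (0 : Sec E F V)
  obtain ⟨A, rfl⟩ := exists_sec_apply_eq (E := E) (F := F →L[ℝ] F)
    (V := fun m => V m →L[ℝ] V m) m A₀
  refine ⟨GaugeSec.ofHom A + D X, ?_⟩
  change Gauge.ofEnd (A m).toLinearMap + (D X).1 m = d
  rw [← hΦ, sub_add_cancel]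

/-- The linear map on the fibre of `𝔇V` at `m` induced by an operation on sections of `𝔇V` that is
linear over the smooth functions, in the sense that `T (f δ) = f(m) T δ`. -/
def gaugeLift (m : M) (T : GaugeSec E F V →ₗ[ℝ] W)
    (hT : ∀ (f : SmoothFun E M) (δ : GaugeSec E F V), T (GaugeSec.fsmul f δ) = f m • T δ) :
    Gauge E F V m →ₗ[ℝ] W where
  toFun d := T (exists_gaugeSec_apply_eq m d).choose
  map_add' d d' := by
    rw [← T.map_add]
    apply gauge_tensorial_eq T hT
    have h := (exists_gaugeSec_apply_eq m d).choose_spec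
    have h' := (exists_gaugeSec_apply_eq m d').choose_spec
    exact (exists_gaugeSec_apply_eq m (d + d')).choose_spec.trans (congrArg₂ (· + ·) h h').symm
  map_smul' c d := by
    rw [RingHom.id_apply, ← T.map_smul]
    apply gauge_tensorial_eq T hT
    have h := (exists_gaugeSec_apply_eq m d).choose_spec
    exact (exists_gaugeSec_apply_eq m (c • d)).choose_spec.trans (congrArg (c • ·) h).symm

theorem gaugeLift_apply (m : M) (T : GaugeSec E F V →ₗ[ℝ] W)
    (hT : ∀ (f : SmoothFun E M) (δ : GaugeSec E F V), T (GaugeSec.fsmul f δ) = f m • T δ)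
    (δ : GaugeSec E F V) : gaugeLift m T hT (δ.1 m) = T δ :=
  gauge_tensorial_eq T hT (exists_gaugeSec_apply_eq m (δ.1 m)).choose_spec

end Lift


section Bracket

theorem Sec.mdifferentiableAt (u : Sec E F V) (m : M) :
    MDifferentiableAt 𝓘(ℝ, E) (𝓘(ℝ, E).prod 𝓘(ℝ, F)) (fun m => TotalSpace.mk' F m (u m)) m :=
  (u.contMDiff m).mdifferentiableAt (by simp)

theorem VF.bracket_add_right (X Y Z : VF E M) : X.bracket (Y + Z) = X.bracket Y + X.bracket Z :=
  Sec.ext' fun m => by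
    have : IsManifold 𝓘(ℝ, E) (minSmoothness ℝ 2) M := isManifold_two
    exact mlieBracket_add_right (Y.mdifferentiableAt m) (Z.mdifferentiableAt m)

theorem VF.bracket_swap (X Y : VF E M) : X.bracket Y = - Y.bracket X :=
  Sec.ext' fun _ => mlieBracket_swap_apply

theorem VF.bracket_add_left (X Y Z : VF E M) : (X + Y).bracket Z = X.bracket Z + Y.bracket Z := by
  rw [VF.bracket_swap, VF.bracket_add_right, VF.bracket_swap X, VF.bracket_swap Y, neg_add]

theorem VF.bracket_smul_right (c : ℝ) (X Y : VF E M) : X.bracket (c • Y) = c • X.bracket Y :=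
  Sec.ext' fun m => by
    have : IsManifold 𝓘(ℝ, E) (minSmoothness ℝ 2) M := isManifold_two
    exact mlieBracket_const_smul_right (Y.mdifferentiableAt m)

theorem VF.bracket_smul_left (c : ℝ) (X Y : VF E M) : (c • X).bracket Y = c • X.bracket Y := by
  rw [VF.bracket_swap, VF.bracket_smul_right, VF.bracket_swap X, smul_neg]

theorem VF.bracket_fsmul_right (f : SmoothFun E M) (X Y : VF E M) :
    X.bracket (Y.fsmul f) = (X.bracket Y).fsmul f + Y.fsmul (X.deriv f) :=
  Sec.ext' fun m => by
    have : IsManifold 𝓘(ℝ, E) (minSmoothness ℝ 2) M := isManifold_two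
    refine (mlieBracket_smul_right f.mdifferentiableAt (Y.mdifferentiableAt m)).trans ?_
    rw [add_comm]
    rfl

theorem GaugeSec.op_bracket (δ δ' : GaugeSec E F V) (u : Sec E F V) :
    GaugeSec.op (GaugeSec.bracket δ δ') u =
      GaugeSec.op δ (GaugeSec.op δ' u) - GaugeSec.op δ' (GaugeSec.op δ u) := rfl

theorem GaugeSec.bracket_add_right (δ δ₁ δ₂ : GaugeSec E F V) :
    GaugeSec.bracket δ (δ₁ + δ₂) = GaugeSec.bracket δ δ₁ + GaugeSec.bracket δ δ₂ := by
  refine GaugeSec.ext (fun u => ?_) ?_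
  · change GaugeSec.op δ (GaugeSec.op δ₁ u + GaugeSec.op δ₂ u) -
      (GaugeSec.op δ₁ (GaugeSec.op δ u) + GaugeSec.op δ₂ (GaugeSec.op δ u)) =
      (GaugeSec.op δ (GaugeSec.op δ₁ u) - GaugeSec.op δ₁ (GaugeSec.op δ u)) +
      (GaugeSec.op δ (GaugeSec.op δ₂ u) - GaugeSec.op δ₂ (GaugeSec.op δ u))
    rw [(GaugeSec.op δ).map_add]
    abel
  · exact VF.bracket_add_right (GaugeSec.anchor δ) (GaugeSec.anchor δ₁) (GaugeSec.anchor δ₂)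

theorem GaugeSec.bracket_smul_right (c : ℝ) (δ δ' : GaugeSec E F V) :
    GaugeSec.bracket δ (c • δ') = c • GaugeSec.bracket δ δ' := by
  refine GaugeSec.ext (fun u => ?_) ?_
  · change GaugeSec.op δ (c • GaugeSec.op δ' u) - c • (GaugeSec.op δ' (GaugeSec.op δ u)) =
      c • (GaugeSec.op δ (GaugeSec.op δ' u) - GaugeSec.op δ' (GaugeSec.op δ u))
    rw [(GaugeSec.op δ).map_smul, smul_sub]
  · exact VF.bracket_smul_right c (GaugeSec.anchor δ) (GaugeSec.anchor δ')

theorem GaugeSec.bracket_fsmul_right (f : SmoothFun E M) (δ δ' : GaugeSec E F V) :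
    GaugeSec.bracket δ (GaugeSec.fsmul f δ') =
      GaugeSec.fsmul f (GaugeSec.bracket δ δ') +
        GaugeSec.fsmul ((GaugeSec.anchor δ).deriv f) δ' := by
  refine GaugeSec.ext (fun u => Sec.ext' fun m => ?_) ?_
  · change (GaugeSec.op δ ((GaugeSec.op δ' u).fsmul f)) m - f m • (GaugeSec.op δ' (GaugeSec.op δ u)) m =
      f m • (GaugeSec.op δ (GaugeSec.op δ' u) m - GaugeSec.op δ' (GaugeSec.op δ u) m) +
        (GaugeSec.anchor δ).deriv f m • GaugeSec.op δ' u m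
    rw [GaugeSec.op_fsmul, smul_sub]
    change (f m • GaugeSec.op δ (GaugeSec.op δ' u) m +
      (GaugeSec.anchor δ).deriv f m • GaugeSec.op δ' u m) - _ = _
    abel
  · exact VF.bracket_fsmul_right f (GaugeSec.anchor δ) (GaugeSec.anchor δ')

end Bracket

section Jet

variable (E F V) in
/-- The fibre at `m` of the jet bundle `𝔍V`, inside `Hom(𝔇V, V)`: linear maps `ν : 𝔇V_m → V_m` with
`ν(Φ) = Φ(ν(1))` for `Φ ∈ gl(V_m)`. The 1-jet of `u` at `m` is the map `d ↦ d(u)`. -/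
def Jet (m : M) : Submodule ℝ (Gauge E F V m →ₗ[ℝ] V m) where
  carrier := {ν | ∀ Φ : V m →ₗ[ℝ] V m, ν (Gauge.ofEnd Φ) = Φ (ν (Gauge.ofEnd LinearMap.id))}
  zero_mem' := by intro Φ; simp
  add_mem' := by
    intro a b ha hb Φ
    rw [LinearMap.add_apply, ha Φ, hb Φ, LinearMap.add_apply, map_add]
  smul_mem' := by
    intro c a ha Φ
    rw [LinearMap.smul_apply, ha Φ, LinearMap.smul_apply, map_smul]

/-- The inclusion `Hom(TM, V) → 𝔍V`. -/
def Jet.incl {m : M} (y : TangentSpace 𝓘(ℝ, E) m →ₗ[ℝ] V m) : Jet E F V m :=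
  ⟨y ∘ₗ Gauge.anchor, fun Φ => by
    have h (Ψ : V m →ₗ[ℝ] V m) :
      Gauge.anchor (Gauge.ofEnd (E := E) (F := F) (V := V) Ψ) = 0 := rfl
    simp only [LinearMap.comp_apply, h, map_zero]⟩

/-- The projection `𝔍V → V`. -/
def Jet.proj {m : M} : Jet E F V m →ₗ[ℝ] V m :=
  LinearMap.applyₗ (Gauge.ofEnd LinearMap.id) ∘ₗ (Jet E F V m).subtype

variable (E F V) in
/-- The smooth sections of `𝔍V`: those families `ν` for which `ν(δ)` is a smooth section of `V`
whenever `δ` is a smooth section of `𝔇V`. -/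
def JetSec : Submodule ℝ (∀ m : M, Jet E F V m) where
  carrier := {ν | ∀ δ : GaugeSec E F V, ContMDiff 𝓘(ℝ, E) (𝓘(ℝ, E).prod 𝓘(ℝ, F)) ∞
      (fun m => TotalSpace.mk' F m ((ν m).1 (δ.1 m)))}
  zero_mem' := fun _ => (0 : Sec E F V).contMDiff
  add_mem' ha hb := fun δ => (ha δ).add_section (hb δ)
  smul_mem' c _ ha := fun δ => (ha δ).const_smul_section (a := c)

/-- The pairing `⟨ν, δ⟩` of sections of `𝔍V` and `𝔇V`, a section of `V`. -/
def JetSec.pair (ν : JetSec E F V) (δ : GaugeSec E F V) : Sec E F V :=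
  ⟨fun m => (ν.1 m).1 (δ.1 m), ν.2 δ⟩

/-- The jet prolongation of a section. -/
def JetSec.jet (u : Sec E F V) : JetSec E F V :=
  ⟨fun m => ⟨LinearMap.applyₗ u ∘ₗ LinearMap.fst ℝ _ _ ∘ₗ (Gauge E F V m).subtype, fun _ => rfl⟩,
    fun δ => (GaugeSec.op δ u).contMDiff⟩

variable (V) in
/-- The identity of `V` as a section of `𝔇V`. -/
def GaugeSec.one : GaugeSec E F V :=
  GaugeSec.mk LinearMap.id 0 fun f u => Sec.ext' fun m => by
    change f m • u m = f m • u m + mvfderiv 𝓘(ℝ, E) f m 0 • u m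
    simp

/-- The projection `𝔍V → V` on sections. -/
def JetSec.proj (ν : JetSec E F V) : Sec E F V := JetSec.pair ν (GaugeSec.one V)

variable [T2Space M] [FiniteDimensional ℝ F]
  [∀ m, IsTopologicalAddGroup (V m)] [∀ m, ContinuousSMul ℝ (V m)]

/-- The map `δ' ↦ δ⟨ν, δ'⟩(m) - ⟨ν, [δ, δ']⟩(m)`. -/
def JetSec.lieDerivMap (δ : GaugeSec E F V) (ν : JetSec E F V) (m : M) :
    GaugeSec E F V →ₗ[ℝ] V m where
  toFun := fun δ' => GaugeSec.op δ (JetSec.pair ν δ') m -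
    JetSec.pair ν (GaugeSec.bracket δ δ') m
  map_add' := fun a b => by
    have h1 : JetSec.pair ν (a + b) = JetSec.pair ν a + JetSec.pair ν b :=
      Sec.ext' fun m => (ν.1 m).1.map_add (a.1 m) (b.1 m)
    have h2 : JetSec.pair ν (GaugeSec.bracket δ (a + b)) =
        JetSec.pair ν (GaugeSec.bracket δ a) + JetSec.pair ν (GaugeSec.bracket δ b) := by
      rw [GaugeSec.bracket_add_right]
      exact Sec.ext' fun m =>
        (ν.1 m).1.map_add ((GaugeSec.bracket δ a).1 m) ((GaugeSec.bracket δ b).1 m)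
    rw [h1, h2, (GaugeSec.op δ).map_add]
    exact add_sub_add_comm _ _ _ _
  map_smul' := fun c a => by
    have h1 : JetSec.pair ν (c • a) = c • JetSec.pair ν a :=
      Sec.ext' fun m => (ν.1 m).1.map_smul c (a.1 m)
    have h2 : JetSec.pair ν (GaugeSec.bracket δ (c • a)) =
        c • JetSec.pair ν (GaugeSec.bracket δ a) := by
      rw [GaugeSec.bracket_smul_right]
      exact Sec.ext' fun m => (ν.1 m).1.map_smul c ((GaugeSec.bracket δ a).1 m)
    rw [h1, h2, (GaugeSec.op δ).map_smul]
    exact (smul_sub c _ _).symm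

theorem JetSec.lieDerivMap_fsmul (δ : GaugeSec E F V) (ν : JetSec E F V) (m : M)
    (f : SmoothFun E M) (δ' : GaugeSec E F V) :
    JetSec.lieDerivMap δ ν m (GaugeSec.fsmul f δ') = f m • JetSec.lieDerivMap δ ν m δ' := by
  change GaugeSec.op δ (JetSec.pair ν (GaugeSec.fsmul f δ')) m -
    JetSec.pair ν (GaugeSec.bracket δ (GaugeSec.fsmul f δ')) m =
    f m • (GaugeSec.op δ (JetSec.pair ν δ') m - JetSec.pair ν (GaugeSec.bracket δ δ') m)
  have h1 : JetSec.pair ν (GaugeSec.fsmul f δ') = (JetSec.pair ν δ').fsmul f :=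
    Sec.ext' fun m => (ν.1 m).1.map_smul (f m) (δ'.1 m)
  have h2 : JetSec.pair ν (GaugeSec.bracket δ (GaugeSec.fsmul f δ')) m =
      f m • JetSec.pair ν (GaugeSec.bracket δ δ') m +
        (GaugeSec.anchor δ).deriv f m • JetSec.pair ν δ' m := by
    rw [GaugeSec.bracket_fsmul_right]
    change (ν.1 m).1 (f m • (GaugeSec.bracket δ δ').1 m +
      (GaugeSec.anchor δ).deriv f m • δ'.1 m) = _
    rw [(ν.1 m).1.map_add, (ν.1 m).1.map_smul, (ν.1 m).1.map_smul]
    rfl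
  rw [h1, h2, GaugeSec.op_fsmul, smul_sub]
  exact add_sub_add_right_eq_sub _ _ _

/-- The Lie derivative `L_δ ν`, determined by `⟨L_δ ν, δ'⟩ = δ⟨ν, δ'⟩ - ⟨ν, [δ, δ']⟩`. -/
def JetSec.lieDeriv (δ : GaugeSec E F V) (ν : JetSec E F V) : JetSec E F V :=
  ⟨fun m => ⟨gaugeLift m (JetSec.lieDerivMap δ ν m) (JetSec.lieDerivMap_fsmul δ ν m), fun Φ => by
    obtain ⟨A₀, rfl⟩ := exists_clm_eq Φ (0 : Sec E F V)
    obtain ⟨A, rfl⟩ := exists_sec_apply_eq (E := E) (F := F →L[ℝ] F)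
      (V := fun m => V m →L[ℝ] V m) m A₀
    have h1 := gaugeLift_apply m (JetSec.lieDerivMap δ ν m) (JetSec.lieDerivMap_fsmul δ ν m) (GaugeSec.ofHom A)
    have h2 := gaugeLift_apply m (JetSec.lieDerivMap δ ν m) (JetSec.lieDerivMap_fsmul δ ν m) (GaugeSec.one V)
    refine h1.trans (Eq.trans ?_ (congrArg (A m) h2.symm))
    have h3 (B : Sec E (F →L[ℝ] F) (fun m => V m →L[ℝ] V m)) (p : M) :
        JetSec.pair ν (GaugeSec.ofHom B) p = B p (JetSec.proj ν p) := (ν.1 p).2 (B p).toLinearMap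
    -- the bracket of `δ` with an endomorphism field is an endomorphism field
    obtain ⟨B, hB⟩ := GaugeSec.exists_eq_ofHom (GaugeSec.bracket δ (GaugeSec.ofHom A)) (by
      change (GaugeSec.anchor δ).bracket 0 = 0
      have := VF.bracket_smul_right 0 (GaugeSec.anchor δ) 0
      simpa using this)
    have hone : GaugeSec.bracket δ (GaugeSec.one V) = 0 := by
      refine GaugeSec.ext (fun u => ?_) ?_
      · change GaugeSec.op δ u - GaugeSec.op δ u = 0
        rw [sub_self]
      · change (GaugeSec.anchor δ).bracket 0 = 0
        have := VF.bracket_smul_right 0 (GaugeSec.anchor δ) 0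
        simpa using this
    have hBm : B m (JetSec.proj ν m) = GaugeSec.op (GaugeSec.bracket δ (GaugeSec.ofHom A))
        (JetSec.proj ν) m := by rw [hB]; rfl
    change GaugeSec.op δ (JetSec.pair ν (GaugeSec.ofHom A)) m -
      JetSec.pair ν (GaugeSec.bracket δ (GaugeSec.ofHom A)) m =
      A m (GaugeSec.op δ (JetSec.proj ν) m - JetSec.pair ν (GaugeSec.bracket δ (GaugeSec.one V)) m)
    have h0 : JetSec.pair ν (0 : GaugeSec E F V) m = 0 := (ν.1 m).1.map_zero
    have h4 : JetSec.pair ν (GaugeSec.ofHom A) = GaugeSec.op (GaugeSec.ofHom A) (JetSec.proj ν) :=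
      Sec.ext' fun p => h3 A p
    rw [hone, h0, sub_zero, hB, h3, hBm, GaugeSec.op_bracket, h4]
    exact sub_sub_cancel _ _⟩,
  fun δ' => by
    have h : ContMDiff 𝓘(ℝ, E) (𝓘(ℝ, E).prod 𝓘(ℝ, F)) ∞ (fun m => TotalSpace.mk' F m
        ((GaugeSec.op δ (JetSec.pair ν δ') - JetSec.pair ν (GaugeSec.bracket δ δ') :
          Sec E F V) m)) := ContMDiffSection.contMDiff _
    refine h.congr fun m => ?_
    exact congrArg (TotalSpace.mk' F m) (gaugeLift_apply m (JetSec.lieDerivMap δ ν m) (JetSec.lieDerivMap_fsmul δ ν m) δ')⟩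

theorem JetSec.pair_lieDeriv (δ δ' : GaugeSec E F V) (ν : JetSec E F V) :
    JetSec.pair (JetSec.lieDeriv δ ν) δ' =
      GaugeSec.op δ (JetSec.pair ν δ') - JetSec.pair ν (GaugeSec.bracket δ δ') :=
  Sec.ext' fun m => gaugeLift_apply m (JetSec.lieDerivMap δ ν m) (JetSec.lieDerivMap_fsmul δ ν m) δ'

end Jet

section Poisson

variable [T2Space M]

section SkewAlgebroid

/-- A section of `Hom(V, V')` applied to a section of `V`. -/
def Sec.app [∀ m, IsTopologicalAddGroup (V m)] [∀ m, ContinuousSMul ℝ (V m)]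
    {F' : Type*} [NormedAddCommGroup F'] [NormedSpace ℝ F']
    {V' : M → Type*} [TopologicalSpace (TotalSpace F' V')] [∀ m, AddCommGroup (V' m)]
    [∀ m, Module ℝ (V' m)] [∀ m, TopologicalSpace (V' m)] [FiberBundle F' V']
    [VectorBundle ℝ F' V'] [∀ m, IsTopologicalAddGroup (V' m)] [∀ m, ContinuousSMul ℝ (V' m)]
    (A : Sec E (F →L[ℝ] F') (fun m => V m →L[ℝ] V' m)) (u : Sec E F V) : Sec E F' V' :=
  ⟨fun m => A m (u m), ContMDiff.clm_bundle_apply A.contMDiff u.contMDiff⟩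

variable (E F V) in
/-- An anchor and a skew-symmetric bracket on sections satisfying the Leibniz rule: a Lie algebroid
structure on the vector bundle `V`, except that the Jacobi identity is not required. -/
structure SkewAlgebroid [∀ m, IsTopologicalAddGroup (V m)] [∀ m, ContinuousSMul ℝ (V m)] where
  anchor : Sec E (F →L[ℝ] E) (fun m => V m →L[ℝ] TangentSpace 𝓘(ℝ, E) m)
  bracket : Sec E F V → Sec E F V → Sec E F V
  skew : ∀ u v, bracket u v = - bracket v u
  add_right : ∀ u v w, bracket u (v + w) = bracket u v + bracket u w
  smul_right : ∀ (c : ℝ) u v, bracket u (c • v) = c • bracket u v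
  leibniz : ∀ (f : SmoothFun E M) u v,
    bracket u (v.fsmul f) = (bracket u v).fsmul f + v.fsmul (VF.deriv (anchor.app u) f)

variable [∀ m, IsTopologicalAddGroup (V m)] [∀ m, ContinuousSMul ℝ (V m)]

/-- The operator `[v, ·]`, as a section of `𝔇V`. -/
def SkewAlgebroid.ad (A : SkewAlgebroid E F V) (v : Sec E F V) : GaugeSec E F V :=
  GaugeSec.mk ⟨⟨A.bracket v, A.add_right v⟩, fun c w => A.smul_right c v w⟩ (A.anchor.app v)
    (fun f u => A.leibniz f v u)

theorem SkewAlgebroid.ad_add (A : SkewAlgebroid E F V) (v w : Sec E F V) :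
    A.ad (v + w) = A.ad v + A.ad w := by
  refine GaugeSec.ext (fun u => ?_) (Sec.ext' fun m => (A.anchor m).map_add (v m) (w m))
  change A.bracket (v + w) u = A.bracket v u + A.bracket w u
  rw [A.skew, A.add_right, A.skew v, A.skew w, neg_add]

theorem SkewAlgebroid.ad_smul (A : SkewAlgebroid E F V) (c : ℝ) (v : Sec E F V) :
    A.ad (c • v) = c • A.ad v := by
  refine GaugeSec.ext (fun u => ?_) (Sec.ext' fun m => (A.anchor m).map_smul c (v m))
  change A.bracket (c • v) u = c • A.bracket v u
  rw [A.skew, A.smul_right, A.skew v, smul_neg]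

theorem SkewAlgebroid.ad_fsmul (A : SkewAlgebroid E F V) (f : SmoothFun E M) (v : Sec E F V)
    (m : M) : (A.ad (v.fsmul f)).1 m = f m • (A.ad v).1 m -
      Gauge.ofEnd (((mvfderiv 𝓘(ℝ, E) f m).toLinearMap ∘ₗ (A.anchor m).toLinearMap).smulRight
        (v m)) := by
  refine Subtype.ext (Prod.ext (LinearMap.ext fun u => ?_) ?_)
  · change A.bracket (v.fsmul f) u m =
      f m • A.bracket v u m - mvfderiv 𝓘(ℝ, E) f m (A.anchor m (u m)) • v m
    have h (w : Sec E F V) : (-w) m = -(w m) := rfl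
    rw [A.skew, A.leibniz, A.skew v, h, h, smul_neg]
    change -(f m • A.bracket u v m + mvfderiv 𝓘(ℝ, E) f m (A.anchor m (u m)) • v m) = _
    rw [neg_add, sub_eq_add_neg]
  · change A.anchor m (f m • v m) = f m • A.anchor m (v m) - 0
    rw [map_smul, sub_zero]

/-- For `ν` in the fibre of `𝔍V` at `m`, the map `v ↦ -ν([v, ·])`. -/
def SkewAlgebroid.sharpOp (A : SkewAlgebroid E F V) {m : M} (ν : Jet E F V m) :
    Sec E F V →ₗ[ℝ] V m where
  toFun v := - ν.1 ((A.ad v).1 m)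
  map_add' v w := by
    rw [A.ad_add]
    exact (congrArg Neg.neg (ν.1.map_add ((A.ad v).1 m) ((A.ad w).1 m))).trans (neg_add _ _)
  map_smul' c v := by
    rw [A.ad_smul]
    exact (congrArg Neg.neg (ν.1.map_smul c ((A.ad v).1 m))).trans (smul_neg _ _).symm

/-- The bundle map `π : 𝔍V → 𝔇V` with `π([u]_m) = [u, ·](m)` on 1-jets. -/
def SkewAlgebroid.sharp (A : SkewAlgebroid E F V) {m : M} :
    Jet E F V m →ₗ[ℝ] Gauge E F V m where
  toFun ν := ⟨(A.sharpOp ν, A.anchor m (Jet.proj ν)), fun f u => by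
    change - ν.1 ((A.ad (u.fsmul f)).1 m) = f m • - ν.1 ((A.ad u).1 m) +
      mvfderiv 𝓘(ℝ, E) f m (A.anchor m (Jet.proj ν)) • u m
    rw [A.ad_fsmul, map_sub, ν.1.map_smul, ν.2, neg_sub, smul_neg, sub_eq_add_neg, add_comm]
    rfl⟩
  map_add' ν μ := by
    refine Subtype.ext (Prod.ext (LinearMap.ext fun u => ?_) ?_)
    · exact neg_add (ν.1 ((A.ad u).1 m)) (μ.1 ((A.ad u).1 m))
    · exact (A.anchor m).map_add (Jet.proj ν) (Jet.proj μ)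
  map_smul' c ν := by
    refine Subtype.ext (Prod.ext (LinearMap.ext fun u => ?_) ?_)
    · exact (smul_neg c (ν.1 ((A.ad u).1 m))).symm
    · exact (A.anchor m).map_smul c (Jet.proj ν)

/-- `π` on sections. -/
def SkewAlgebroid.sharpSec (A : SkewAlgebroid E F V) (ν : JetSec E F V) : GaugeSec E F V :=
  ⟨fun m => A.sharp (ν.1 m), fun u => (-(JetSec.pair ν (A.ad u))).contMDiff,
    (A.anchor.app (JetSec.proj ν)).contMDiff⟩

theorem SkewAlgebroid.sharpSec_jet (A : SkewAlgebroid E F V) (u : Sec E F V) :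
    A.sharpSec (JetSec.jet u) = A.ad u := by
  refine GaugeSec.ext (fun v => ?_) rfl
  rw [show GaugeSec.op (A.ad u) v = A.bracket u v from rfl, A.skew]
  rfl

variable [FiniteDimensional ℝ F]

/-- The bracket `[μ, ν]_π = L_{π μ} ν - L_{π ν} μ - d⟨π μ, ν⟩` on `Γ(𝔍V)`. -/
def SkewAlgebroid.jetBracket (A : SkewAlgebroid E F V) (μ ν : JetSec E F V) : JetSec E F V :=
  JetSec.lieDeriv (A.sharpSec μ) ν - JetSec.lieDeriv (A.sharpSec ν) μ -
    JetSec.jet (JetSec.pair ν (A.sharpSec μ))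

end SkewAlgebroid

section Cotangent

variable (E M) in
/-- The fibres of the cotangent bundle. -/
abbrev Cotangent : M → Type _ := fun m => TangentSpace 𝓘(ℝ, E) m →L[ℝ] Trivial M ℝ m

variable (E M) in
/-- Smooth 1-forms. -/
abbrev OneForm : Type _ := Sec E (E →L[ℝ] ℝ) (Cotangent E M)

theorem contMDiff_trivial_iff {g : M → ℝ} :
    ContMDiff 𝓘(ℝ, E) (𝓘(ℝ, E).prod 𝓘(ℝ, ℝ)) ∞ (fun m => TotalSpace.mk' ℝ (E := Trivial M ℝ) m (g m)) ↔
      ContMDiff 𝓘(ℝ, E) 𝓘(ℝ, ℝ) ∞ g :=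
  ⟨fun h m => (contMDiffAt_section m).1 (h m), fun h m => (contMDiffAt_section m).2 (h m)⟩

/-- The smooth function `α(X)`. -/
def OneForm.apply (α : OneForm E M) (X : VF E M) : SmoothFun E M :=
  ⟨fun m => α m (X m), contMDiff_trivial_iff.1 (ContMDiff.clm_bundle_apply α.contMDiff X.contMDiff)⟩

/-- The differential of a smooth function. -/
def OneForm.d (f : SmoothFun E M) : OneForm E M :=
  ⟨fun m => mvfderiv 𝓘(ℝ, E) f m, contMDiff_hom_of_apply (V := (TangentSpace 𝓘(ℝ, E) : M → Type _))
    (V' := Trivial M ℝ) (fun m => mvfderiv 𝓘(ℝ, E) f m)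
    fun X => contMDiff_trivial_iff.2 (VF.deriv X f).contMDiff⟩

variable (E M) in
/-- A bivector field, as a skew-symmetric bundle map `Π : T*M → TM`. -/
structure Bivector where
  sharp : Sec E ((E →L[ℝ] ℝ) →L[ℝ] E) (fun m : M => Cotangent E M m →L[ℝ] TangentSpace 𝓘(ℝ, E) m)
  skew : ∀ (m : M) (α β : Cotangent E M m), α (sharp m β) = - β (sharp m α)

/-- The vector field `Π(α)`. -/
def Bivector.vf (P : Bivector E M) (α : OneForm E M) : VF E M := P.sharp.app α

theorem Bivector.skew_apply (P : Bivector E M) (α β : OneForm E M) (m : M) :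
    α.apply (P.vf β) m = - β.apply (P.vf α) m := P.skew m (α m) (β m)

theorem VF.deriv_add (X : VF E M) (f g : SmoothFun E M) (m : M) :
    X.deriv (f + g) m = X.deriv f m + X.deriv g m := by
  have h := mvfderiv_add (I := 𝓘(ℝ, E)) (f.mdifferentiableAt (x := m)) (g.mdifferentiableAt (x := m))
  exact congrArg (fun L => L (X m)) h

theorem VF.deriv_mul (X : VF E M) (f g : SmoothFun E M) (m : M) :
    X.deriv (f * g) m = f m * X.deriv g m + g m * X.deriv f m := by
  have h := mvfderiv_smul (I := 𝓘(ℝ, E)) (f.mdifferentiableAt (x := m)) (g.mdifferentiableAt (x := m))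
  refine (congrArg (fun L => L (X m)) h).trans ?_
  change f m * _ + _ * g m = _
  rw [mul_comm _ (g m)]
  rfl

theorem VF.deriv_smul (X : VF E M) (c : ℝ) (f : SmoothFun E M) (m : M) :
    X.deriv (c • f) m = c * X.deriv f m := by
  have h := mvfderiv_smul (I := 𝓘(ℝ, E)) (a := fun _ => c) (x := m) mdifferentiableAt_const
    (f.mdifferentiableAt (x := m))
  rw [mvfderiv_const] at h
  refine (congrArg (fun L => L (X m)) h).trans ?_
  rw [add_apply, smul_apply, smul_eq_mul]
  simp only [ContinuousLinearMap.smulRight_apply, zero_apply, zero_smul, add_zero]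
  rfl

/-- The value at `m` of `Πα(β(X)) - β([Πα, X]) - Πβ(α(X)) + α([Πβ, X]) - X(β(Πα))`, that is, of
`[α, β] = L_{Πα} β - L_{Πβ} α - d(Π(α, β))` on `X`. -/
def Bivector.bracketFun (P : Bivector E M) (α β : OneForm E M) (X : VF E M) : SmoothFun E M :=
  (P.vf α).deriv (β.apply X) - β.apply ((P.vf α).bracket X) - (P.vf β).deriv (α.apply X) +
    α.apply ((P.vf β).bracket X) - X.deriv (β.apply (P.vf α))

theorem OneForm.apply_add (α : OneForm E M) (X Y : VF E M) :
    α.apply (X + Y) = α.apply X + α.apply Y :=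
  ContMDiffMap.ext fun m => (α m).map_add (X m) (Y m)

theorem OneForm.apply_smul (α : OneForm E M) (c : ℝ) (X : VF E M) :
    α.apply (c • X) = c • α.apply X :=
  ContMDiffMap.ext fun m => (α m).map_smul c (X m)

theorem OneForm.apply_fsmul (α : OneForm E M) (f : SmoothFun E M) (X : VF E M) :
    α.apply (X.fsmul f) = f * α.apply X :=
  ContMDiffMap.ext fun m => (α m).map_smul (f m) (X m)

theorem OneForm.fsmul_apply (α : OneForm E M) (f : SmoothFun E M) (X : VF E M) :
    OneForm.apply (α.fsmul f) X = f * α.apply X := rfl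

theorem VF.fsmul_deriv (X : VF E M) (f g : SmoothFun E M) (m : M) :
    VF.deriv (X.fsmul f) g m = f m * X.deriv g m :=
  (mvfderiv 𝓘(ℝ, E) g m).map_smul (f m) (X m)

theorem VF.bracket_fsmul_left (f : SmoothFun E M) (X Y : VF E M) :
    VF.bracket (X.fsmul f) Y = (X.bracket Y).fsmul f - X.fsmul (Y.deriv f) := by
  rw [VF.bracket_swap, VF.bracket_fsmul_right, VF.bracket_swap X]
  refine Sec.ext' fun m => ?_
  change -(f m • Y.bracket X m + Y.deriv f m • X m) = f m • -(Y.bracket X m) - Y.deriv f m • X m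
  rw [smul_neg, neg_add, sub_eq_add_neg]

theorem Bivector.bracketFun_apply (P : Bivector E M) (α β : OneForm E M) (X : VF E M) (m : M) :
    P.bracketFun α β X m = (P.vf α).deriv (β.apply X) m - β.apply ((P.vf α).bracket X) m -
      (P.vf β).deriv (α.apply X) m + α.apply ((P.vf β).bracket X) m -
      X.deriv (β.apply (P.vf α)) m := rfl

/-- The bracket `[α, β] = L_{Πα} β - L_{Πβ} α - d(Π(α, β))` of 1-forms at the point `m`. -/
def Bivector.bracketAt (P : Bivector E M) (α β : OneForm E M) (m : M) :
    TangentSpace 𝓘(ℝ, E) m →ₗ[ℝ] ℝ :=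
  tensorialLift (E := E) (F := E) (V := (TangentSpace 𝓘(ℝ, E) : M → Type _)) m
    { toFun := fun X => P.bracketFun α β X m
      map_add' := fun X Y => by
        have hadd (f g : SmoothFun E M) : (f + g) m = f m + g m := rfl
        have h' (f : SmoothFun E M) : VF.deriv (X + Y) f m = VF.deriv X f m + VF.deriv Y f m :=
          (mvfderiv 𝓘(ℝ, E) f m).map_add (X m) (Y m)
        simp only [P.bracketFun_apply, VF.bracket_add_right, OneForm.apply_add, VF.deriv_add, h', hadd]
        ring
      map_smul' := fun c X => by
        have hsmul (f : SmoothFun E M) : (c • f) m = c * f m := rfl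
        have h' (f : SmoothFun E M) : VF.deriv (c • X) f m = c * VF.deriv X f m :=
          (mvfderiv 𝓘(ℝ, E) f m).map_smul c (X m)
        simp only [P.bracketFun_apply, VF.bracket_smul_right, OneForm.apply_smul, VF.deriv_smul, h',
          hsmul, RingHom.id_apply, smul_eq_mul]
        ring }
    (fun f X => by
      have h (γ : OneForm E M) (Y : VF E M) : γ.apply (Y.bracket (X.fsmul f)) m =
          f m * γ.apply (Y.bracket X) m + Y.deriv f m * γ.apply X m := by
        rw [VF.bracket_fsmul_right, OneForm.apply_add, OneForm.apply_fsmul, OneForm.apply_fsmul]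
        rfl
      change P.bracketFun α β (X.fsmul f) m = f m • P.bracketFun α β X m
      simp only [P.bracketFun_apply, h, OneForm.apply_fsmul, VF.deriv_mul, VF.fsmul_deriv,
        smul_eq_mul]
      ring)

theorem Bivector.bracketAt_apply (P : Bivector E M) (α β : OneForm E M) (m : M) (X : VF E M) :
    P.bracketAt α β m (X m) = P.bracketFun α β X m :=
  tensorialLift_apply (E := E) (F := E) (V := (TangentSpace 𝓘(ℝ, E) : M → Type _)) m _ _ X

/-- The bracket `[α, β] = L_{Πα} β - L_{Πβ} α - d(Π(α, β))` of 1-forms. -/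
def Bivector.bracket (P : Bivector E M) (α β : OneForm E M) : OneForm E M :=
  have : ∀ m : M, FiniteDimensional ℝ (TangentSpace 𝓘(ℝ, E) m) := fun _ =>
    inferInstanceAs (FiniteDimensional ℝ E)
  have : ∀ m : M, T2Space (TangentSpace 𝓘(ℝ, E) m) := fun _ => inferInstanceAs (T2Space E)
  ⟨fun m => LinearMap.toContinuousLinearMap (P.bracketAt α β m),
    contMDiff_hom_of_apply (V := (TangentSpace 𝓘(ℝ, E) : M → Type _)) (V' := Trivial M ℝ)
      (fun m => LinearMap.toContinuousLinearMap (P.bracketAt α β m)) fun X => by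
      refine contMDiff_trivial_iff.2 ((P.bracketFun α β X).contMDiff.congr fun m => ?_)
      exact P.bracketAt_apply α β m X⟩

theorem Bivector.bracket_apply (P : Bivector E M) (α β : OneForm E M) (X : VF E M) (m : M) :
    P.bracket α β m (X m) = P.bracketFun α β X m := P.bracketAt_apply α β m X

theorem OneForm.ext {α β : OneForm E M} (h : ∀ (X : VF E M) m, α m (X m) = β m (X m)) :
    α = β := by
  refine Sec.ext' fun m => ContinuousLinearMap.ext fun v => ?_
  obtain ⟨X, rfl⟩ := exists_sec_apply_eq (E := E) (F := E)
    (V := (TangentSpace 𝓘(ℝ, E) : M → Type _)) m v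
  exact h X m

/-- The bracket of 1-forms and the anchor `Π` on the cotangent bundle. -/
def Bivector.algebroid (P : Bivector E M) : SkewAlgebroid E (E →L[ℝ] ℝ) (Cotangent E M) where
  anchor := P.sharp
  bracket := P.bracket
  skew α β := OneForm.ext fun X m => by
    change _ = - (P.bracket β α m (X m))
    rw [P.bracket_apply, P.bracket_apply, P.bracketFun_apply, P.bracketFun_apply]
    have h : OneForm.apply β (P.vf α) = (-1 : ℝ) • OneForm.apply α (P.vf β) := ContMDiffMap.ext fun p => by
      rw [P.skew_apply]
      exact (neg_one_mul _).symm
    rw [h, VF.deriv_smul]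
    ring
  add_right α β γ := OneForm.ext fun X m => by
    change _ = P.bracket α β m (X m) + P.bracket α γ m (X m)
    have h1 (Y : VF E M) : OneForm.apply (β + γ) Y = OneForm.apply β Y + OneForm.apply γ Y := rfl
    have h2 : P.vf (β + γ) = P.vf β + P.vf γ :=
      Sec.ext' fun p => (P.sharp p).map_add (β p) (γ p)
    have h3 (f : SmoothFun E M) : VF.deriv (P.vf β + P.vf γ) f m =
        (P.vf β).deriv f m + (P.vf γ).deriv f m :=
      (mvfderiv 𝓘(ℝ, E) f m).map_add (P.vf β m) (P.vf γ m)
    have h4 (f g : SmoothFun E M) : (f + g) m = f m + g m := rfl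
    simp only [P.bracket_apply, P.bracketFun_apply, h1, h2, h3, VF.deriv_add,
      VF.bracket_add_left, OneForm.apply_add, h4]
    ring
  smul_right c α β := OneForm.ext fun X m => by
    change _ = c * P.bracket α β m (X m)
    have h1 (Y : VF E M) : OneForm.apply (c • β) Y = c • OneForm.apply β Y := rfl
    have h2 : P.vf (c • β) = c • P.vf β :=
      Sec.ext' fun p => (P.sharp p).map_smul c (β p)
    have h3 (f : SmoothFun E M) : VF.deriv (c • P.vf β) f m = c * (P.vf β).deriv f m :=
      (mvfderiv 𝓘(ℝ, E) f m).map_smul c (P.vf β m)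
    have h4 (f : SmoothFun E M) : (c • f) m = c * f m := rfl
    simp only [P.bracket_apply, P.bracketFun_apply, h1, h2, h3, VF.deriv_smul,
      VF.bracket_smul_left, OneForm.apply_smul, h4]
    ring
  leibniz f α β := OneForm.ext fun X m => by
    change _ = f m * P.bracket α β m (X m) + (P.vf α).deriv f m * OneForm.apply β X m
    have h2 : P.vf (β.fsmul f) = (P.vf β).fsmul f :=
      Sec.ext' fun p => (P.sharp p).map_smul (f p) (β p)
    have h4 (f g : SmoothFun E M) : (f * g) m = f m * g m := rfl
    have h5 : OneForm.apply α (VF.bracket ((P.vf β).fsmul f) X) m =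
        f m * OneForm.apply α ((P.vf β).bracket X) m + X.deriv f m * OneForm.apply β (P.vf α) m := by
      have h6 : X.deriv f m * OneForm.apply α (P.vf β) m = -(X.deriv f m * OneForm.apply β (P.vf α) m) := by
        rw [P.skew_apply]; ring
      rw [VF.bracket_fsmul_left, ← neg_eq_iff_eq_neg.2 h6, ← sub_eq_add_neg]
      change (α m) (f m • (P.vf β).bracket X m - X.deriv f m • P.vf β m) = _
      rw [map_sub, map_smul, map_smul]
      rfl
    simp only [P.bracket_apply, P.bracketFun_apply, OneForm.fsmul_apply, h2, h4, h5, VF.deriv_mul,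
      VF.fsmul_deriv]
    ring

end Cotangent

section Poisson

variable (E M) in
/-- A Poisson structure: a bivector field `Π` whose bracket `{f, g} = dg(Π df)` satisfies the
Jacobi identity. -/
structure PoissonStructure extends Bivector E M where
  jacobi : ∀ f g h : SmoothFun E M,
    let br (a b : SmoothFun E M) : SmoothFun E M :=
      (OneForm.d b).apply (toBivector.vf (OneForm.d a))
    br f (br g h) + br g (br h f) + br h (br f g) = 0

variable (E M) in
/-- A symplectic form: a closed nondegenerate 2-form `ω`, given as the bundle map
`X ↦ ω(X, ·)`. -/
structure SymplecticForm where
  flat : Sec E (E →L[ℝ] (E →L[ℝ] ℝ)) (fun m : M => TangentSpace 𝓘(ℝ, E) m →L[ℝ] Cotangent E M m)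
  alternating : ∀ (m : M) (x : TangentSpace 𝓘(ℝ, E) m), flat m x x = 0
  nondegenerate : ∀ (m : M) (x : TangentSpace 𝓘(ℝ, E) m), (∀ y, flat m x y = 0) → x = 0
  closed : ∀ X Y Z : VF E M,
    let w (A B : VF E M) : SmoothFun E M := OneForm.apply (flat.app A) B
    X.deriv (w Y Z) - Y.deriv (w X Z) + Z.deriv (w X Y)
      - w (X.bracket Y) Z + w (X.bracket Z) Y - w (Y.bracket Z) X = 0

end Poisson

section Algebroid

universe w w'

variable (E M) in
/-- The data of a Lie algebroid over `M`: fibres, the space of smooth sections among all families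
of elements of the fibres, the anchor, and the bracket of smooth sections. -/
structure AlgebroidData where
  Fiber : M → Type w
  [groupInst : ∀ m, AddCommGroup (Fiber m)]
  [moduleInst : ∀ m, Module ℝ (Fiber m)]
  sections : Submodule ℝ (∀ m, Fiber m)
  anchor : ∀ m, Fiber m →ₗ[ℝ] TangentSpace 𝓘(ℝ, E) m
  bracket : sections → sections → sections

attribute [instance] AlgebroidData.groupInst AlgebroidData.moduleInst

/-- The data form a Lie algebroid: a smooth vector bundle (the smooth sections are a sheaf of
modules over the smooth functions, with local frames consisting of bases of the fibres), a smooth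
anchor, and a Lie bracket on smooth sections that satisfies the Leibniz rule and that the anchor
maps to the Lie bracket of vector fields. -/
structure AlgebroidData.IsLieAlgebroid (A : AlgebroidData.{w} E M) : Prop where
  fsmul_mem : ∀ (f : SmoothFun E M), ∀ s ∈ A.sections, (fun m => f m • s m) ∈ A.sections
  mem_of_local : ∀ s : (∀ m, A.Fiber m),
    (∀ m₀, ∃ t ∈ A.sections, ∀ᶠ m in 𝓝 m₀, s m = t m) → s ∈ A.sections
  exists_frame : ∀ m₀ : M, ∃ (n : ℕ) (e : Fin n → A.sections),
    (∀ᶠ m in 𝓝 m₀, LinearIndependent ℝ (fun i => (e i).1 m) ∧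
      Submodule.span ℝ (Set.range fun i => (e i).1 m) = ⊤) ∧
    ∀ s ∈ A.sections, ∃ c : Fin n → SmoothFun E M,
      ∀ᶠ m in 𝓝 m₀, s m = ∑ i, c i m • (e i).1 m
  anchor_smooth : ∀ s ∈ A.sections, ContMDiff 𝓘(ℝ, E) (𝓘(ℝ, E).prod 𝓘(ℝ, E)) ∞
    (fun m => TotalSpace.mk' E (E := (TangentSpace 𝓘(ℝ, E) : M → Type _)) m (A.anchor m (s m)))
  bracket_add : ∀ r s t, A.bracket r (s + t) = A.bracket r s + A.bracket r t
  bracket_smul : ∀ (c : ℝ) s t, A.bracket s (c • t) = c • A.bracket s t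
  bracket_skew : ∀ s t, A.bracket s t = - A.bracket t s
  jacobi : ∀ r s t, A.bracket r (A.bracket s t) + A.bracket s (A.bracket t r) +
    A.bracket t (A.bracket r s) = 0
  leibniz : ∀ (f : SmoothFun E M) (s t t' : A.sections), (∀ m, t'.1 m = f m • t.1 m) →
    ∀ m, (A.bracket s t').1 m =
      f m • (A.bracket s t).1 m + mvfderiv 𝓘(ℝ, E) f m (A.anchor m (s.1 m)) • t.1 m
  anchor_bracket : ∀ (s t : A.sections) (m : M), A.anchor m ((A.bracket s t).1 m) =
    mlieBracket 𝓘(ℝ, E) (fun p => A.anchor p (s.1 p)) (fun p => A.anchor p (t.1 p)) m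

/-- The family of linear maps `φ` is a morphism of Lie algebroids over the identity of `M`:
a smooth bundle map that preserves anchors and brackets. -/
structure AlgebroidData.IsMorphism (A : AlgebroidData.{w} E M) (B : AlgebroidData.{w'} E M)
    (φ : ∀ m, A.Fiber m →ₗ[ℝ] B.Fiber m) : Prop where
  map_mem : ∀ s ∈ A.sections, (fun m => φ m (s m)) ∈ B.sections
  map_anchor : ∀ (m : M) (v : A.Fiber m), B.anchor m (φ m v) = A.anchor m v
  map_bracket : ∀ (s t : A.sections) (m : M), φ m ((A.bracket s t).1 m) =
    (B.bracket ⟨fun p => φ p (s.1 p), map_mem s.1 s.2⟩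
      ⟨fun p => φ p (t.1 p), map_mem t.1 t.2⟩).1 m

/-- `φ` is an isomorphism of Lie algebroids: a morphism with an inverse that is a morphism. -/
def AlgebroidData.IsIsomorphism (A : AlgebroidData.{w} E M) (B : AlgebroidData.{w'} E M)
    (φ : ∀ m, A.Fiber m →ₗ[ℝ] B.Fiber m) : Prop :=
  A.IsMorphism B φ ∧ ∃ ψ : ∀ m, B.Fiber m →ₗ[ℝ] A.Fiber m, B.IsMorphism A ψ ∧
    ∀ m, ψ m ∘ₗ φ m = LinearMap.id ∧ φ m ∘ₗ ψ m = LinearMap.id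

variable (E F V) in
/-- The gauge algebroid `𝔇V`. -/
def gaugeAlgebroid : AlgebroidData E M where
  Fiber m := Gauge E F V m
  sections := GaugeSec E F V
  anchor _ := Gauge.anchor
  bracket := GaugeSec.bracket

/-- The jet algebroid `𝔍V` of an algebroid `V`, with the bracket `[·, ·]_π` and the anchor given
by that of `𝔇V` and `π`. -/
def jetAlgebroid [FiniteDimensional ℝ F] [∀ m, IsTopologicalAddGroup (V m)]
    [∀ m, ContinuousSMul ℝ (V m)] (A : SkewAlgebroid E F V) : AlgebroidData E M where
  Fiber m := Jet E F V m
  sections := JetSec E F V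
  anchor _ := Gauge.anchor ∘ₗ A.sharp
  bracket := A.jetBracket

variable (E M) in
/-- The gauge algebroid `𝔇(TM)` of the tangent bundle. -/
abbrev tangentGauge : AlgebroidData E M :=
  gaugeAlgebroid E E (TangentSpace 𝓘(ℝ, E) : M → Type _)

/-- The jet algebroid `𝔍(T*M)` of the cotangent Lie algebroid of a Poisson manifold. -/
abbrev PoissonStructure.cotangentJet (P : PoissonStructure E M) : AlgebroidData E M :=
  jetAlgebroid P.toBivector.algebroid

end Algebroid

section Lift

variable (E M) in
/-- The fibre of `Hom(TM, T*M)` at `m`. -/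
abbrev HomTangentCotangent (m : M) : Type _ := TangentSpace 𝓘(ℝ, E) m →ₗ[ℝ] Cotangent E M m

variable (E M) in
/-- The fibre of `𝔍(T*M)` at `m`. -/
abbrev CotangentJet (m : M) : Type _ := Jet E (E →L[ℝ] ℝ) (Cotangent E M) m

variable (E M) in
/-- The fibre of `𝔇(TM)` at `m`. -/
abbrev TangentGauge (m : M) : Type _ := Gauge E E (TangentSpace 𝓘(ℝ, E) : M → Type _) m

variable [T2Space M]

/-- `φ : 𝔍(T*M) → 𝔇(TM)` is a morphism of Lie algebroids which is `-1 ⊗ Π` on `Hom(TM, T*M)`,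
which lifts `Π : T*M → TM`, and which maps the 1-jet of `α` at `m` to the operator
`X ↦ [Π α, X](m)`. -/
structure PoissonStructure.IsLift (P : PoissonStructure E M)
    (φ : ∀ m, CotangentJet E M m →ₗ[ℝ] TangentGauge E M m) : Prop where
  isMorphism : P.cotangentJet.IsMorphism (tangentGauge E M) φ
  left_square : ∀ (m : M) (y : HomTangentCotangent E M m),
    φ m (Jet.incl y) = Gauge.ofEnd (-((P.sharp m).toLinearMap ∘ₗ y))
  right_square : ∀ (m : M) (ν : CotangentJet E M m),
    Gauge.anchor (φ m ν) = P.sharp m (Jet.proj ν)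
  map_jet : ∀ (α : OneForm E M) (X : VF E M) (m : M),
    (φ m ((JetSec.jet α).1 m)).1.1 X = (P.vf α).bracket X m

end Lift

end Poisson

end Sections

end

/-!
A short exact sequence of spaces of sections whose outer terms have local frames has one in the
middle: this gives the bundle structures on `𝔇V` and `𝔍V`. Every element of `𝔍V_m` is the 1-jet of a
section, every element of `T*M_m` is an exact differential, and the failure of an anchor or of a
bundle map to respect brackets is linear over functions, as is the Jacobiator once the anchor
respects brackets. Hence these identities need to be checked on jets and on exact differentials
only, where they reduce to the Jacobi identities for `V` and for the Poisson bracket.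

For a bundle map `A : V → TM` and a section `δ` of `𝔇V` with symbol `X`, the expression
`[X, A u] - A (δ u)` is linear over functions in `u`, so `[A u, X](m)` depends only on the 1-jet of
`u` at `m`. Thus `[u]_m ↦ [A u, ·](m)` defines a map `𝔍V → 𝔇(TM)`; it is bijective when `A` is, by
the five lemma.

A symplectic form is inverted fibrewise; its closedness, evaluated on Hamiltonian vector fields, is
the Jacobi identity of the resulting bracket.
-/

noncomputable section

section LocalFrames

variable {E : Type*} [NormedAddCommGroup E] [NormedSpace ℝ E]
  {M : Type*} [TopologicalSpace M] [ChartedSpace E M]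
  {Fib : M → Type*} [∀ m, AddCommGroup (Fib m)] [∀ m, Module ℝ (Fib m)]

variable (E) in
/-- A local frame of the space of families `S` near `m₀`: finitely many members of `S` that form a
basis of every fibre near `m₀` and in which every member of `S` has smooth coefficients. -/
def HasLocalFrame (S : Submodule ℝ (∀ m, Fib m)) (m₀ : M) : Prop :=
  ∃ (n : ℕ) (e : Fin n → S),
    (∀ᶠ m in 𝓝 m₀, LinearIndependent ℝ (fun i => (e i).1 m) ∧
      Submodule.span ℝ (Set.range fun i => (e i).1 m) = ⊤) ∧
    ∀ s ∈ S, ∃ c : Fin n → SmoothFun E M, ∀ᶠ m in 𝓝 m₀, s m = ∑ i, c i m • (e i).1 m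

variable (E) in
/-- The families in `S` are the smooth sections of a vector bundle whose fibres are the spaces
`Fib m`; the smooth structure of the bundle is encoded by `S` alone. -/
structure IsSectionSpace (S : Submodule ℝ (∀ m, Fib m)) : Prop where
  fsmul_mem : ∀ (f : SmoothFun E M), ∀ s ∈ S, (fun m => f m • s m) ∈ S
  mem_of_local : ∀ s : (∀ m, Fib m), (∀ m₀, ∃ t ∈ S, ∀ᶠ m in 𝓝 m₀, s m = t m) → s ∈ S
  hasLocalFrame : ∀ m₀, HasLocalFrame E S m₀

variable {S : Submodule ℝ (∀ m, Fib m)}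

/-- Every element of every fibre is a value of a member of `G`. -/
def FillsFibers (G : Set S) : Prop := ∀ (m : M) (v : Fib m), ∃ g ∈ G, g.1 m = v

theorem hasLocalFrame_of_fintype {ι : Type*} [Fintype ι] {m₀ : M} (e : ι → S)
    (basis : ∀ᶠ m in 𝓝 m₀, LinearIndependent ℝ (fun i => (e i).1 m) ∧
      Submodule.span ℝ (Set.range fun i => (e i).1 m) = ⊤)
    (coeff : ∀ s ∈ S, ∃ c : ι → SmoothFun E M, ∀ᶠ m in 𝓝 m₀, s m = ∑ i, c i m • (e i).1 m) :
    HasLocalFrame E S m₀ := by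
  let σ := Fintype.equivFin ι
  refine ⟨Fintype.card ι, e ∘ σ.symm, ?_, fun s hs => ?_⟩
  · filter_upwards [basis] with m ⟨indep, span⟩
    refine ⟨indep.comp _ σ.symm.injective, ?_⟩
    rw [← span]
    exact congrArg _ (σ.symm.surjective.range_comp fun i => (e i).1 m)
  · obtain ⟨c, hc⟩ := coeff s hs
    refine ⟨c ∘ σ.symm, ?_⟩
    filter_upwards [hc] with m hm
    exact hm.trans (σ.symm.sum_comp fun i => c i m • (e i).1 m).symm

theorem HasLocalFrame.exists_frame_of_basis {m₀ : M} (hS : HasLocalFrame E S m₀)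
    {ι : Type*} [Fintype ι] (b : Module.Basis ι ℝ (Fib m₀)) :
    ∃ (e : ι → S) (b' : Module.Basis ι ℝ (Fib m₀)), (∀ i, (e i).1 m₀ = b' i) ∧
      ∀ s ∈ S, ∃ c : ι → SmoothFun E M, ∀ᶠ m in 𝓝 m₀, s m = ∑ i, c i m • (e i).1 m := by
  obtain ⟨n, e, he, coeff⟩ := hS
  let b' := Module.Basis.mk he.self_of_nhds.1 he.self_of_nhds.2.ge
  let σ := b'.indexEquiv b
  refine ⟨e ∘ σ.symm, b'.reindex σ, fun i => ?_, fun s hs => ?_⟩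
  · simp only [b', Module.Basis.reindex_apply, Module.Basis.mk_apply, Function.comp_apply]
  · obtain ⟨c, hc⟩ := coeff s hs
    refine ⟨c ∘ σ.symm, ?_⟩
    filter_upwards [hc] with m hm
    exact hm.trans (σ.symm.sum_comp fun i => c i m • (e i).1 m).symm

theorem sum_fsmul_mem (fsmul_mem : ∀ (f : SmoothFun E M), ∀ s ∈ S, (fun m => f m • s m) ∈ S)
    {ι : Type*} [Fintype ι] (c : ι → SmoothFun E M) {s : ι → ∀ m, Fib m} (hs : ∀ i, s i ∈ S) :
    (fun m => ∑ i, c i m • s i m) ∈ S := by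
  have sum_eq : (fun m => ∑ i, c i m • s i m) = ∑ i, fun m => c i m • s i m := by
    ext m
    simp only [Finset.sum_apply]
  rw [sum_eq]
  exact S.sum_mem fun i _ => fsmul_mem (c i) _ (hs i)

/-- Multiplication of a member of `S` by a smooth function. -/
def IsSectionSpace.fsmul (hS : IsSectionSpace E S) (f : SmoothFun E M) (s : S) : S :=
  ⟨fun m => f m • s.1 m, hS.fsmul_mem f s.1 s.2⟩

theorem IsSectionSpace.exists_apply_eq (hS : IsSectionSpace E S) (m : M) (v : Fib m) :
    ∃ s : S, s.1 m = v := by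
  obtain ⟨n, e, he, -⟩ := hS.hasLocalFrame m
  obtain ⟨c, hc⟩ := (Submodule.mem_span_range_iff_exists_fun ℝ).1
    (he.self_of_nhds.2 ▸ Submodule.mem_top : v ∈ Submodule.span ℝ (Set.range fun i => (e i).1 m))
  refine ⟨∑ i, c i • e i, ?_⟩
  rw [Submodule.coe_sum, Finset.sum_apply, ← hc]
  rfl

section Smooth

variable [FiniteDimensional ℝ E] [T2Space M] [IsManifold 𝓘(ℝ, E) ∞ M]

theorem exists_smoothFun_eq_one_near {m : M} {U : Set M} (hU : U ∈ 𝓝 m) :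
    ∃ f : SmoothFun E M, (∀ᶠ p in 𝓝 m, f p = 1) ∧ ∀ p, p ∉ U → f p = 0 := by
  obtain ⟨ψ, -, hψ⟩ := (SmoothBumpFunction.nhds_basis_tsupport (I := 𝓘(ℝ, E)) m).mem_iff.1 hU
  exact ⟨⟨ψ, ψ.contMDiff⟩, ψ.eventuallyEq_one,
    fun p hp => image_eq_zero_of_notMem_tsupport fun h => hp (hψ h)⟩

theorem exists_smoothFun_mul_eq_one_near {m : M} {d : SmoothFun E M} (hd : d m ≠ 0) :
    ∃ g : SmoothFun E M, ∀ᶠ p in 𝓝 m, g p * d p = 1 := by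
  have isOpen_ne : IsOpen {p | d p ≠ 0} := isOpen_ne_fun d.contMDiff.continuous continuous_const
  obtain ⟨g, hg⟩ := exists_fun_eventuallyEq isOpen_ne hd (fun p => (d p)⁻¹) fun p hp =>
    ((contDiffAt_inv ℝ hp).contMDiffAt.comp p d.contMDiff.contMDiffAt).contMDiffWithinAt
  refine ⟨g, ?_⟩
  filter_upwards [hg, isOpen_ne.mem_nhds hd] with p hp hp'
  rw [hp, inv_mul_cancel₀ hp']

theorem exists_smoothFun_mulVec_eq_near {ι : Type*} [Fintype ι] [DecidableEq ι] {m₀ : M}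
    (a : Matrix ι ι (SmoothFun E M)) (c : ι → SmoothFun E M) (ha : a.det m₀ ≠ 0) :
    ∃ d : ι → SmoothFun E M, ∀ᶠ m in 𝓝 m₀, ∀ i, ∑ j, a i j m * d j m = c i m := by
  obtain ⟨g, hg⟩ := exists_smoothFun_mul_eq_one_near ha
  refine ⟨fun j => g * a.cramer c j, ?_⟩
  filter_upwards [hg] with m hm i
  have cramer_eq : ∑ j, a i j * (g * a.cramer c j) = g * a.det * c i := by
    have := congrFun (a.mulVec_cramer c) i
    rw [mul_assoc]
    refine Eq.trans ?_ (congrArg (g * ·) this)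
    simp only [Matrix.mulVec, dotProduct, Finset.mul_sum]
    exact Finset.sum_congr rfl fun j _ => mul_left_comm _ _ _
  have at_m := congrArg (ContMDiffMap.evalRingHom (I := 𝓘(ℝ, E)) (I' := 𝓘(ℝ, ℝ)) m) cramer_eq
  rw [map_sum, map_mul, map_mul] at at_m
  refine at_m.trans ?_
  change g m * a.det m * c i m = c i m
  rw [hm, one_mul]

theorem det_ne_zero_of_basis_eq_sum {ι W : Type*} [Fintype ι] [DecidableEq ι] [AddCommGroup W]
    [Module ℝ W] (b b' : Module.Basis ι ℝ W) {a : Matrix ι ι ℝ}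
    (h : ∀ j, b j = ∑ i, a i j • b' i) : a.det ≠ 0 := by
  have toMatrix_eq : b'.toMatrix b = a := by
    ext i j
    rw [Module.Basis.toMatrix_apply, h, b'.repr_sum_self]
  rw [← toMatrix_eq, ← Module.Basis.det_apply]
  exact (b'.isUnit_det b).ne_zero

theorem HasLocalFrame.exists_coeff_of_basis {m₀ : M} (hS : HasLocalFrame E S m₀)
    {ι : Type*} [Fintype ι] (b : Module.Basis ι ℝ (Fib m₀)) {f : ι → S}
    (hf : ∀ i, (f i).1 m₀ = b i) {t : ∀ m, Fib m} (ht : t ∈ S) :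
    ∃ d : ι → SmoothFun E M, ∀ᶠ m in 𝓝 m₀, t m = ∑ i, d i m • (f i).1 m := by
  classical
  obtain ⟨e, b', hb', coeff⟩ := hS.exists_frame_of_basis b
  choose a ha using fun i => coeff (f i).1 (f i).2
  obtain ⟨c, hc⟩ := coeff t ht
  let A : Matrix ι ι (SmoothFun E M) := Matrix.of fun i j => a j i
  have det_ne : A.det m₀ ≠ 0 := by
    have := det_ne_zero_of_basis_eq_sum b b' (a := A.map fun f => f m₀) fun j => by
      rw [← hf, (ha j).self_of_nhds]
      simp only [hb', A, Matrix.map_apply, Matrix.of_apply]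
    let ev : SmoothFun E M →+* ℝ := ContMDiffMap.evalRingHom m₀
    exact fun h => this ((RingHom.map_det ev A).symm.trans h)
  obtain ⟨d, hd⟩ := exists_smoothFun_mulVec_eq_near A c det_ne
  refine ⟨d, ?_⟩
  filter_upwards [hd, hc, eventually_all.2 ha] with m hdm hcm ham
  calc t m = ∑ i, ∑ j, d j m • a j i m • (e i).1 m := by
        simp only [hcm, ← hdm, Finset.sum_smul, smul_smul, mul_comm, A, Matrix.of_apply]
    _ = ∑ j, d j m • (f j).1 m := by
        simp only [ham, Finset.smul_sum]
        exact Finset.sum_comm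

namespace IsSectionSpace

variable (hS : IsSectionSpace E S)
include hS

theorem map_eq_zero_of_tensorial {m : M} {W : Type*} [AddCommGroup W] [Module ℝ W]
    (T : S →ₗ[ℝ] W) (hT : ∀ f s, T (hS.fsmul f s) = f m • T s) {s : S} (hs : s.1 m = 0) :
    T s = 0 := by
  obtain ⟨n, e, he, coeff⟩ := hS.hasLocalFrame m
  obtain ⟨c, hc⟩ := coeff s.1 s.2
  obtain ⟨f, hf, hf'⟩ := exists_smoothFun_eq_one_near (E := E) hc
  have expansion : hS.fsmul f s = hS.fsmul f (∑ i, hS.fsmul (c i) (e i)) := by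
    refine Subtype.ext (funext fun p => ?_)
    change f p • s.1 p = f p • (∑ i, hS.fsmul (c i) (e i) : S).1 p
    by_cases hp : s.1 p = ∑ i, c i p • (e i).1 p
    · rw [hp, Submodule.coe_sum, Finset.sum_apply]
      rfl
    · rw [hf' p hp, zero_smul, zero_smul]
  have map_expansion := congrArg T expansion
  rw [hT, hT, hf.self_of_nhds, one_smul, one_smul, map_sum] at map_expansion
  have coeff_eq_zero := Fintype.linearIndependent_iff.1 he.self_of_nhds.1 (fun i => c i m)
    (hc.self_of_nhds.symm.trans hs)
  rw [map_expansion]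
  exact Finset.sum_eq_zero fun i _ => by rw [hT, coeff_eq_zero i, zero_smul]

theorem map_eq_of_tensorial {m : M} {W : Type*} [AddCommGroup W] [Module ℝ W]
    (T : S →ₗ[ℝ] W) (hT : ∀ f s, T (hS.fsmul f s) = f m • T s) {s t : S} (hst : s.1 m = t.1 m) :
    T s = T t := by
  rw [← sub_eq_zero, ← map_sub]
  exact hS.map_eq_zero_of_tensorial T hT (sub_eq_zero.2 hst)

theorem map_eq_zero_of_fillsFibers {G : Set S} (hG : FillsFibers G) {m : M} {W : Type*}
    [AddCommGroup W] [Module ℝ W] (T : S →ₗ[ℝ] W) (hT : ∀ f s, T (hS.fsmul f s) = f m • T s)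
    (h : ∀ g ∈ G, T g = 0) (s : S) : T s = 0 := by
  obtain ⟨g, hg, hgs⟩ := hG m (s.1 m)
  rw [hS.map_eq_of_tensorial T hT hgs.symm, h g hg]

variable {B : M → Type*} [∀ m, AddCommGroup (B m)] [∀ m, Module ℝ (B m)]
  {SB : Submodule ℝ (∀ m, B m)} (hSB : IsSectionSpace E SB)
include hSB

theorem map_mem_of_fillsFibers {G : Set S} (hG : FillsFibers G) (φ : ∀ m, Fib m →ₗ[ℝ] B m)
    (hφ : ∀ g ∈ G, (fun m => φ m (g.1 m)) ∈ SB) {s : ∀ m, Fib m} (hs : s ∈ S) :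
    (fun m => φ m (s m)) ∈ SB := by
  refine hSB.mem_of_local _ fun m₀ => ?_
  obtain ⟨n, e, he, -⟩ := hS.hasLocalFrame m₀
  let b := Module.Basis.mk he.self_of_nhds.1 he.self_of_nhds.2.ge
  choose g hgG hg using fun i => hG m₀ (b i)
  obtain ⟨d, hd⟩ := (hS.hasLocalFrame m₀).exists_coeff_of_basis b hg hs
  refine ⟨_, sum_fsmul_mem hSB.fsmul_mem d fun i => hφ (g i) (hgG i), ?_⟩
  filter_upwards [hd] with m hm
  simp only [hm, map_sum, map_smul]

theorem symm_mem (φ : ∀ m, Fib m ≃ₗ[ℝ] B m) (hφ : ∀ s ∈ S, (fun m => φ m (s m)) ∈ SB)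
    {t : ∀ m, B m} (ht : t ∈ SB) : (fun m => (φ m).symm (t m)) ∈ S := by
  let G : Set SB := Set.range fun s : S => ⟨fun m => φ m (s.1 m), hφ s.1 s.2⟩
  have hG : FillsFibers G := fun m v => by
    obtain ⟨s, hs⟩ := hS.exists_apply_eq m ((φ m).symm v)
    exact ⟨_, ⟨s, rfl⟩, (congrArg (φ m) hs).trans ((φ m).apply_symm_apply v)⟩
  refine hSB.map_mem_of_fillsFibers hS hG (fun m => (φ m).symm.toLinearMap) ?_ ht
  rintro _ ⟨s, rfl⟩
  simp only [LinearEquiv.coe_coe, LinearEquiv.symm_apply_apply, SetLike.coe_mem]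

end IsSectionSpace

end Smooth

end LocalFrames

section Extensions

theorem linearIndependent_sumElim_of_exact {R K G Q ι κ : Type*} [Ring R] [AddCommGroup K]
    [Module R K] [AddCommGroup G] [Module R G] [AddCommGroup Q] [Module R Q] {i : K →ₗ[R] G}
    {p : G →ₗ[R] Q} (hi : Function.Injective i) (hip : Function.Exact i p) {k : ι → K} {g : κ → G}
    (hk : LinearIndependent R k) (hg : LinearIndependent R (p ∘ g)) :
    LinearIndependent R (Sum.elim (i ∘ k) g) := by
  refine (hk.map' i (LinearMap.ker_eq_bot.2 hi)).sum_type (hg.of_comp p)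
    ((Submodule.range_ker_disjoint hg).symm.mono_left (Submodule.span_le.2 ?_))
  rintro _ ⟨j, rfl⟩
  exact hip.apply_apply_eq_zero (k j)

theorem span_sumElim_eq_top_of_exact {R K G Q ι κ : Type*} [Ring R] [AddCommGroup K]
    [Module R K] [AddCommGroup G] [Module R G] [AddCommGroup Q] [Module R Q] {i : K →ₗ[R] G}
    {p : G →ₗ[R] Q} (hip : Function.Exact i p) {k : ι → K} {g : κ → G}
    (hk : Submodule.span R (Set.range k) = ⊤) (hg : Submodule.span R (Set.range (p ∘ g)) = ⊤) :
    Submodule.span R (Set.range (Sum.elim (i ∘ k) g)) = ⊤ := by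
  set N := Submodule.span R (Set.range (Sum.elim (i ∘ k) g)) with hN
  rw [Set.Sum.elim_range, Submodule.span_union, Set.range_comp, ← Submodule.map_span, hk,
    Submodule.map_top, ← hip.linearMap_ker_eq] at hN
  have map_eq_top : N.map p = ⊤ := by
    rw [hN, Submodule.map_sup, Submodule.map_span, ← Set.range_comp, hg, sup_top_eq]
  rw [← sup_eq_left.2 (hN ▸ le_sup_left : LinearMap.ker p ≤ N), ← Submodule.comap_map_eq,
    map_eq_top, Submodule.comap_top]

variable {E : Type*} [NormedAddCommGroup E] [NormedSpace ℝ E] [FiniteDimensional ℝ E]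
  {M : Type*} [TopologicalSpace M] [ChartedSpace E M] [T2Space M] [IsManifold 𝓘(ℝ, E) ∞ M]
  {K G Q : M → Type*} [∀ m, AddCommGroup (K m)] [∀ m, Module ℝ (K m)]
  [∀ m, AddCommGroup (G m)] [∀ m, Module ℝ (G m)] [∀ m, AddCommGroup (Q m)] [∀ m, Module ℝ (Q m)]
  {SK : Submodule ℝ (∀ m, K m)} {SG : Submodule ℝ (∀ m, G m)} {SQ : Submodule ℝ (∀ m, Q m)}

theorem exists_mem_eq_near_of_apply_eq_zero_near {i : ∀ m, K m →ₗ[ℝ] G m} {p : ∀ m, G m →ₗ[ℝ] Q m}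
    (hip : ∀ m, Function.Exact (i m) (p m))
    (fsmul_mem : ∀ (f : SmoothFun E M), ∀ s ∈ SG, (fun m => f m • s m) ∈ SG)
    (hi : ∀ k, (fun m => i m (k m)) ∈ SG → k ∈ SK) {s : ∀ m, G m} (hs : s ∈ SG) {m₀ : M}
    (hps : ∀ᶠ m in 𝓝 m₀, p m (s m) = 0) : ∃ k ∈ SK, ∀ᶠ m in 𝓝 m₀, i m (k m) = s m := by
  obtain ⟨f, hf, hf'⟩ := exists_smoothFun_eq_one_near (E := E) hps
  have apply_eq_zero (m : M) : p m (f m • s m) = 0 := by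
    by_cases hm : p m (s m) = 0
    · rw [map_smul, hm, smul_zero]
    · rw [hf' m hm, zero_smul, map_zero]
  choose k hk using fun m => (hip m _).1 (apply_eq_zero m)
  refine ⟨k, hi k ((funext hk : (fun m => i m (k m)) = _) ▸ fsmul_mem f s hs), ?_⟩
  filter_upwards [hf] with m hm
  rw [hk, hm, one_smul]

theorem IsSectionSpace.of_exact (hK : IsSectionSpace E SK) (hQ : IsSectionSpace E SQ)
    {i : ∀ m, K m →ₗ[ℝ] G m} {p : ∀ m, G m →ₗ[ℝ] Q m} (inj : ∀ m, Function.Injective (i m))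
    (hip : ∀ m, Function.Exact (i m) (p m))
    (fsmul_mem : ∀ (f : SmoothFun E M), ∀ s ∈ SG, (fun m => f m • s m) ∈ SG)
    (mem_of_local : ∀ s : (∀ m, G m), (∀ m₀, ∃ t ∈ SG, ∀ᶠ m in 𝓝 m₀, s m = t m) → s ∈ SG)
    (hi : ∀ k, (fun m => i m (k m)) ∈ SG ↔ k ∈ SK) (hp : ∀ s ∈ SG, (fun m => p m (s m)) ∈ SQ)
    (lift : ∀ q ∈ SQ, ∀ m₀, ∃ s ∈ SG, ∀ᶠ m in 𝓝 m₀, p m (s m) = q m) :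
    IsSectionSpace E SG := by
  refine ⟨fsmul_mem, mem_of_local, fun m₀ => ?_⟩
  obtain ⟨a, k, hk, coeffK⟩ := hK.hasLocalFrame m₀
  obtain ⟨b, q, hq, coeffQ⟩ := hQ.hasLocalFrame m₀
  choose g hgS hg using fun j => lift (q j).1 (q j).2 m₀
  refine hasLocalFrame_of_fintype
    (Sum.elim (fun j => ⟨_, (hi _).2 (k j).2⟩) fun j => ⟨g j, hgS j⟩) ?_ fun s hs => ?_
  · filter_upwards [hk, hq, eventually_all.2 hg] with m hkm hqm hgm
    have frame_eq : (fun j => ((Sum.elim (fun j => ⟨_, (hi _).2 (k j).2⟩) fun j => ⟨g j, hgS j⟩ :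
        Fin a ⊕ Fin b → SG) j).1 m) = Sum.elim (i m ∘ fun j => (k j).1 m) fun j => g j m := by
      ext (j | j) <;> rfl
    have comp_eq : (p m ∘ fun j => g j m) = fun j => (q j).1 m := funext hgm
    rw [frame_eq]
    exact ⟨linearIndependent_sumElim_of_exact (inj m) (hip m) hkm.1 (comp_eq ▸ hqm.1),
      span_sumElim_eq_top_of_exact (hip m) hkm.2 (comp_eq ▸ hqm.2)⟩
  · obtain ⟨c, hc⟩ := coeffQ _ (hp s hs)
    obtain ⟨x, hx, hxs⟩ := exists_mem_eq_near_of_apply_eq_zero_near hip fsmul_mem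
      (fun k => (hi k).1) (SG.sub_mem hs (sum_fsmul_mem fsmul_mem c hgS)) (m₀ := m₀) (by
        filter_upwards [hc, eventually_all.2 hg] with m hcm hgm
        simp only [Pi.sub_apply, map_sub, map_sum, map_smul, hgm, hcm, sub_self])
    obtain ⟨d, hd⟩ := coeffK x hx
    refine ⟨Sum.elim d c, ?_⟩
    filter_upwards [hxs, hd] with m hxm hdm
    rw [Fintype.sum_sum_type]
    refine (sub_eq_iff_eq_add.1 hxm.symm).trans (congrArg (· + _) ?_)
    simp only [hdm, map_sum, map_smul, Sum.elim_inl]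

end Extensions

section SectionsOfBundles

variable {E : Type*} [NormedAddCommGroup E] [NormedSpace ℝ E]
  {M : Type*} [TopologicalSpace M] [ChartedSpace E M]
  {F : Type*} [NormedAddCommGroup F] [NormedSpace ℝ F]
  {V : M → Type*} [TopologicalSpace (TotalSpace F V)] [∀ m, AddCommGroup (V m)]
  [∀ m, Module ℝ (V m)] [∀ m, TopologicalSpace (V m)] [FiberBundle F V] [VectorBundle ℝ F V]

variable (E F V) in
/-- The smooth sections of `V` among all families of elements of the fibres. -/
def secSubmodule : Submodule ℝ (∀ m, V m) where
  carrier := {s | ContMDiff 𝓘(ℝ, E) (𝓘(ℝ, E).prod 𝓘(ℝ, F)) ∞ (fun m => TotalSpace.mk' F m (s m))}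
  zero_mem' := (0 : Sec E F V).contMDiff
  add_mem' ha hb := ha.add_section hb
  smul_mem' c _ ha := ha.const_smul_section (a := c)

theorem contMDiff_of_eq_near {s : ∀ m, V m}
    (h : ∀ m₀, ∃ t ∈ secSubmodule E F V, ∀ᶠ m in 𝓝 m₀, s m = t m) : s ∈ secSubmodule E F V := by
  intro m₀
  obtain ⟨t, ht, hst⟩ := h m₀
  refine (ht m₀).congr_of_eventuallyEq ?_
  filter_upwards [hst] with m hm
  rw [hm]

variable [FiniteDimensional ℝ E] [IsManifold 𝓘(ℝ, E) ∞ M] [T2Space M]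
  [ContMDiffVectorBundle ∞ F V 𝓘(ℝ, E)] [FiniteDimensional ℝ F]

theorem hasLocalFrame_secSubmodule (m : M) :
    HasLocalFrame E (secSubmodule E F V) m := by
  have : ContMDiffVectorBundle 1 F V 𝓘(ℝ, E) := ContMDiffVectorBundle.of_le (n := ∞) (by simp)
  let t := trivializationAt F V m
  let b := Module.finBasis ℝ F
  have hm : m ∈ t.baseSet := FiberBundle.mem_baseSet_trivializationAt F V m
  choose e he using fun i => exists_sec_eventuallyEq t.open_baseSet hm _
    (t.contMDiffOn_localFrame_baseSet (I := 𝓘(ℝ, E)) ∞ b i)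
  refine hasLocalFrame_of_fintype (fun i => ⟨e i, (e i).contMDiff⟩) ?_ fun s hs => ?_
  · have frame := t.isLocalFrameOn_localFrame_baseSet 𝓘(ℝ, E) ∞ b
    filter_upwards [eventually_all.2 he, t.open_baseSet.mem_nhds hm] with p hp hpb
    simp only [hp]
    exact ⟨frame.linearIndependent hpb, eq_top_iff.2 (frame.generating hpb)⟩
  · choose c hc using fun i => exists_fun_eventuallyEq t.open_baseSet hm _
      (contMDiffOn_baseSet_localFrameCoeff (k := ∞) (e := t) b (s := s) hs.contMDiffOn i)
    refine ⟨c, ?_⟩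
    filter_upwards [t.eventually_eq_localFrame_sum_coeff_smul (I := 𝓘(ℝ, E)) b (s := s) hm,
      eventually_all.2 he, eventually_all.2 hc] with p expansion hep hcp
    rw [expansion]
    exact Finset.sum_congr rfl fun i _ => by rw [hep, hcp]; rfl

theorem isSectionSpace_secSubmodule : IsSectionSpace E (secSubmodule E F V) where
  fsmul_mem f s hs := (Sec.fsmul f (⟨s, hs⟩ : Sec E F V)).contMDiff
  mem_of_local _ := contMDiff_of_eq_near
  hasLocalFrame := hasLocalFrame_secSubmodule

end SectionsOfBundles

section GaugeAlgebroid

variable {E : Type*} [NormedAddCommGroup E] [NormedSpace ℝ E]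
  {M : Type*} [TopologicalSpace M] [ChartedSpace E M] [IsManifold 𝓘(ℝ, E) ∞ M]
  {F : Type*} [NormedAddCommGroup F] [NormedSpace ℝ F]
  {V : M → Type*} [TopologicalSpace (TotalSpace F V)] [∀ m, AddCommGroup (V m)]
  [∀ m, Module ℝ (V m)] [∀ m, TopologicalSpace (V m)] [FiberBundle F V] [VectorBundle ℝ F V]

theorem gaugeSec_mem_of_eq_near {s : ∀ m, Gauge E F V m}
    (h : ∀ m₀, ∃ t ∈ GaugeSec E F V, ∀ᶠ m in 𝓝 m₀, s m = t m) : s ∈ GaugeSec E F V := by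
  refine ⟨fun u => contMDiff_of_eq_near fun m₀ => ?_, contMDiff_of_eq_near fun m₀ => ?_⟩ <;>
    obtain ⟨t, ht, hst⟩ := h m₀
  · exact ⟨_, ht.1 u, hst.mono fun m hm => congrArg (fun d : Gauge E F V m => d.1.1 u) hm⟩
  · exact ⟨_, ht.2, hst.mono fun m hm => congrArg Gauge.anchor hm⟩

variable [FiniteDimensional ℝ E]

theorem VF.bracket_jacobi (X Y Z : VF E M) :
    X.bracket (Y.bracket Z) + Y.bracket (Z.bracket X) + Z.bracket (X.bracket Y) = 0 := by
  have : IsManifold 𝓘(ℝ, E) (minSmoothness ℝ 3) M := by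
    simp only [minSmoothness_of_isRCLikeNormedField]
    exact IsManifold.of_le (n := ∞) (WithTop.coe_le_coe.2 le_top)
  have smooth (W : VF E M) (m : M) : ContMDiffAt 𝓘(ℝ, E) 𝓘(ℝ, E).tangent (minSmoothness ℝ 2)
      (fun p => (W p : TangentBundle 𝓘(ℝ, E) M)) m := by
    simp only [minSmoothness_of_isRCLikeNormedField]
    exact (W.contMDiff m).of_le (WithTop.coe_le_coe.2 le_top)
  have bracket_leibniz :
      X.bracket (Y.bracket Z) = (X.bracket Y).bracket Z + Y.bracket (X.bracket Z) :=
    Sec.ext' fun m => leibniz_identity_mlieBracket_apply (smooth X m) (smooth Y m) (smooth Z m)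
  have bracket_neg : Y.bracket (-X.bracket Z) = -Y.bracket (X.bracket Z) := by
    simpa using VF.bracket_smul_right (-1) Y (X.bracket Z)
  rw [bracket_leibniz, VF.bracket_swap (X.bracket Y) Z, VF.bracket_swap Z X, bracket_neg]
  abel

variable [ContMDiffVectorBundle ∞ F V 𝓘(ℝ, E)]

theorem GaugeSec.bracket_swap (δ δ' : GaugeSec E F V) :
    GaugeSec.bracket δ δ' = - GaugeSec.bracket δ' δ :=
  GaugeSec.ext (fun _ => (neg_sub _ _).symm) (VF.bracket_swap _ _)

theorem GaugeSec.bracket_jacobi (r s t : GaugeSec E F V) :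
    GaugeSec.bracket r (GaugeSec.bracket s t) + GaugeSec.bracket s (GaugeSec.bracket t r) +
      GaugeSec.bracket t (GaugeSec.bracket r s) = 0 := by
  refine GaugeSec.ext (fun u => ?_) (VF.bracket_jacobi _ _ _)
  change GaugeSec.op (GaugeSec.bracket r (GaugeSec.bracket s t)) u +
    GaugeSec.op (GaugeSec.bracket s (GaugeSec.bracket t r)) u +
    GaugeSec.op (GaugeSec.bracket t (GaugeSec.bracket r s)) u = 0
  simp only [GaugeSec.op_bracket, map_sub]
  abel

variable [T2Space M]

theorem Gauge.ofEnd_injective (m : M) :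
    Function.Injective (Gauge.ofEnd : (V m →ₗ[ℝ] V m) →ₗ[ℝ] Gauge E F V m) := by
  intro Φ Ψ h
  refine LinearMap.ext fun v => ?_
  obtain ⟨u, rfl⟩ := exists_sec_apply_eq (E := E) (F := F) m v
  exact congrArg (fun d : Gauge E F V m => d.1.1 u) h

theorem Gauge.exact_ofEnd_anchor [FiniteDimensional ℝ F] (m : M) :
    Function.Exact (Gauge.ofEnd : (V m →ₗ[ℝ] V m) →ₗ[ℝ] Gauge E F V m) Gauge.anchor := fun d =>
  ⟨fun h => (Gauge.exists_eq_ofEnd d h).imp fun _ h => h.symm, by rintro ⟨Φ, rfl⟩; rfl⟩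

theorem exists_gaugeSec_anchor_eq_near (X : VF E M) (m₀ : M) :
    ∃ δ : GaugeSec E F V, ∀ᶠ m in 𝓝 m₀, Gauge.anchor (δ.1 m) = X m := by
  obtain ⟨D, χ, -, hχ, hD⟩ := exists_local_connection (E := E) (F := F) (V := V) m₀
  refine ⟨D X, ?_⟩
  filter_upwards [hχ] with m hm
  change GaugeSec.anchor (D X) m = _
  rw [hD]
  change χ m • X m = X m
  rw [hm, one_smul]

theorem Gauge.anchor_surjective (m : M) :
    Function.Surjective (Gauge.anchor : Gauge E F V m →ₗ[ℝ] TangentSpace 𝓘(ℝ, E) m) := by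
  intro v
  obtain ⟨X, rfl⟩ := exists_sec_apply_eq (E := E) (F := E) m v
  obtain ⟨δ, hδ⟩ := exists_gaugeSec_anchor_eq_near (F := F) (V := V) X m
  exact ⟨δ.1 m, hδ.self_of_nhds⟩

variable [FiniteDimensional ℝ F] [∀ m, IsTopologicalAddGroup (V m)] [∀ m, ContinuousSMul ℝ (V m)]

theorem isSectionSpace_gaugeSec : IsSectionSpace E (GaugeSec E F V) := by
  refine IsSectionSpace.of_exact (K := fun m => V m →L[ℝ] V m)
    (Q := (TangentSpace 𝓘(ℝ, E) : M → Type _))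
    (SK := secSubmodule E (F →L[ℝ] F) _) (SQ := secSubmodule E E _)
    (i := fun m => Gauge.ofEnd ∘ₗ ContinuousLinearMap.coeLM ℝ) (p := fun m => Gauge.anchor)
    isSectionSpace_secSubmodule isSectionSpace_secSubmodule ?_ ?_
    (fun f δ hδ => (GaugeSec.fsmul f ⟨δ, hδ⟩).2) (fun _ => gaugeSec_mem_of_eq_near)
    (fun A => ⟨fun h => contMDiff_hom_of_apply A fun u => h.1 u,
      fun h => (GaugeSec.ofHom ⟨A, h⟩).2⟩) (fun _ h => h.2) fun X hX m₀ => ?_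
  · exact fun m => (Gauge.ofEnd_injective m).comp ContinuousLinearMap.coe_injective
  · intro m d
    rw [Gauge.exact_ofEnd_anchor m d]
    constructor
    · rintro ⟨Φ, rfl⟩
      obtain ⟨A, rfl⟩ := exists_clm_eq Φ (0 : Sec E F V)
      exact ⟨A, rfl⟩
    · rintro ⟨A, rfl⟩
      exact ⟨_, rfl⟩
  · obtain ⟨δ, hδ⟩ := exists_gaugeSec_anchor_eq_near (F := F) (V := V) ⟨X, hX⟩ m₀
    exact ⟨δ.1, δ.2, hδ⟩

theorem gaugeAlgebroid_isLieAlgebroid : (gaugeAlgebroid E F V).IsLieAlgebroid where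
  fsmul_mem := isSectionSpace_gaugeSec.fsmul_mem
  mem_of_local := isSectionSpace_gaugeSec.mem_of_local
  exists_frame := isSectionSpace_gaugeSec.hasLocalFrame
  anchor_smooth _ hs := hs.2
  bracket_add := GaugeSec.bracket_add_right
  bracket_smul := GaugeSec.bracket_smul_right
  bracket_skew := GaugeSec.bracket_swap
  jacobi := GaugeSec.bracket_jacobi
  leibniz f s t t' h m := by
    obtain rfl : t' = GaugeSec.fsmul f t := Subtype.ext (funext h)
    exact congrArg (fun δ : GaugeSec E F V => δ.1 m) (GaugeSec.bracket_fsmul_right f s t)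
  anchor_bracket _ _ _ := rfl

end GaugeAlgebroid

section Generators

universe w w'

variable {E : Type*} [NormedAddCommGroup E] [NormedSpace ℝ E]
  {M : Type*} [TopologicalSpace M] [ChartedSpace E M] [IsManifold 𝓘(ℝ, E) ∞ M]

namespace IsSectionSpace

variable {Fib : M → Type*} [∀ m, AddCommGroup (Fib m)] [∀ m, Module ℝ (Fib m)]
  {S : Submodule ℝ (∀ m, Fib m)}

/-- `D` is a derivation of the module of sections `S` with symbol `X`. -/
def IsDerivation (hS : IsSectionSpace E S) (D : Module.End ℝ S) (X : VF E M) : Prop :=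
  ∀ f s, D (hS.fsmul f s) = hS.fsmul f (D s) + hS.fsmul (X.deriv f) s

variable {hS : IsSectionSpace E S} {D D' : Module.End ℝ S} {X Y : VF E M}

theorem IsDerivation.sub_fsmul (hD : hS.IsDerivation D X) (hD' : hS.IsDerivation D' X)
    (f : SmoothFun E M) (s : S) : (D - D') (hS.fsmul f s) = hS.fsmul f ((D - D') s) := by
  rw [LinearMap.sub_apply, hD f, hD' f, add_sub_add_right_eq_sub]
  exact Subtype.ext (funext fun m => (smul_sub (f m) _ _).symm)

variable [FiniteDimensional ℝ E]

theorem IsDerivation.lie (hD : hS.IsDerivation D X) (hD' : hS.IsDerivation D' Y) :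
    hS.IsDerivation ⁅D, D'⁆ (X.bracket Y) := by
  intro f s
  have deriv_bracket (m : M) : (X.bracket Y).deriv f m = X.deriv (Y.deriv f) m -
      Y.deriv (X.deriv f) m := VF.bracket_deriv X Y f m
  simp only [Ring.lie_def, LinearMap.sub_apply, Module.End.mul_apply]
  rw [hD' f, hD f, map_add, map_add, hD f, hD (Y.deriv f), hD' f, hD' (X.deriv f)]
  refine Subtype.ext (funext fun m => ?_)
  simp only [fsmul, Submodule.coe_add, Submodule.coe_sub, Pi.add_apply, Pi.sub_apply, deriv_bracket]
  module

theorem eq_zero_of_skew_of_fillsFibers [T2Space M] (hS : IsSectionSpace E S) {G : Set S}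
    (hG : FillsFibers G) {m : M} {W : Type*} [AddCommGroup W] [Module ℝ W] (β : S → S →ₗ[ℝ] W)
    (hβ : ∀ f s t, β s (hS.fsmul f t) = f m • β s t) (skew : ∀ s t, β s t = -β t s)
    (h : ∀ s ∈ G, ∀ t ∈ G, β s t = 0) (s t : S) : β s t = 0 := by
  have eq_zero_left (s) (hs : s ∈ G) (t) : β s t = 0 :=
    hS.map_eq_zero_of_fillsFibers hG (β s) (fun f => hβ f s) (h s hs) t
  refine hS.map_eq_zero_of_fillsFibers hG (β s) (fun f => hβ f s) (fun t ht => ?_) t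
  rw [skew, eq_zero_left t ht, neg_zero]

end IsSectionSpace

/-- `A` is a Lie algebroid except that the Jacobi identity and the compatibility of the anchor with
the brackets may fail. -/
structure AlgebroidData.IsSkewAlgebroid (A : AlgebroidData.{w} E M) : Prop
    extends IsSectionSpace E A.sections where
  anchor_smooth : ∀ s ∈ A.sections, ContMDiff 𝓘(ℝ, E) (𝓘(ℝ, E).prod 𝓘(ℝ, E)) ∞
    (fun m => TotalSpace.mk' E (E := (TangentSpace 𝓘(ℝ, E) : M → Type _)) m (A.anchor m (s m)))
  bracket_add : ∀ r s t, A.bracket r (s + t) = A.bracket r s + A.bracket r t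
  bracket_smul : ∀ (c : ℝ) s t, A.bracket s (c • t) = c • A.bracket s t
  bracket_skew : ∀ s t, A.bracket s t = -A.bracket t s
  leibniz : ∀ (f : SmoothFun E M) (s t : A.sections) (m : M),
    (A.bracket s (toIsSectionSpace.fsmul f t)).1 m =
      f m • (A.bracket s t).1 m + mvfderiv 𝓘(ℝ, E) f m (A.anchor m (s.1 m)) • t.1 m

theorem AlgebroidData.IsLieAlgebroid.isSkewAlgebroid {A : AlgebroidData.{w} E M}
    (hA : A.IsLieAlgebroid) : A.IsSkewAlgebroid where
  fsmul_mem := hA.fsmul_mem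
  mem_of_local := hA.mem_of_local
  hasLocalFrame := hA.exists_frame
  anchor_smooth := hA.anchor_smooth
  bracket_add := hA.bracket_add
  bracket_smul := hA.bracket_smul
  bracket_skew := hA.bracket_skew
  leibniz f s t m := hA.leibniz f s t _ (fun _ => rfl) m

namespace AlgebroidData.IsSkewAlgebroid

variable {A : AlgebroidData.{w} E M} {B : AlgebroidData.{w'} E M}
  (hA : A.IsSkewAlgebroid) (hB : B.IsSkewAlgebroid)

/-- The operator `[s, ·]` on sections. -/
def ad (s : A.sections) : Module.End ℝ A.sections where
  toFun := A.bracket s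
  map_add' := hA.bracket_add s
  map_smul' c := hA.bracket_smul c s

variable [FiniteDimensional ℝ E]

/-- The anchor as a map from sections to vector fields. -/
def anchorVF : A.sections →ₗ[ℝ] VF E M where
  toFun s := ⟨fun m => A.anchor m (s.1 m), hA.anchor_smooth s.1 s.2⟩
  map_add' s t := Sec.ext' fun m => (A.anchor m).map_add (s.1 m) (t.1 m)
  map_smul' c s := Sec.ext' fun m => (A.anchor m).map_smul c (s.1 m)

theorem anchorVF_fsmul (f : SmoothFun E M) (s : A.sections) :
    hA.anchorVF (hA.fsmul f s) = (hA.anchorVF s).fsmul f :=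
  Sec.ext' fun m => (A.anchor m).map_smul (f m) (s.1 m)

theorem isDerivation_ad (s : A.sections) :
    hA.toIsSectionSpace.IsDerivation (hA.ad s) (hA.anchorVF s) := fun f t =>
  Subtype.ext (funext fun m => hA.leibniz f s t m)

variable [T2Space M] {G : Set A.sections}

theorem anchor_bracket (hG : FillsFibers G)
    (anchor_G : ∀ s ∈ G, ∀ t ∈ G,
      hA.anchorVF (A.bracket s t) = (hA.anchorVF s).bracket (hA.anchorVF t))
    (s t : A.sections) : hA.anchorVF (A.bracket s t) = (hA.anchorVF s).bracket (hA.anchorVF t) := by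
  refine Sec.ext' fun m => ?_
  let bracketVF (X : VF E M) : VF E M →ₗ[ℝ] VF E M :=
    ⟨⟨X.bracket, VF.bracket_add_right X⟩, fun c => VF.bracket_smul_right c X⟩
  let β (s : A.sections) : A.sections →ₗ[ℝ] TangentSpace 𝓘(ℝ, E) m :=
    Sec.eval E E (TangentSpace 𝓘(ℝ, E) : M → Type _) m ∘ₗ
      (hA.anchorVF ∘ₗ hA.ad s - bracketVF (hA.anchorVF s) ∘ₗ hA.anchorVF)
  have β_apply (s t) : β s t = (hA.anchorVF (hA.ad s t) -
    (hA.anchorVF s).bracket (hA.anchorVF t) : VF E M) m := rfl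
  refine sub_eq_zero.1 (hA.eq_zero_of_skew_of_fillsFibers hG (m := m) β ?_ ?_ ?_ s t)
  · intro f s t
    rw [β_apply, β_apply, hA.isDerivation_ad s f, map_add, anchorVF_fsmul, anchorVF_fsmul,
      anchorVF_fsmul, VF.bracket_fsmul_right, add_sub_add_right_eq_sub]
    exact (smul_sub (f m) _ _).symm
  · intro s t
    have ad_swap : hA.ad s t = -hA.ad t s := hA.bracket_skew s t
    rw [β_apply, β_apply, ad_swap, VF.bracket_swap, map_neg, ← neg_add', ← sub_eq_add_neg]
    rfl
  · intro s hs t ht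
    exact sub_eq_zero.2 (congrArg (fun X : VF E M => X m) (anchor_G s hs t ht))

theorem jacobi (hG : FillsFibers G)
    (anchor_bracket : ∀ s t, hA.anchorVF (A.bracket s t) = (hA.anchorVF s).bracket (hA.anchorVF t))
    (jacobi_G : ∀ r ∈ G, ∀ s ∈ G, ∀ t ∈ G, A.bracket r (A.bracket s t) +
      A.bracket s (A.bracket t r) + A.bracket t (A.bracket r s) = 0) (r s t : A.sections) :
    A.bracket r (A.bracket s t) + A.bracket s (A.bracket t r) +
      A.bracket t (A.bracket r s) = 0 := by
  let J (r s t : A.sections) : A.sections :=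
    A.bracket r (A.bracket s t) + A.bracket s (A.bracket t r) + A.bracket t (A.bracket r s)
  have J_rotate (r s t) : J r s t = J s t r := by
    simp only [J]
    abel
  -- `J r s` is a difference of derivations with the same symbol, hence linear over functions.
  have J_eq (r s t) : J r s t = (⁅hA.ad r, hA.ad s⁆ - hA.ad (A.bracket r s)) t := by
    have bracket_swap : A.bracket s (A.bracket t r) = -A.bracket s (A.bracket r t) := by
      rw [hA.bracket_skew t r]
      exact (hA.ad s).map_neg _
    simp only [J]
    rw [bracket_swap, hA.bracket_skew t, ← sub_eq_add_neg, ← sub_eq_add_neg]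
    rfl
  have J_fsmul (r s f t) : J r s (hA.fsmul f t) = hA.fsmul f (J r s t) := by
    have symbol := hA.isDerivation_ad (A.bracket r s)
    rw [anchor_bracket] at symbol
    rw [J_eq, J_eq]
    exact ((hA.isDerivation_ad r).lie (hA.isDerivation_ad s)).sub_fsmul symbol f t
  have J_eq_zero (r s) (h : ∀ t ∈ G, J r s t = 0) (t) : J r s t = 0 := by
    refine Subtype.ext (funext fun m => ?_)
    have := hA.map_eq_zero_of_fillsFibers hG (m := m) ((LinearMap.proj m ∘ₗ A.sections.subtype) ∘ₗ
      (⁅hA.ad r, hA.ad s⁆ - hA.ad (A.bracket r s)))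
    simp only [LinearMap.comp_apply, ← J_eq] at this
    exact this (fun f t => congrArg (fun u : A.sections => u.1 m) (J_fsmul r s f t))
      (fun t ht => congrArg (fun u : A.sections => u.1 m) (h t ht)) t
  refine J_eq_zero r s (fun t ht => ?_) t
  rw [J_rotate, J_rotate]
  refine J_eq_zero t r (fun s hs => ?_) s
  rw [J_rotate, J_rotate]
  refine J_eq_zero s t (fun r hr => ?_) r
  rw [J_rotate, J_rotate]
  exact jacobi_G r hr s hs t ht

theorem isLieAlgebroid (hG : FillsFibers G)
    (anchor_G : ∀ s ∈ G, ∀ t ∈ G,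
      hA.anchorVF (A.bracket s t) = (hA.anchorVF s).bracket (hA.anchorVF t))
    (jacobi_G : ∀ r ∈ G, ∀ s ∈ G, ∀ t ∈ G, A.bracket r (A.bracket s t) +
      A.bracket s (A.bracket t r) + A.bracket t (A.bracket r s) = 0) : A.IsLieAlgebroid where
  fsmul_mem := hA.fsmul_mem
  mem_of_local := hA.mem_of_local
  exists_frame := hA.hasLocalFrame
  anchor_smooth := hA.anchor_smooth
  bracket_add := hA.bracket_add
  bracket_smul := hA.bracket_smul
  bracket_skew := hA.bracket_skew
  jacobi := hA.jacobi hG (hA.anchor_bracket hG anchor_G) jacobi_G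
  leibniz f s t t' ht m := by
    obtain rfl : t' = hA.fsmul f t := Subtype.ext (funext ht)
    exact hA.leibniz f s t m
  anchor_bracket s t m :=
    congrArg (fun X : VF E M => X m) (hA.anchor_bracket hG anchor_G s t)

include hA hB

theorem isMorphism (hG : FillsFibers G) (φ : ∀ m, A.Fiber m →ₗ[ℝ] B.Fiber m)
    (map_mem : ∀ s ∈ A.sections, (fun m => φ m (s m)) ∈ B.sections)
    (map_anchor : ∀ (m : M) (v : A.Fiber m), B.anchor m (φ m v) = A.anchor m v)
    (bracket_G : ∀ s ∈ G, ∀ t ∈ G, ∀ m, φ m ((A.bracket s t).1 m) =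
      (B.bracket ⟨_, map_mem s.1 s.2⟩ ⟨_, map_mem t.1 t.2⟩).1 m) : A.IsMorphism B φ where
  map_mem := map_mem
  map_anchor := map_anchor
  map_bracket s t m := by
    let Φ : A.sections →ₗ[ℝ] B.sections :=
      { toFun := fun s => ⟨_, map_mem s.1 s.2⟩
        map_add' := fun s t => Subtype.ext (funext fun m => (φ m).map_add (s.1 m) (t.1 m))
        map_smul' := fun c s => Subtype.ext (funext fun m => (φ m).map_smul c (s.1 m)) }
    have Φ_fsmul (f s) : Φ (hA.fsmul f s) = hB.fsmul f (Φ s) :=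
      Subtype.ext (funext fun m => (φ m).map_smul (f m) (s.1 m))
    have anchorVF_Φ (s) : hB.anchorVF (Φ s) = hA.anchorVF s :=
      Sec.ext' fun m => map_anchor m (s.1 m)
    let β (s : A.sections) : A.sections →ₗ[ℝ] B.Fiber m :=
      (LinearMap.proj m ∘ₗ B.sections.subtype) ∘ₗ (Φ ∘ₗ hA.ad s - hB.ad (Φ s) ∘ₗ Φ)
    have β_apply (s t) : β s t = (Φ (hA.ad s t) - hB.ad (Φ s) (Φ t)).1 m := rfl
    refine sub_eq_zero.1 (hA.eq_zero_of_skew_of_fillsFibers hG (m := m) β ?_ ?_ ?_ s t)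
    · intro f s t
      rw [β_apply, β_apply, hA.isDerivation_ad s f, map_add, Φ_fsmul, Φ_fsmul, Φ_fsmul,
        hB.isDerivation_ad (Φ s) f, anchorVF_Φ, add_sub_add_right_eq_sub]
      exact (smul_sub (f m) _ _).symm
    · intro s t
      have ad_swap : hA.ad s t = -hA.ad t s := hA.bracket_skew s t
      have ad_Φ_swap : hB.ad (Φ s) (Φ t) = -hB.ad (Φ t) (Φ s) := hB.bracket_skew _ _
      rw [β_apply, β_apply, ad_swap, ad_Φ_swap, map_neg, ← neg_sub']
      rfl
    · exact fun s hs t ht => sub_eq_zero.2 (bracket_G s hs t ht m)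

theorem isIsomorphism {φ : ∀ m, A.Fiber m →ₗ[ℝ] B.Fiber m} (hφ : A.IsMorphism B φ)
    (bijective : ∀ m, Function.Bijective (φ m)) : A.IsIsomorphism B φ := by
  let e (m : M) : A.Fiber m ≃ₗ[ℝ] B.Fiber m := LinearEquiv.ofBijective (φ m) (bijective m)
  have symm_mem (t) (ht : t ∈ B.sections) : (fun m => (e m).symm (t m)) ∈ A.sections :=
    hA.symm_mem hB.toIsSectionSpace e hφ.map_mem ht
  have apply_symm (m) (v : B.Fiber m) : φ m ((e m).symm v) = v := (e m).apply_symm_apply v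
  refine ⟨hφ, fun m => (e m).symm.toLinearMap, ⟨symm_mem, fun m v => ?_, fun s t m => ?_⟩, fun m =>
    ⟨LinearMap.ext (e m).symm_apply_apply, LinearMap.ext (e m).apply_symm_apply⟩⟩
  · rw [← hφ.map_anchor]
    exact congrArg _ (apply_symm m v)
  · apply (bijective m).1
    rw [hφ.map_bracket]
    have map_symm (r : B.sections) :
        (⟨fun p => φ p ((e p).symm (r.1 p)), hφ.map_mem _ (symm_mem r.1 r.2)⟩ : B.sections) = r :=
      Subtype.ext (funext fun p => apply_symm p (r.1 p))
    refine (apply_symm m _).trans ?_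
    exact congrArg (fun u : B.sections => u.1 m)
      (congrArg₂ B.bracket (map_symm s) (map_symm t)).symm

end AlgebroidData.IsSkewAlgebroid

end Generators

section JetBundle

variable {E : Type*} [NormedAddCommGroup E] [NormedSpace ℝ E]
  {M : Type*} [TopologicalSpace M] [ChartedSpace E M]

theorem exists_clm_tangent_eq [FiniteDimensional ℝ E] {m : M} {W : Type*} [AddCommGroup W]
    [Module ℝ W] [TopologicalSpace W] [IsTopologicalAddGroup W] [ContinuousSMul ℝ W]
    (y : TangentSpace 𝓘(ℝ, E) m →ₗ[ℝ] W) :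
    ∃ A : TangentSpace 𝓘(ℝ, E) m →L[ℝ] W, A.toLinearMap = y :=
  have : FiniteDimensional ℝ (TangentSpace 𝓘(ℝ, E) m) := inferInstanceAs (FiniteDimensional ℝ E)
  have : T2Space (TangentSpace 𝓘(ℝ, E) m) := inferInstanceAs (T2Space E)
  ⟨LinearMap.toContinuousLinearMap y, rfl⟩

variable [IsManifold 𝓘(ℝ, E) ∞ M] {F : Type*} [NormedAddCommGroup F] [NormedSpace ℝ F]
  {V : M → Type*} [TopologicalSpace (TotalSpace F V)] [∀ m, AddCommGroup (V m)]
  [∀ m, Module ℝ (V m)] [∀ m, TopologicalSpace (V m)] [FiberBundle F V] [VectorBundle ℝ F V]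

theorem jetSec_mem_of_eq_near {s : ∀ m, Jet E F V m}
    (h : ∀ m₀, ∃ t ∈ JetSec E F V, ∀ᶠ m in 𝓝 m₀, s m = t m) : s ∈ JetSec E F V := by
  refine fun δ => contMDiff_of_eq_near fun m₀ => ?_
  obtain ⟨t, ht, hst⟩ := h m₀
  exact ⟨_, ht δ, hst.mono fun m hm => congrArg (fun ν : Jet E F V m => ν.1 (δ.1 m)) hm⟩

/-- Multiplication of a section of `𝔍V` by a smooth function. -/
def JetSec.fsmul (f : SmoothFun E M) (ν : JetSec E F V) : JetSec E F V :=
  ⟨fun m => f m • ν.1 m, fun δ => (Sec.fsmul f (JetSec.pair ν δ)).contMDiff⟩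

namespace JetSec

theorem pair_add_left (μ ν : JetSec E F V) (δ : GaugeSec E F V) :
    pair (μ + ν) δ = pair μ δ + pair ν δ := rfl

theorem pair_smul_left (c : ℝ) (ν : JetSec E F V) (δ : GaugeSec E F V) :
    pair (c • ν) δ = c • pair ν δ := rfl

theorem pair_fsmul_left (f : SmoothFun E M) (ν : JetSec E F V) (δ : GaugeSec E F V) :
    pair (fsmul f ν) δ = (pair ν δ).fsmul f := rfl

end JetSec

variable [FiniteDimensional ℝ E]

namespace JetSec

theorem pair_add_right (ν : JetSec E F V) (δ δ' : GaugeSec E F V) :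
    pair ν (δ + δ') = pair ν δ + pair ν δ' :=
  Sec.ext' fun m => (ν.1 m).1.map_add (δ.1 m) (δ'.1 m)

theorem pair_sub_right (ν : JetSec E F V) (δ δ' : GaugeSec E F V) :
    pair ν (δ - δ') = pair ν δ - pair ν δ' :=
  Sec.ext' fun m => (ν.1 m).1.map_sub (δ.1 m) (δ'.1 m)

theorem pair_smul_right (c : ℝ) (ν : JetSec E F V) (δ : GaugeSec E F V) :
    pair ν (c • δ) = c • pair ν δ :=
  Sec.ext' fun m => (ν.1 m).1.map_smul c (δ.1 m)

theorem pair_fsmul_right (f : SmoothFun E M) (ν : JetSec E F V) (δ : GaugeSec E F V) :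
    pair ν (GaugeSec.fsmul f δ) = (pair ν δ).fsmul f :=
  Sec.ext' fun m => (ν.1 m).1.map_smul (f m) (δ.1 m)

theorem pair_jet (u : Sec E F V) (δ : GaugeSec E F V) : pair (jet u) δ = GaugeSec.op δ u := rfl

end JetSec

namespace GaugeSec

theorem op_add_apply (δ δ' : GaugeSec E F V) (u : Sec E F V) :
    op (δ + δ') u = op δ u + op δ' u := rfl

theorem op_smul_apply (c : ℝ) (δ : GaugeSec E F V) (u : Sec E F V) :
    op (c • δ) u = c • op δ u := rfl

theorem op_fsmul_apply (f : SmoothFun E M) (δ : GaugeSec E F V) (u : Sec E F V) :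
    op (fsmul f δ) u = (op δ u).fsmul f := rfl

end GaugeSec

variable [T2Space M]

theorem exists_fun_mvfderiv_eq (m : M) (y : TangentSpace 𝓘(ℝ, E) m →L[ℝ] ℝ) :
    ∃ f : SmoothFun E M, f m = 0 ∧ mvfderiv 𝓘(ℝ, E) f m = y := by
  have : IsManifold 𝓘(ℝ, E) 1 M := IsManifold.of_le (n := ∞) (by simp)
  let φ := extChartAt 𝓘(ℝ, E) m
  obtain ⟨e, he⟩ := isInvertible_mfderiv_extChartAt (I := 𝓘(ℝ, E)) (mem_extChartAt_source m)
  let y' : E →L[ℝ] ℝ := y.comp e.symm.toContinuousLinearMap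
  let g : E → ℝ := fun v => y' (v - φ m)
  have smooth_g : ContMDiff 𝓘(ℝ, E) 𝓘(ℝ, ℝ) ∞ g :=
    (y'.contDiff.comp (contDiff_id.sub contDiff_const)).contMDiff
  obtain ⟨f, hf⟩ := exists_fun_eventuallyEq (chartAt E m).open_source (mem_chart_source E m)
    (g ∘ φ) (smooth_g.comp_contMDiffOn contMDiffOn_extChartAt)
  refine ⟨f, by rw [hf.self_of_nhds]; exact (congrArg y' (sub_self _)).trans (map_zero _), ?_⟩
  have mfderiv_g : mfderiv 𝓘(ℝ, E) 𝓘(ℝ, ℝ) g (φ m) = y' := by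
    rw [mfderiv_eq_fderiv]
    exact (y'.hasFDerivAt.comp (φ m) ((hasFDerivAt_id _).sub_const _)).fderiv
  have mfderiv_f : mfderiv 𝓘(ℝ, E) 𝓘(ℝ, ℝ) f m = y'.comp (mfderiv 𝓘(ℝ, E) 𝓘(ℝ, E) φ m) := by
    rw [Filter.EventuallyEq.mfderiv_eq hf, mfderiv_comp m (smooth_g.mdifferentiableAt (by simp))
      (mdifferentiableAt_extChartAt (mem_chart_source E m)), mfderiv_g]
    rfl
  ext v
  have mfderiv_chart : mfderiv 𝓘(ℝ, E) 𝓘(ℝ, E) φ m v = e v := (congrArg (fun L => L v) he).symm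
  refine (congrArg (fun L => L v) mfderiv_f).trans ((congrArg y' mfderiv_chart).trans ?_)
  exact congrArg y (e.symm_apply_apply v)

variable [ContMDiffVectorBundle ∞ F V 𝓘(ℝ, E)]

theorem Jet.incl_injective (m : M) :
    Function.Injective (Jet.incl : (TangentSpace 𝓘(ℝ, E) m →ₗ[ℝ] V m) → Jet E F V m) := by
  intro y z h
  refine LinearMap.ext fun v => ?_
  obtain ⟨d, rfl⟩ := Gauge.anchor_surjective (E := E) (F := F) (V := V) m v
  exact congrArg (fun ν : Jet E F V m => ν.1 d) h

theorem Jet.proj_surjective (m : M) :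
    Function.Surjective (Jet.proj : Jet E F V m →ₗ[ℝ] V m) := by
  intro v
  obtain ⟨u, rfl⟩ := exists_sec_apply_eq (E := E) (F := F) m v
  exact ⟨(JetSec.jet u).1 m, rfl⟩

theorem Jet.exists_jet_eq_incl {m : M} (y : TangentSpace 𝓘(ℝ, E) m →ₗ[ℝ] V m) :
    ∃ u : Sec E F V, (JetSec.jet u).1 m = Jet.incl y := by
  let b : Module.Basis _ ℝ (TangentSpace 𝓘(ℝ, E) m) := Module.finBasis ℝ E
  choose a ha using fun i => exists_clm_tangent_eq (b.coord i)
  choose f hf hdf using fun i => exists_fun_mvfderiv_eq (E := E) m (a i)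
  choose s hs using fun i => exists_sec_apply_eq (E := E) (F := F) m (y (b i))
  refine ⟨∑ i, (s i).fsmul (f i), Subtype.ext (LinearMap.ext fun d => ?_)⟩
  have apply_fsmul (i) : d.1.1 ((s i).fsmul (f i)) = b.repr (Gauge.anchor d) i • y (b i) := by
    rw [d.2, hf, zero_smul, zero_add, hdf, hs]
    exact congrArg (fun L : TangentSpace 𝓘(ℝ, E) m →ₗ[ℝ] ℝ => L (Gauge.anchor d) • y (b i)) (ha i)
  calc d.1.1 (∑ i, (s i).fsmul (f i)) = ∑ i, b.repr (Gauge.anchor d) i • y (b i) := by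
        simp only [map_sum, apply_fsmul]
    _ = y (∑ i, b.repr (Gauge.anchor d) i • b i) := by simp only [map_sum, map_smul]
    _ = y (Gauge.anchor d) := by rw [b.sum_repr]

variable (E F V) in
/-- The 1-jet at `m` as a function of the section. -/
def Jet.jetAt (m : M) : Sec E F V →ₗ[ℝ] Jet E F V m where
  toFun u := (JetSec.jet u).1 m
  map_add' u v := Subtype.ext (LinearMap.ext fun d => d.1.1.map_add u v)
  map_smul' c u := Subtype.ext (LinearMap.ext fun d => d.1.1.map_smul c u)

section

variable [∀ m, IsTopologicalAddGroup (V m)] [∀ m, ContinuousSMul ℝ (V m)]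

theorem incl_mem_jetSec_iff {y : ∀ m : M, TangentSpace 𝓘(ℝ, E) m →L[ℝ] V m} :
    (fun m => Jet.incl (y m).toLinearMap) ∈ JetSec E F V ↔
      y ∈ secSubmodule E (E →L[ℝ] F) (fun m => TangentSpace 𝓘(ℝ, E) m →L[ℝ] V m) := by
  refine ⟨fun h => contMDiff_hom_of_apply y fun X => contMDiff_of_eq_near fun m₀ => ?_,
    fun h δ => ContMDiff.clm_bundle_apply h δ.2.2⟩
  obtain ⟨δ, hδ⟩ := exists_gaugeSec_anchor_eq_near (F := F) (V := V) X m₀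
  exact ⟨_, h δ, hδ.mono fun m hm => congrArg (y m) hm.symm⟩

end

variable [FiniteDimensional ℝ F]

theorem Jet.proj_eq_zero_iff {m : M} (ν : Jet E F V m) :
    Jet.proj ν = 0 ↔ ∃ y, Jet.incl y = ν := by
  refine ⟨fun h => ?_, by rintro ⟨y, rfl⟩; exact map_zero y⟩
  obtain ⟨g, hg⟩ := LinearMap.exists_rightInverse_of_surjective
    (Gauge.anchor : Gauge E F V m →ₗ[ℝ] TangentSpace 𝓘(ℝ, E) m)
    (LinearMap.range_eq_top.2 (Gauge.anchor_surjective m))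
  have anchor_g (v) : Gauge.anchor (g v) = v := congrArg (fun L => L v) hg
  refine ⟨ν.1 ∘ₗ g, Subtype.ext (LinearMap.ext fun d => ?_)⟩
  obtain ⟨Φ, hΦ⟩ := (Gauge.exact_ofEnd_anchor m (d - g (Gauge.anchor d))).1 (by
    rw [map_sub, anchor_g, sub_self])
  have apply_sub_eq_zero : ν.1 (d - g (Gauge.anchor d)) = 0 := by
    rw [← hΦ, ν.2]
    exact (congrArg Φ h).trans (map_zero Φ)
  rw [map_sub, sub_eq_zero] at apply_sub_eq_zero
  exact apply_sub_eq_zero.symm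

theorem Jet.jetAt_surjective (m : M) : Function.Surjective (Jet.jetAt E F V m) := by
  intro ν
  obtain ⟨u, hu⟩ := exists_sec_apply_eq (E := E) (F := F) m (Jet.proj ν)
  obtain ⟨y, hy⟩ := (Jet.proj_eq_zero_iff (ν - Jet.jetAt E F V m u)).1
    ((map_sub Jet.proj ν _).trans (sub_eq_zero.2 hu.symm))
  obtain ⟨v, hv⟩ := Jet.exists_jet_eq_incl (F := F) y
  exact ⟨u + v, by rw [map_add, ← eq_sub_iff_add_eq', ← hy, ← hv]; rfl⟩

theorem fillsFibers_range_jet :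
    FillsFibers (Set.range (JetSec.jet : Sec E F V → JetSec E F V)) := fun m ν =>
  let ⟨u, hu⟩ := Jet.jetAt_surjective m ν
  ⟨_, ⟨u, rfl⟩, hu⟩

/-- The linear map on `𝔍V_m` induced by a linear map on sections that depends on the 1-jet at `m`
only. -/
def Jet.lift {m : M} {W : Type*} [AddCommGroup W] [Module ℝ W] (T : Sec E F V →ₗ[ℝ] W)
    (hT : LinearMap.ker (Jet.jetAt E F V m) ≤ LinearMap.ker T) : Jet E F V m →ₗ[ℝ] W :=
  (LinearMap.ker _).liftQ T hT ∘ₗ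
    ((Jet.jetAt E F V m).quotKerEquivOfSurjective (Jet.jetAt_surjective m)).symm.toLinearMap

theorem Jet.lift_jet {m : M} {W : Type*} [AddCommGroup W] [Module ℝ W] (T : Sec E F V →ₗ[ℝ] W)
    (hT : LinearMap.ker (Jet.jetAt E F V m) ≤ LinearMap.ker T) (u : Sec E F V) :
    Jet.lift T hT ((JetSec.jet u).1 m) = T u :=
  congrArg ((LinearMap.ker _).liftQ T hT)
    ((LinearEquiv.symm_apply_eq ((Jet.jetAt E F V m).quotKerEquivOfSurjective
      (Jet.jetAt_surjective m)) (y := Submodule.Quotient.mk u)).2 rfl)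

variable [∀ m, IsTopologicalAddGroup (V m)] [∀ m, ContinuousSMul ℝ (V m)]

theorem JetSec.ext {ν ν' : JetSec E F V} (h : ∀ δ, pair ν δ = pair ν' δ) : ν = ν' := by
  refine Subtype.ext (funext fun m => Subtype.ext (LinearMap.ext fun d => ?_))
  obtain ⟨δ, rfl⟩ := exists_gaugeSec_apply_eq m d
  exact congrArg (fun u : Sec E F V => u m) (h δ)

theorem isSectionSpace_jetSec : IsSectionSpace E (JetSec E F V) := by
  refine IsSectionSpace.of_exact (K := fun m => TangentSpace 𝓘(ℝ, E) m →L[ℝ] V m) (Q := V)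
    (SK := secSubmodule E (E →L[ℝ] F) _) (SQ := secSubmodule E F V)
    (i := fun m => ⟨⟨fun y => Jet.incl y.toLinearMap, fun _ _ => rfl⟩, fun _ _ => rfl⟩)
    (p := fun m => Jet.proj) isSectionSpace_secSubmodule isSectionSpace_secSubmodule ?_ ?_
    (fun f ν hν => (JetSec.fsmul f ⟨ν, hν⟩).2) (fun _ => jetSec_mem_of_eq_near)
    (fun _ => incl_mem_jetSec_iff) (fun ν hν => (JetSec.proj ⟨ν, hν⟩).contMDiff)
    (fun u hu _ => ⟨_, (JetSec.jet ⟨u, hu⟩).2, Eventually.of_forall fun _ => rfl⟩)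
  · exact fun m => (Jet.incl_injective m).comp ContinuousLinearMap.coe_injective
  · intro m ν
    rw [Jet.proj_eq_zero_iff]
    constructor
    · rintro ⟨y, rfl⟩
      obtain ⟨A, rfl⟩ := exists_clm_tangent_eq y
      exact ⟨A, rfl⟩
    · rintro ⟨A, rfl⟩
      exact ⟨_, rfl⟩

end JetBundle

section JetAlgebroid

variable {E : Type*} [NormedAddCommGroup E] [NormedSpace ℝ E] [FiniteDimensional ℝ E]
  {M : Type*} [TopologicalSpace M] [ChartedSpace E M] [IsManifold 𝓘(ℝ, E) ∞ M]
  {F : Type*} [NormedAddCommGroup F] [NormedSpace ℝ F]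
  {V : M → Type*} [TopologicalSpace (TotalSpace F V)] [∀ m, AddCommGroup (V m)]
  [∀ m, Module ℝ (V m)] [∀ m, TopologicalSpace (V m)] [FiberBundle F V] [VectorBundle ℝ F V]
  [ContMDiffVectorBundle ∞ F V 𝓘(ℝ, E)]

namespace GaugeSec

theorem bracket_add_left (δ δ' ε : GaugeSec E F V) :
    bracket (δ + δ') ε = bracket δ ε + bracket δ' ε := by
  rw [bracket_swap, bracket_add_right, bracket_swap δ, bracket_swap δ']
  exact neg_add (bracket ε δ) (bracket ε δ')

theorem bracket_smul_left (c : ℝ) (δ ε : GaugeSec E F V) :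
    bracket (c • δ) ε = c • bracket δ ε := by
  rw [bracket_swap, bracket_smul_right, bracket_swap δ]
  exact (smul_neg c (bracket ε δ)).symm

theorem bracket_fsmul_left (f : SmoothFun E M) (δ ε : GaugeSec E F V) :
    bracket (fsmul f δ) ε = fsmul f (bracket δ ε) - fsmul ((anchor ε).deriv f) δ := by
  rw [bracket_swap, bracket_fsmul_right, bracket_swap δ]
  refine Subtype.ext (funext fun m => ?_)
  change -(f m • (bracket ε δ).1 m + (anchor ε).deriv f m • δ.1 m) =
    f m • -(bracket ε δ).1 m - (anchor ε).deriv f m • δ.1 m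
  rw [neg_add, smul_neg, sub_eq_add_neg]

end GaugeSec

namespace SkewAlgebroid

variable [T2Space M] [∀ m, IsTopologicalAddGroup (V m)] [∀ m, ContinuousSMul ℝ (V m)]
  (A : SkewAlgebroid E F V)

theorem sharpSec_add (μ ν : JetSec E F V) :
    A.sharpSec (μ + ν) = A.sharpSec μ + A.sharpSec ν :=
  Subtype.ext (funext fun m => A.sharp.map_add (μ.1 m) (ν.1 m))

theorem sharpSec_smul (c : ℝ) (ν : JetSec E F V) : A.sharpSec (c • ν) = c • A.sharpSec ν :=
  Subtype.ext (funext fun m => A.sharp.map_smul c (ν.1 m))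

theorem sharpSec_fsmul (f : SmoothFun E M) (ν : JetSec E F V) :
    A.sharpSec (JetSec.fsmul f ν) = GaugeSec.fsmul f (A.sharpSec ν) :=
  Subtype.ext (funext fun m => A.sharp.map_smul (f m) (ν.1 m))

variable [FiniteDimensional ℝ F]

theorem pair_sharpSec_swap (μ ν : JetSec E F V) :
    JetSec.pair μ (A.sharpSec ν) = - JetSec.pair ν (A.sharpSec μ) := by
  refine Sec.ext' fun m => ?_
  obtain ⟨u, hu⟩ := Jet.jetAt_surjective m (μ.1 m)
  change (JetSec.jet u).1 m = μ.1 m at hu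
  have sharp_eq : A.sharp (μ.1 m) = (A.ad u).1 m := by
    rw [← hu]
    exact congrArg (fun δ : GaugeSec E F V => δ.1 m) (A.sharpSec_jet u)
  change (μ.1 m).1 (A.sharp (ν.1 m)) = -((ν.1 m).1 (A.sharp (μ.1 m)))
  rw [sharp_eq, ← hu]
  rfl

theorem pair_jetBracket (μ ν : JetSec E F V) (δ : GaugeSec E F V) :
    JetSec.pair (A.jetBracket μ ν) δ =
      (GaugeSec.op (A.sharpSec μ) (JetSec.pair ν δ) -
        JetSec.pair ν (GaugeSec.bracket (A.sharpSec μ) δ)) -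
      (GaugeSec.op (A.sharpSec ν) (JetSec.pair μ δ) -
        JetSec.pair μ (GaugeSec.bracket (A.sharpSec ν) δ)) -
      GaugeSec.op δ (JetSec.pair ν (A.sharpSec μ)) := by
  rw [← JetSec.pair_lieDeriv, ← JetSec.pair_lieDeriv]
  rfl

theorem jetBracket_jet (u v : Sec E F V) :
    A.jetBracket (JetSec.jet u) (JetSec.jet v) = JetSec.jet (A.bracket u v) := by
  refine JetSec.ext fun δ => ?_
  have op_ad (u v : Sec E F V) : GaugeSec.op (A.ad u) v = A.bracket u v := rfl
  rw [pair_jetBracket]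
  simp only [JetSec.pair_jet, sharpSec_jet, GaugeSec.op_bracket, op_ad]
  rw [A.skew v u, map_neg]
  abel

theorem jetBracket_swap (μ ν : JetSec E F V) : A.jetBracket μ ν = - A.jetBracket ν μ := by
  refine JetSec.ext fun δ => ?_
  have pair_neg : JetSec.pair (-A.jetBracket ν μ) δ = - JetSec.pair (A.jetBracket ν μ) δ := rfl
  rw [pair_neg, pair_jetBracket, pair_jetBracket, A.pair_sharpSec_swap ν μ, map_neg]
  abel

theorem jetBracket_add (μ ν ν' : JetSec E F V) :
    A.jetBracket μ (ν + ν') = A.jetBracket μ ν + A.jetBracket μ ν' := by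
  refine JetSec.ext fun δ => ?_
  simp only [JetSec.pair_add_left, JetSec.pair_add_right, pair_jetBracket, sharpSec_add,
    GaugeSec.op_add_apply, GaugeSec.bracket_add_left, map_add]
  abel

theorem jetBracket_smul (c : ℝ) (μ ν : JetSec E F V) :
    A.jetBracket μ (c • ν) = c • A.jetBracket μ ν := by
  refine JetSec.ext fun δ => ?_
  simp only [JetSec.pair_smul_left, JetSec.pair_smul_right, pair_jetBracket, sharpSec_smul,
    GaugeSec.op_smul_apply, GaugeSec.bracket_smul_left, map_smul, smul_sub]

theorem jetBracket_fsmul (f : SmoothFun E M) (μ ν : JetSec E F V) :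
    A.jetBracket μ (JetSec.fsmul f ν) = JetSec.fsmul f (A.jetBracket μ ν) +
      JetSec.fsmul ((GaugeSec.anchor (A.sharpSec μ)).deriv f) ν := by
  refine JetSec.ext fun δ => ?_
  simp only [JetSec.pair_add_left, JetSec.pair_fsmul_left, pair_jetBracket, sharpSec_fsmul,
    GaugeSec.op_fsmul, GaugeSec.bracket_fsmul_left, JetSec.pair_sub_right,
    JetSec.pair_fsmul_right, GaugeSec.op_fsmul_apply]
  -- The terms with `δ(f)` come from `[πν, δ]` and from `𝕕⟨ν, πμ⟩`; they cancel by skew-symmetry.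
  rw [A.pair_sharpSec_swap μ ν]
  refine Sec.ext' fun m => ?_
  set νδ := JetSec.pair ν δ
  set νμ := JetSec.pair ν (A.sharpSec μ)
  set a := GaugeSec.op (A.sharpSec μ) νδ m
  set b := JetSec.pair ν (GaugeSec.bracket (A.sharpSec μ) δ) m
  set c := GaugeSec.op (A.sharpSec ν) (JetSec.pair μ δ) m
  set d := JetSec.pair μ (GaugeSec.bracket (A.sharpSec ν) δ) m
  set e := GaugeSec.op δ νμ m
  set x := (GaugeSec.anchor (A.sharpSec μ)).deriv f m
  set y := (GaugeSec.anchor δ).deriv f m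
  change (f m • a + x • νδ m - f m • b) - (f m • c - (f m • d - y • (-(νμ m)))) -
    (f m • e + y • νμ m) = f m • ((a - b) - (c - d) - e) + x • νδ m
  module

theorem jetAlgebroid_isSkewAlgebroid : (jetAlgebroid A).IsSkewAlgebroid where
  toIsSectionSpace := isSectionSpace_jetSec
  anchor_smooth s hs := (A.sharpSec ⟨s, hs⟩).2.2
  bracket_add := A.jetBracket_add
  bracket_smul := A.jetBracket_smul
  bracket_skew := A.jetBracket_swap
  leibniz f s t m := congrArg (fun ν : JetSec E F V => ν.1 m) (A.jetBracket_fsmul f s t)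

theorem jetAlgebroid_isLieAlgebroid
    (anchor_bracket : ∀ u v, A.anchor.app (A.bracket u v) =
      VF.bracket (A.anchor.app u) (A.anchor.app v))
    (jacobi : ∀ u v w, A.bracket u (A.bracket v w) + A.bracket v (A.bracket w u) +
      A.bracket w (A.bracket u v) = 0) : (jetAlgebroid A).IsLieAlgebroid := by
  refine A.jetAlgebroid_isSkewAlgebroid.isLieAlgebroid fillsFibers_range_jet ?_ ?_
  · rintro _ ⟨u, rfl⟩ _ ⟨v, rfl⟩
    change A.jetAlgebroid_isSkewAlgebroid.anchorVF
      (A.jetBracket (JetSec.jet u) (JetSec.jet v)) = _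
    rw [jetBracket_jet]
    exact anchor_bracket u v
  · rintro _ ⟨u, rfl⟩ _ ⟨v, rfl⟩ _ ⟨w, rfl⟩
    change A.jetBracket (JetSec.jet u) (A.jetBracket (JetSec.jet v) (JetSec.jet w)) +
      A.jetBracket (JetSec.jet v) (A.jetBracket (JetSec.jet w) (JetSec.jet u)) +
      A.jetBracket (JetSec.jet w) (A.jetBracket (JetSec.jet u) (JetSec.jet v)) = 0
    simp only [jetBracket_jet]
    refine JetSec.ext fun δ => ?_
    simp only [JetSec.pair_add_left, JetSec.pair_jet, ← map_add, jacobi]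
    exact map_zero _

/-- The algebroid data consisting of `V`, its smooth sections, and the anchor and bracket of `A`. -/
def toAlgebroidData : AlgebroidData E M where
  Fiber := V
  sections := secSubmodule E F V
  anchor m := (A.anchor m).toLinearMap
  bracket s t := ⟨A.bracket ⟨s.1, s.2⟩ ⟨t.1, t.2⟩, (A.bracket ⟨s.1, s.2⟩ ⟨t.1, t.2⟩).contMDiff⟩

theorem toAlgebroidData_isSkewAlgebroid : A.toAlgebroidData.IsSkewAlgebroid where
  toIsSectionSpace := isSectionSpace_secSubmodule (F := F) (V := V)
  anchor_smooth s hs := (A.anchor.app ⟨s, hs⟩).contMDiff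
  bracket_add r s t := Subtype.ext (congrArg (fun u : Sec E F V => (u : ∀ m, V m))
    (A.add_right ⟨r.1, r.2⟩ ⟨s.1, s.2⟩ ⟨t.1, t.2⟩))
  bracket_smul c s t := Subtype.ext (congrArg (fun u : Sec E F V => (u : ∀ m, V m))
    (A.smul_right c ⟨s.1, s.2⟩ ⟨t.1, t.2⟩))
  bracket_skew s t := Subtype.ext (congrArg (fun u : Sec E F V => (u : ∀ m, V m))
    (A.skew ⟨s.1, s.2⟩ ⟨t.1, t.2⟩))
  leibniz f s t m := congrArg (fun u : Sec E F V => u m)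
    (A.leibniz f ⟨s.1, s.2⟩ ⟨t.1, t.2⟩)

variable {G : Set (Sec E F V)}

theorem anchor_bracket (hG : ∀ (m : M) (v : V m), ∃ g ∈ G, g m = v)
    (anchor_G : ∀ u ∈ G, ∀ v ∈ G, A.anchor.app (A.bracket u v) =
      VF.bracket (A.anchor.app u) (A.anchor.app v)) (u v : Sec E F V) :
    A.anchor.app (A.bracket u v) = VF.bracket (A.anchor.app u) (A.anchor.app v) :=
  A.toAlgebroidData_isSkewAlgebroid.anchor_bracket (G := {s | (⟨s.1, s.2⟩ : Sec E F V) ∈ G})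
    (fun m v => let ⟨g, hg, hgm⟩ := hG m v; ⟨⟨g, g.contMDiff⟩, hg, hgm⟩)
    (fun _ hs _ ht => anchor_G _ hs _ ht) ⟨u, u.contMDiff⟩ ⟨v, v.contMDiff⟩

theorem jacobi (hG : ∀ (m : M) (v : V m), ∃ g ∈ G, g m = v)
    (anchor_bracket : ∀ u v, A.anchor.app (A.bracket u v) =
      VF.bracket (A.anchor.app u) (A.anchor.app v))
    (jacobi_G : ∀ u ∈ G, ∀ v ∈ G, ∀ w ∈ G, A.bracket u (A.bracket v w) +
      A.bracket v (A.bracket w u) + A.bracket w (A.bracket u v) = 0) (u v w : Sec E F V) :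
    A.bracket u (A.bracket v w) + A.bracket v (A.bracket w u) +
      A.bracket w (A.bracket u v) = 0 := by
  have jacobi_sections := A.toAlgebroidData_isSkewAlgebroid.jacobi
    (G := {s | (⟨s.1, s.2⟩ : Sec E F V) ∈ G})
    (fun m v => let ⟨g, hg, hgm⟩ := hG m v; ⟨⟨g, g.contMDiff⟩, hg, hgm⟩)
    (fun s t => anchor_bracket ⟨s.1, s.2⟩ ⟨t.1, t.2⟩)
    (fun r hr s hs t ht => Subtype.ext
      (congrArg (fun u : Sec E F V => (u : ∀ m, V m)) (jacobi_G _ hr _ hs _ ht)))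
    ⟨u, u.contMDiff⟩ ⟨v, v.contMDiff⟩ ⟨w, w.contMDiff⟩
  exact Sec.ext' fun m => congrArg (fun s : A.toAlgebroidData.sections => s.1 m) jacobi_sections

end SkewAlgebroid

end JetAlgebroid

section CotangentAlgebroid

variable {E : Type*} [NormedAddCommGroup E] [NormedSpace ℝ E] [FiniteDimensional ℝ E]
  {M : Type*} [TopologicalSpace M] [ChartedSpace E M] [IsManifold 𝓘(ℝ, E) ∞ M] [T2Space M]

namespace VF

theorem deriv_neg (X : VF E M) (f : SmoothFun E M) (m : M) : X.deriv (-f) m = -X.deriv f m := by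
  have neg_eq_smul : -f = (-1 : ℝ) • f := ContMDiffMap.ext fun p => (neg_one_mul (f p)).symm
  rw [neg_eq_smul, deriv_smul, neg_one_mul]

theorem deriv_zero (X : VF E M) (m : M) : X.deriv 0 m = 0 := by
  rw [← zero_smul ℝ (0 : SmoothFun E M), deriv_smul, zero_mul]

end VF

theorem tangent_eq_of_mvfderiv {m : M} {v w : TangentSpace 𝓘(ℝ, E) m}
    (h : ∀ f : SmoothFun E M, mvfderiv 𝓘(ℝ, E) f m v = mvfderiv 𝓘(ℝ, E) f m w) : v = w := by
  rw [← sub_eq_zero, ← Module.forall_dual_apply_eq_zero_iff ℝ]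
  intro y
  obtain ⟨A, rfl⟩ := exists_clm_tangent_eq y
  obtain ⟨f, -, hf⟩ := exists_fun_mvfderiv_eq m A
  change A (v - w) = 0
  rw [map_sub, ← hf, h, sub_self]

theorem VF.ext_deriv {X Y : VF E M} (h : ∀ f m, X.deriv f m = Y.deriv f m) : X = Y :=
  Sec.ext' fun m => tangent_eq_of_mvfderiv fun f => h f m

theorem OneForm.exists_d_eq (m : M) (α : Cotangent E M m) :
    ∃ f : SmoothFun E M, OneForm.d f m = α :=
  (exists_fun_mvfderiv_eq m α).imp fun _ h => h.2

namespace Bivector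

variable (P : Bivector E M)

/-- The bracket `{f, g} = dg(Π df)` of functions. -/
def poisson (f g : SmoothFun E M) : SmoothFun E M := (P.vf (OneForm.d f)).deriv g

theorem poisson_swap (f g : SmoothFun E M) : P.poisson f g = -P.poisson g f :=
  ContMDiffMap.ext fun m => P.skew_apply (OneForm.d g) (OneForm.d f) m

theorem poisson_swap_right (f g h : SmoothFun E M) (m : M) :
    P.poisson f (P.poisson g h) m = -P.poisson f (P.poisson h g) m := by
  rw [P.poisson_swap g h]
  exact VF.deriv_neg _ _ m

theorem bracket_d_d (f g : SmoothFun E M) :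
    P.bracket (OneForm.d f) (OneForm.d g) = OneForm.d (P.poisson f g) := by
  refine OneForm.ext fun X m => ?_
  have apply_d (h : SmoothFun E M) (Y : VF E M) : (OneForm.d h).apply Y = Y.deriv h := rfl
  have deriv_vf_d (a b : SmoothFun E M) : (P.vf (OneForm.d a)).deriv b = P.poisson a b := rfl
  have deriv_bracket (Y : VF E M) (h : SmoothFun E M) : (Y.bracket X).deriv h m =
      Y.deriv (X.deriv h) m - X.deriv (Y.deriv h) m := VF.bracket_deriv Y X h m
  have deriv_poisson_swap : X.deriv (P.poisson g f) m = -X.deriv (P.poisson f g) m := by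
    rw [P.poisson_swap, VF.deriv_neg]
  rw [P.bracket_apply, P.bracketFun_apply]
  simp only [apply_d, deriv_bracket, deriv_vf_d]
  rw [deriv_poisson_swap]
  change _ = X.deriv (P.poisson f g) m
  ring

end Bivector

namespace PoissonStructure

variable (P : PoissonStructure E M)

theorem poisson_jacobi (f g h : SmoothFun E M) :
    P.poisson f (P.poisson g h) + P.poisson g (P.poisson h f) + P.poisson h (P.poisson f g) = 0 :=
  P.jacobi f g h

theorem vf_d_poisson (f g : SmoothFun E M) :
    P.vf (OneForm.d (P.poisson f g)) =
      (P.vf (OneForm.d f)).bracket (P.vf (OneForm.d g)) := by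
  refine VF.ext_deriv fun h m => ?_
  have deriv_bracket : ((P.vf (OneForm.d f)).bracket (P.vf (OneForm.d g))).deriv h m =
      P.poisson f (P.poisson g h) m - P.poisson g (P.poisson f h) m :=
    VF.bracket_deriv _ _ h m
  have poisson_swap_left : P.poisson (P.poisson f g) h m = -P.poisson h (P.poisson f g) m :=
    congrArg (fun k : SmoothFun E M => k m) (P.poisson_swap (P.poisson f g) h)
  have jacobi_at : P.poisson f (P.poisson g h) m + P.poisson g (P.poisson h f) m +
      P.poisson h (P.poisson f g) m = 0 :=
    congrArg (fun k : SmoothFun E M => k m) (P.poisson_jacobi f g h)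
  change P.poisson (P.poisson f g) h m = _
  linarith [P.poisson_swap_right g f h m]

theorem vf_bracket (α β : OneForm E M) : P.vf (P.bracket α β) = (P.vf α).bracket (P.vf β) := by
  refine P.algebroid.anchor_bracket (G := Set.range OneForm.d) (fun m v => ?_) ?_ α β
  · obtain ⟨f, hf⟩ := OneForm.exists_d_eq m v
    exact ⟨_, ⟨f, rfl⟩, hf⟩
  · rintro _ ⟨f, rfl⟩ _ ⟨g, rfl⟩
    change P.vf (P.bracket (OneForm.d f) (OneForm.d g)) = _
    rw [P.bracket_d_d]
    exact P.vf_d_poisson f g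

theorem bracket_jacobi (α β γ : OneForm E M) :
    P.bracket α (P.bracket β γ) + P.bracket β (P.bracket γ α) +
      P.bracket γ (P.bracket α β) = 0 := by
  refine P.algebroid.jacobi (G := Set.range OneForm.d) (fun m v => ?_) P.vf_bracket ?_ α β γ
  · obtain ⟨f, hf⟩ := OneForm.exists_d_eq m v
    exact ⟨_, ⟨f, rfl⟩, hf⟩
  · rintro _ ⟨f, rfl⟩ _ ⟨g, rfl⟩ _ ⟨h, rfl⟩
    change P.bracket (OneForm.d f) (P.bracket (OneForm.d g) (OneForm.d h)) +
      P.bracket (OneForm.d g) (P.bracket (OneForm.d h) (OneForm.d f)) +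
      P.bracket (OneForm.d h) (P.bracket (OneForm.d f) (OneForm.d g)) = 0
    simp only [P.bracket_d_d]
    refine OneForm.ext fun X m => ?_
    change X.deriv _ m + X.deriv _ m + X.deriv _ m = 0
    rw [← VF.deriv_add, ← VF.deriv_add, P.poisson_jacobi, VF.deriv_zero]

theorem cotangentJet_isLieAlgebroid : P.cotangentJet.IsLieAlgebroid :=
  P.algebroid.jetAlgebroid_isLieAlgebroid P.vf_bracket P.bracket_jacobi

end PoissonStructure

end CotangentAlgebroid

section AdjointGauge

variable {E : Type*} [NormedAddCommGroup E] [NormedSpace ℝ E] [FiniteDimensional ℝ E]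
  {M : Type*} [TopologicalSpace M] [ChartedSpace E M] [IsManifold 𝓘(ℝ, E) ∞ M]

/-- The operator `[Y, ·]` on vector fields, as a section of `𝔇(TM)`. -/
def VF.adGauge : VF E M →ₗ[ℝ] GaugeSec E E (TangentSpace 𝓘(ℝ, E) : M → Type _) where
  toFun Y := GaugeSec.mk ⟨⟨Y.bracket, VF.bracket_add_right Y⟩, fun c => VF.bracket_smul_right c Y⟩ Y
    fun f X => VF.bracket_fsmul_right f Y X
  map_add' Y Z := GaugeSec.ext (fun X => VF.bracket_add_left Y Z X) rfl
  map_smul' c Y := GaugeSec.ext (fun X => VF.bracket_smul_left c Y X) rfl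

theorem VF.adGauge_bracket [T2Space M] (Y Z : VF E M) :
    VF.adGauge (Y.bracket Z) = GaugeSec.bracket (VF.adGauge Y) (VF.adGauge Z) := by
  refine GaugeSec.ext (fun (X : VF E M) => ?_) rfl
  change (Y.bracket Z).bracket X = Y.bracket (Z.bracket X) - Z.bracket (Y.bracket X)
  have bracket_bracket_swap : Z.bracket (X.bracket Y) = - Z.bracket (Y.bracket X) := by
    rw [VF.bracket_swap X Y, ← neg_one_smul ℝ, VF.bracket_smul_right, neg_one_smul]
  have jacobi := VF.bracket_jacobi Y Z X
  rw [bracket_bracket_swap, VF.bracket_swap X (Y.bracket Z)] at jacobi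
  rw [eq_comm, ← sub_eq_zero, ← jacobi]
  abel

end AdjointGauge

section TangentLift

variable {E : Type*} [NormedAddCommGroup E] [NormedSpace ℝ E] [FiniteDimensional ℝ E]
  {M : Type*} [TopologicalSpace M] [ChartedSpace E M] [IsManifold 𝓘(ℝ, E) ∞ M] [T2Space M]
  {F : Type*} [NormedAddCommGroup F] [NormedSpace ℝ F] [FiniteDimensional ℝ F]
  {V : M → Type*} [TopologicalSpace (TotalSpace F V)] [∀ m, AddCommGroup (V m)]
  [∀ m, Module ℝ (V m)] [∀ m, TopologicalSpace (V m)] [FiberBundle F V] [VectorBundle ℝ F V]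
  [ContMDiffVectorBundle ∞ F V 𝓘(ℝ, E)]
  [∀ m, IsTopologicalAddGroup (V m)] [∀ m, ContinuousSMul ℝ (V m)]

namespace Sec

variable (A : Sec E (F →L[ℝ] E) (fun m : M => V m →L[ℝ] TangentSpace 𝓘(ℝ, E) m))

/-- Application of the bundle map `A`, as a linear map on sections. -/
def appLinear : Sec E F V →ₗ[ℝ] VF E M where
  toFun := A.app
  map_add' u v := Sec.ext' fun m => (A m).map_add (u m) (v m)
  map_smul' c u := Sec.ext' fun m => (A m).map_smul c (u m)

theorem bracket_app_eq_app_op {m : M} {X : VF E M} {δ : GaugeSec E F V} {u : Sec E F V}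
    (hδ : Gauge.anchor (δ.1 m) = X m) (hu : u m = 0) :
    VF.bracket X (A.app u) m = A m (GaugeSec.op δ u m) := by
  let T : Sec E F V →ₗ[ℝ] TangentSpace 𝓘(ℝ, E) m :=
    Sec.eval E E (TangentSpace 𝓘(ℝ, E) : M → Type _) m ∘ₗ
      (GaugeSec.op (VF.adGauge X) ∘ₗ appLinear A - appLinear A ∘ₗ GaugeSec.op δ)
  refine sub_eq_zero.1 (tensorial_pointwise T (fun f u => ?_) hu)
  have app_fsmul : A.app (u.fsmul f) = (A.app u).fsmul f :=
    Sec.ext' fun p => (A p).map_smul (f p) (u p)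
  have deriv_anchor : VF.deriv (GaugeSec.anchor δ) f m = VF.deriv X f m :=
    congrArg (mvfderiv 𝓘(ℝ, E) f m) hδ
  change VF.bracket X (A.app (u.fsmul f)) m - A m (GaugeSec.op δ (u.fsmul f) m) =
    f m • (VF.bracket X (A.app u) m - A m (GaugeSec.op δ u m))
  rw [app_fsmul, VF.bracket_fsmul_right, GaugeSec.op_fsmul]
  change f m • VF.bracket X (A.app u) m + VF.deriv X f m • A m (u m) -
    A m (f m • GaugeSec.op δ u m + VF.deriv (GaugeSec.anchor δ) f m • u m) = _
  rw [deriv_anchor, map_add, map_smul, map_smul]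
  module

/-- The value at `m` of the operator `[A u, ·]`, as a function of the section `u`. -/
def adAt (m : M) : Sec E F V →ₗ[ℝ] TangentGauge E M m :=
  LinearMap.proj m ∘ₗ (GaugeSec E E (TangentSpace 𝓘(ℝ, E) : M → Type _)).subtype ∘ₗ
    VF.adGauge ∘ₗ appLinear A

theorem adAt_eq_ofEnd {m : M} {u : Sec E F V} {y : TangentSpace 𝓘(ℝ, E) m →ₗ[ℝ] V m}
    (h : Jet.jetAt E F V m u = Jet.incl y) :
    adAt A m u = Gauge.ofEnd (-((A m).toLinearMap ∘ₗ y)) := by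
  have hu : u m = 0 := (congrArg Jet.proj h).trans ((Jet.proj_eq_zero_iff _).2 ⟨y, rfl⟩)
  refine Subtype.ext (Prod.ext (LinearMap.ext fun (X : VF E M) => ?_)
    ((congrArg (A m) hu).trans (map_zero (A m))))
  obtain ⟨δ, hδ⟩ := exists_gaugeSec_anchor_eq_near (F := F) (V := V) X m
  have op_eq : GaugeSec.op δ u m = y (X m) :=
    (congrArg (fun ν : Jet E F V m => ν.1 (δ.1 m)) h).trans (congrArg y hδ.self_of_nhds)
  calc VF.bracket (A.app u) X m = -VF.bracket X (A.app u) m :=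
        congrArg (fun Y : VF E M => Y m) (VF.bracket_swap _ X)
    _ = -A m (GaugeSec.op δ u m) := congrArg Neg.neg (bracket_app_eq_app_op A hδ.self_of_nhds hu)
    _ = -A m (y (X m)) := by rw [op_eq]

theorem ker_jetAt_le_ker_adAt (m : M) :
    LinearMap.ker (Jet.jetAt E F V m) ≤ LinearMap.ker (adAt A m) := fun u hu => by
  refine (adAt_eq_ofEnd A (y := 0) (hu.trans rfl)).trans ?_
  rw [LinearMap.comp_zero, neg_zero, map_zero]

/-- The map `𝔍V → 𝔇(TM)` at `m` induced by a bundle map `A : V → TM`: it sends the 1-jet of `u` to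
`[A u, ·]`. -/
def jetLift (m : M) : Jet E F V m →ₗ[ℝ] TangentGauge E M m :=
  Jet.lift (adAt A m) (ker_jetAt_le_ker_adAt A m)

theorem jetLift_jet (u : Sec E F V) (m : M) :
    jetLift A m ((JetSec.jet u).1 m) = (VF.adGauge (A.app u)).1 m :=
  Jet.lift_jet (adAt A m) (ker_jetAt_le_ker_adAt A m) u

theorem anchor_jetLift {m : M} (ν : Jet E F V m) :
    Gauge.anchor (jetLift A m ν) = A m (Jet.proj ν) := by
  obtain ⟨u, rfl⟩ := Jet.jetAt_surjective m ν
  exact congrArg Gauge.anchor (jetLift_jet A u m)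

theorem jetLift_incl {m : M} (y : TangentSpace 𝓘(ℝ, E) m →ₗ[ℝ] V m) :
    jetLift A m (Jet.incl y) = Gauge.ofEnd (-((A m).toLinearMap ∘ₗ y)) := by
  obtain ⟨u, hu⟩ := Jet.exists_jet_eq_incl (F := F) y
  rw [← hu, jetLift_jet A]
  exact adAt_eq_ofEnd A hu

theorem jetLift_mem {ν : ∀ m, Jet E F V m} (hν : ν ∈ JetSec E F V) :
    (fun m => jetLift A m (ν m)) ∈ GaugeSec E E (TangentSpace 𝓘(ℝ, E) : M → Type _) := by
  refine isSectionSpace_jetSec.map_mem_of_fillsFibers isSectionSpace_gaugeSec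
    fillsFibers_range_jet (jetLift A) ?_ hν
  rintro _ ⟨u, rfl⟩
  exact (funext (jetLift_jet A u) : _ = (VF.adGauge (A.app u)).1) ▸ (VF.adGauge (A.app u)).2

theorem jetLift_bijective {m : M} (h : Function.Bijective (A m)) :
    Function.Bijective (jetLift A m) := by
  let e := LinearEquiv.ofBijective (A m).toLinearMap h
  let homMap : (TangentSpace 𝓘(ℝ, E) m →ₗ[ℝ] V m) ≃ₗ[ℝ] _ :=
    (LinearEquiv.congrRight e).trans (LinearEquiv.neg ℝ)
  let incl : (TangentSpace 𝓘(ℝ, E) m →ₗ[ℝ] V m) →ₗ[ℝ] Jet E F V m :=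
    ⟨⟨Jet.incl, fun _ _ => rfl⟩, fun _ _ => rfl⟩
  exact LinearMap.bijective_of_surjective_of_bijective_of_bijective_of_injective
    (0 : PUnit →ₗ[ℝ] _) incl Jet.proj (0 : _ →ₗ[ℝ] PUnit)
    (0 : PUnit →ₗ[ℝ] _) Gauge.ofEnd Gauge.anchor (0 : _ →ₗ[ℝ] PUnit)
    LinearMap.id homMap.toLinearMap (jetLift A m) e.toLinearMap LinearMap.id
    (LinearMap.comp_zero homMap.toLinearMap).symm
    (LinearMap.ext fun y => (jetLift_incl A y).symm) (LinearMap.ext (anchor_jetLift A)) rfl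
    ((LinearMap.exact_zero_iff_injective PUnit incl).2 (Jet.incl_injective m))
    Jet.proj_eq_zero_iff
    ((LinearMap.exact_zero_iff_surjective PUnit Jet.proj).2 (Jet.proj_surjective m))
    ((LinearMap.exact_zero_iff_injective PUnit Gauge.ofEnd).2 (Gauge.ofEnd_injective m))
    (Gauge.exact_ofEnd_anchor m)
    ((LinearMap.exact_zero_iff_surjective PUnit Gauge.anchor).2 (Gauge.anchor_surjective m))
    Function.surjective_id homMap.bijective e.bijective Function.injective_id

end Sec

end TangentLift

section PoissonLift

variable {E : Type*} [NormedAddCommGroup E] [NormedSpace ℝ E] [FiniteDimensional ℝ E]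
  {M : Type*} [TopologicalSpace M] [ChartedSpace E M] [IsManifold 𝓘(ℝ, E) ∞ M] [T2Space M]

namespace PoissonStructure

variable (P : PoissonStructure E M)

theorem jetLift_isMorphism :
    P.cotangentJet.IsMorphism (tangentGauge E M) (Sec.jetLift P.sharp) := by
  refine P.cotangentJet_isLieAlgebroid.isSkewAlgebroid.isMorphism
    gaugeAlgebroid_isLieAlgebroid.isSkewAlgebroid (G := Set.range JetSec.jet)
    fillsFibers_range_jet _ (fun _ => Sec.jetLift_mem P.sharp)
    (fun _ => Sec.anchor_jetLift P.sharp) ?_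
  rintro _ ⟨α, rfl⟩ _ ⟨β, rfl⟩ m
  let lift (ν : JetSec E (E →L[ℝ] ℝ) (Cotangent E M)) :
      GaugeSec E E (TangentSpace 𝓘(ℝ, E) : M → Type _) := ⟨_, Sec.jetLift_mem P.sharp ν.2⟩
  have lift_jet (γ : OneForm E M) : lift (JetSec.jet γ) = VF.adGauge (P.vf γ) :=
    Subtype.ext (funext (Sec.jetLift_jet P.sharp γ))
  have lift_jetBracket : lift (P.algebroid.jetBracket (JetSec.jet α) (JetSec.jet β)) =
      GaugeSec.bracket (lift (JetSec.jet α)) (lift (JetSec.jet β)) := calc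
    _ = lift (JetSec.jet (P.bracket α β)) := congrArg lift (P.algebroid.jetBracket_jet α β)
    _ = VF.adGauge (P.vf (P.bracket α β)) := lift_jet (P.bracket α β)
    _ = VF.adGauge ((P.vf α).bracket (P.vf β)) := congrArg VF.adGauge (P.vf_bracket α β)
    _ = GaugeSec.bracket (VF.adGauge (P.vf α)) (VF.adGauge (P.vf β)) := VF.adGauge_bracket _ _
    _ = GaugeSec.bracket (lift (JetSec.jet α)) (lift (JetSec.jet β)) :=
      (congrArg₂ GaugeSec.bracket (lift_jet α) (lift_jet β)).symm
  exact congrArg (fun δ : GaugeSec E E (TangentSpace 𝓘(ℝ, E) : M → Type _) => δ.1 m)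
    lift_jetBracket

theorem jetLift_isLift : P.IsLift (Sec.jetLift P.sharp) where
  isMorphism := P.jetLift_isMorphism
  left_square _ := Sec.jetLift_incl P.sharp
  right_square _ := Sec.anchor_jetLift P.sharp
  map_jet α X m := congrArg (fun d : TangentGauge E M m => d.1.1 X) (Sec.jetLift_jet P.sharp α m)

theorem jetLift_isIsomorphism (h : ∀ m, Function.Bijective (P.sharp m)) :
    P.cotangentJet.IsIsomorphism (tangentGauge E M) (Sec.jetLift P.sharp) :=
  P.cotangentJet_isLieAlgebroid.isSkewAlgebroid.isIsomorphism
    gaugeAlgebroid_isLieAlgebroid.isSkewAlgebroid P.jetLift_isMorphism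
    fun m => Sec.jetLift_bijective P.sharp (h m)

end PoissonStructure

end PoissonLift

section Symplectic

variable {E : Type*} [NormedAddCommGroup E] [NormedSpace ℝ E] [FiniteDimensional ℝ E]
  {M : Type*} [TopologicalSpace M] [ChartedSpace E M] [IsManifold 𝓘(ℝ, E) ∞ M] [T2Space M]

namespace SymplecticForm

variable (S : SymplecticForm E M)

theorem flat_swap (m : M) (x y : TangentSpace 𝓘(ℝ, E) m) : S.flat m x y = -S.flat m y x := by
  have flat_add_self : S.flat m x (x + y) + S.flat m y (x + y) = 0 :=
    (congrArg (fun L : Cotangent E M m => L (x + y)) ((S.flat m).map_add x y)).symm.trans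
      (S.alternating m (x + y))
  rw [map_add, map_add, S.alternating, S.alternating, zero_add, add_zero] at flat_add_self
  exact eq_neg_of_add_eq_zero_left flat_add_self

theorem flat_bijective (m : M) : Function.Bijective (S.flat m) := by
  have : FiniteDimensional ℝ (TangentSpace 𝓘(ℝ, E) m) := inferInstanceAs (FiniteDimensional ℝ E)
  have : FiniteDimensional ℝ (Cotangent E M m) := inferInstanceAs (FiniteDimensional ℝ (E →L[ℝ] ℝ))
  have flat_injective : Function.Injective (S.flat m).toLinearMap :=
    (injective_iff_map_eq_zero _).2 fun x hx =>
      S.nondegenerate m x fun y => congrArg (fun L : Cotangent E M m => L y) hx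
  have finrank_dual : Module.finrank ℝ (E →L[ℝ] ℝ) = Module.finrank ℝ E :=
    (LinearMap.toContinuousLinearMap (𝕜 := ℝ) (E := E) (F' := ℝ)).finrank_eq.symm.trans
      Subspace.dual_finrank_eq
  exact ⟨flat_injective,
    (LinearMap.injective_iff_surjective_of_finrank_eq_finrank finrank_dual.symm).1 flat_injective⟩

/-- The isomorphism `x ↦ ω(x, ·)`. -/
def flatEquiv (m : M) : TangentSpace 𝓘(ℝ, E) m ≃ₗ[ℝ] Cotangent E M m :=
  LinearEquiv.ofBijective (S.flat m).toLinearMap (S.flat_bijective m)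

theorem exists_clm_eq_flatEquiv_symm (m : M) :
    ∃ A : Cotangent E M m →L[ℝ] TangentSpace 𝓘(ℝ, E) m,
      A.toLinearMap = (S.flatEquiv m).symm.toLinearMap :=
  have : T2Space (Cotangent E M m) := FiberBundle.t2Space (E →L[ℝ] ℝ) (Cotangent E M) m
  have : FiniteDimensional ℝ (Cotangent E M m) := inferInstanceAs (FiniteDimensional ℝ (E →L[ℝ] ℝ))
  ⟨LinearMap.toContinuousLinearMap (S.flatEquiv m).symm.toLinearMap, rfl⟩

theorem flatEquiv_symm_mem (α : OneForm E M) : (fun m => (S.flatEquiv m).symm (α m)) ∈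
    secSubmodule E E (TangentSpace 𝓘(ℝ, E) : M → Type _) :=
  isSectionSpace_secSubmodule.symm_mem isSectionSpace_secSubmodule S.flatEquiv
    (fun X hX => (S.flat.app ⟨X, hX⟩).contMDiff) (S := secSubmodule E E _)
    (SB := secSubmodule E (E →L[ℝ] ℝ) (Cotangent E M)) α.contMDiff

theorem exists_bivector_sharp_flat : ∃ P : Bivector E M,
    ∀ (m : M) (x : TangentSpace 𝓘(ℝ, E) m), P.sharp m (S.flat m x) = x := by
  choose A hA using S.exists_clm_eq_flatEquiv_symm
  have A_apply (m : M) (α : Cotangent E M m) : A m α = (S.flatEquiv m).symm α :=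
    congrArg (fun L : Cotangent E M m →ₗ[ℝ] TangentSpace 𝓘(ℝ, E) m => L α) (hA m)
  have A_flat (m : M) (x : TangentSpace 𝓘(ℝ, E) m) : A m (S.flat m x) = x :=
    (A_apply m _).trans ((S.flatEquiv m).symm_apply_apply x)
  refine ⟨⟨⟨A, contMDiff_hom_of_apply (V := Cotangent E M)
    (V' := (TangentSpace 𝓘(ℝ, E) : M → Type _)) A fun α => ?_⟩, fun m α β => ?_⟩, A_flat⟩
  · exact (S.flatEquiv_symm_mem α : ContMDiff _ _ _ _).congr fun m =>
      congrArg (TotalSpace.mk' E m) (A_apply m (α m))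
  · obtain ⟨x, rfl⟩ := (S.flat_bijective m).2 α
    obtain ⟨y, rfl⟩ := (S.flat_bijective m).2 β
    change S.flat m x (A m (S.flat m y)) = -S.flat m y (A m (S.flat m x))
    rw [A_flat, A_flat, S.flat_swap]

theorem sharp_bijective {P : Bivector E M} (hP : ∀ m x, P.sharp m (S.flat m x) = x) (m : M) :
    Function.Bijective (P.sharp m) :=
  (Function.Bijective.of_comp_iff (P.sharp m) (S.flat_bijective m)).1 <| by
    rw [show P.sharp m ∘ S.flat m = id from funext (hP m)]
    exact Function.bijective_id

theorem apply_flat_vf_d {P : Bivector E M} (hP : ∀ m x, P.sharp m (S.flat m x) = x)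
    (f : SmoothFun E M) (X : VF E M) :
    OneForm.apply (S.flat.app (P.vf (OneForm.d f))) X = X.deriv f := by
  refine ContMDiffMap.ext fun m => congrArg (fun α : Cotangent E M m => α (X m)) ?_
  exact (S.sharp_bijective hP m).1 (hP m (P.sharp m (OneForm.d f m)))

theorem apply_flat_bracket_vf_d {P : Bivector E M} (hP : ∀ m x, P.sharp m (S.flat m x) = x)
    (f g h : SmoothFun E M) (m : M) :
    OneForm.apply (S.flat.app ((P.vf (OneForm.d f)).bracket (P.vf (OneForm.d g))))
        (P.vf (OneForm.d h)) m =
      -(P.poisson f (P.poisson g h) m - P.poisson g (P.poisson f h) m) := calc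
  _ = -OneForm.apply (S.flat.app (P.vf (OneForm.d h)))
        ((P.vf (OneForm.d f)).bracket (P.vf (OneForm.d g))) m := S.flat_swap m _ _
  _ = -((P.vf (OneForm.d f)).bracket (P.vf (OneForm.d g))).deriv h m := by
    rw [S.apply_flat_vf_d hP]
  _ = _ := congrArg Neg.neg (VF.bracket_deriv _ _ h m)

-- As `ω(Π df, X) = X f`, evaluating `dω` on `Π df, Π dg, Π dh` gives the Jacobiator.
theorem poisson_jacobi {P : Bivector E M} (hP : ∀ m x, P.sharp m (S.flat m x) = x)
    (f g h : SmoothFun E M) :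
    P.poisson f (P.poisson g h) + P.poisson g (P.poisson h f) +
      P.poisson h (P.poisson f g) = 0 := by
  refine ContMDiffMap.ext fun m => ?_
  change P.poisson f (P.poisson g h) m + P.poisson g (P.poisson h f) m +
    P.poisson h (P.poisson f g) m = 0
  let H (f : SmoothFun E M) : VF E M := P.vf (OneForm.d f)
  have deriv_H (f g : SmoothFun E M) : (H f).deriv g = P.poisson f g := rfl
  have flat_H (f : SmoothFun E M) (X : VF E M) :
      OneForm.apply (S.flat.app (H f)) X = X.deriv f := S.apply_flat_vf_d hP f X
  have flat_bracket (f g h : SmoothFun E M) :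
      OneForm.apply (S.flat.app ((H f).bracket (H g))) (H h) m =
        -(P.poisson f (P.poisson g h) m - P.poisson g (P.poisson f h) m) :=
    S.apply_flat_bracket_vf_d hP f g h m
  have closed : (H f).deriv (OneForm.apply (S.flat.app (H g)) (H h)) m -
      (H g).deriv (OneForm.apply (S.flat.app (H f)) (H h)) m +
      (H h).deriv (OneForm.apply (S.flat.app (H f)) (H g)) m -
      OneForm.apply (S.flat.app ((H f).bracket (H g))) (H h) m +
      OneForm.apply (S.flat.app ((H f).bracket (H h))) (H g) m -
      OneForm.apply (S.flat.app ((H g).bracket (H h))) (H f) m = 0 :=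
    congrArg (fun k : SmoothFun E M => k m) (S.closed (H f) (H g) (H h))
  simp only [flat_bracket, flat_H, deriv_H] at closed
  linarith [P.poisson_swap_right f h g m, P.poisson_swap_right g h f m,
    P.poisson_swap_right h g f m]

theorem exists_poissonStructure_sharp_flat : ∃ P : PoissonStructure E M,
    ∀ (m : M) (x : TangentSpace 𝓘(ℝ, E) m), P.sharp m (S.flat m x) = x :=
  let ⟨P, hP⟩ := S.exists_bivector_sharp_flat
  ⟨{ toBivector := P, jacobi := S.poisson_jacobi hP }, hP⟩

end SymplecticForm

end Symplectic

end

theorem mainTheorem8 {E : Type*} [NormedAddCommGroup E] [NormedSpace ℝ E] [FiniteDimensional ℝ E]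
    {M : Type*} [TopologicalSpace M] [T2Space M] [ChartedSpace E M] [IsManifold 𝓘(ℝ, E) ∞ M] :
    (∀ P : PoissonStructure E M,
      -- both bundles are Lie algebroids
      P.cotangentJet.IsLieAlgebroid ∧ (tangentGauge E M).IsLieAlgebroid ∧
      -- the rows of the diagram are exact
      (∀ m : M,
        Function.Injective (Jet.incl : HomTangentCotangent E M m → CotangentJet E M m) ∧
        (∀ ν : CotangentJet E M m, Jet.proj ν = 0 ↔ ∃ y, Jet.incl y = ν) ∧
        Function.Surjective (Jet.proj : CotangentJet E M m →ₗ[ℝ] Cotangent E M m)) ∧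
      (∀ m : M,
        Function.Injective (Gauge.ofEnd :
          (TangentSpace 𝓘(ℝ, E) m →ₗ[ℝ] TangentSpace 𝓘(ℝ, E) m) →ₗ[ℝ] TangentGauge E M m) ∧
        (∀ d : TangentGauge E M m, Gauge.anchor d = 0 ↔ ∃ Φ, Gauge.ofEnd Φ = d) ∧
        Function.Surjective
          (Gauge.anchor : TangentGauge E M m →ₗ[ℝ] TangentSpace 𝓘(ℝ, E) m)) ∧
      -- the morphism, which is an isomorphism when `Π` is nondegenerate
      ∃ φ : ∀ m, CotangentJet E M m →ₗ[ℝ] TangentGauge E M m, P.IsLift φ ∧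
        ((∀ m, Function.Bijective (P.sharp m)) →
          P.cotangentJet.IsIsomorphism (tangentGauge E M) φ)) ∧
    -- the case of a symplectic manifold, with the Poisson structure inverse to the symplectic form
    (∀ S : SymplecticForm E M, ∃ P : PoissonStructure E M,
      (∀ (m : M) (x : TangentSpace 𝓘(ℝ, E) m), P.sharp m (S.flat m x) = x) ∧
      ∃ φ : ∀ m, CotangentJet E M m →ₗ[ℝ] TangentGauge E M m, P.IsLift φ ∧
        P.cotangentJet.IsIsomorphism (tangentGauge E M) φ) := by
  refine ⟨fun P => ⟨P.cotangentJet_isLieAlgebroid, gaugeAlgebroid_isLieAlgebroid,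
    fun m => ⟨Jet.incl_injective m, Jet.proj_eq_zero_iff, Jet.proj_surjective m⟩,
    fun m => ⟨Gauge.ofEnd_injective m, Gauge.exact_ofEnd_anchor m, Gauge.anchor_surjective m⟩,
    Sec.jetLift P.sharp, P.jetLift_isLift, P.jetLift_isIsomorphism⟩, fun S => ?_⟩
  obtain ⟨P, hP⟩ := S.exists_poissonStructure_sharp_flat
  exact ⟨P, hP, Sec.jetLift P.sharp, P.jetLift_isLift,
    P.jetLift_isIsomorphism (S.sharp_bijective hP)⟩
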